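/- **Notation.** Fix $d\ge 1$, $\mathbb T^d=\mathbb R^d/\mathbb Z^d$, $2\mathbb T^d=\mathbb R^d/2\mathbb Z^d$. For $\rho>0$, $C^\omega_\rho(N\mathbb T^d,\ast)$ ($N=1,2$) is the set of $\ast$-valued functions on $N\mathbb T^d$ having a bounded holomorphic extension to $\{|\Im x|<\rho\}$ (where $|\Im x|=\max_i|\Im x_i|$); $\|F\|_\rho=\sup_{|\Im x|<\rho}\|F(x)\|$ with the operator norm, and $C^\omega=\bigcup_{\rho>0}C^\omega_\rho$. $[\cdot]$ is the average with respect to normalized Lebesgue measure. The cocycle $(\omega,A)$, $\omega\in\mathbb R^d$, is analytically conjugated into $(\omega,B)$ by $Z\in C^\omega(2\mathbb T^d,\mathrm{SL}(2,\mathbb R))$ if $Z(x+\omega)^{-1}A(x)Z(x)=B(x)$ for all $x$. **Admissibility.** Let $A_0\in \mathrm{sl}(2,\mathbb R)$, $\rho_0>0$, and let $C,S:\mathrm{sl}(2,\mathbb R)\to \mathrm{sl}(2,\mathbb R)$ be linear with $C^2=C$. The quartet $(A_0,C,S,\omega)$ is admissible with constants $c',\nu>0$ (on strips of width at most $\rho_0$)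 if for every $0<\rho\le\rho_0$ and every $P\in C^\omega_\rho(\mathbb T^d,\mathrm{sl}(2,\mathbb R))$ the equations $$-e^{-A_0}X(x+\omega)e^{A_0}+X(x)=-(P(x)-C([P])),\qquad [X]=S([P])$$ have a unique real analytic solution $X:2\mathbb T^d\to \mathrm{sl}(2,\mathbb R)$, and it satisfies $\|X\|_{\rho-r}\le c'\|P\|_\rho\, r^{-\nu}$ for all $0<r<\rho$. **Theorem.** Let $A_0=\begin{pmatrix}0&c\\0&0\end{pmatrix}$ with $c\in\mathbb R$, and let $c',\nu>0$. There is a constant $\tilde c=\tilde c(A_0,c',\nu)>0$, and for every $\rho_0>0$ there is $\epsilon=\epsilon(A_0,\rho_0,c',\nu)>0$ (both may depend on the fixed dimension $d$), such that the following holds for all $\omega\in\mathbb R^d$, all $C,S$ for which $(A_0,C,S,\omega)$ is admissible with constants $c',\nu$ on strips of width at most $\rho_0$, and all integers $p\ge 0$ (with $\chi^0=1$). To every $f\in C^\omega_{\rho_0}(\mathbb T^d,\mathrm{sl}(2,\mathbb R))$ with $\|f\|_{\rho_0}\le\epsilon$ and every real $\chi$ with $|\chi|\le1$ one can assign $\xi^*=\xi^*(f,\chi)\in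 \mathrm{sl}(2,\mathbb R)$ with $C(\xi^*)=\xi^*$ and $X=X(f,\chi)\in C^\omega_{\rho_0/2}(2\mathbb T^d,\mathrm{sl}(2,\mathbb R))$ with $$\|X\|_{\rho_0/2}\le\tilde c\,\epsilon\,\rho_0^{-\nu},$$ such that the cocycle $(\omega,\,e^{\chi^pA_0}e^{\chi^{p+1}f(x)}e^{-\chi^{p+1}\xi^*})$ is analytically conjugated into $(\omega,e^{\chi^pA_0})$ by $Z(x)=e^{\chi X(x)}$. Moreover, the assignment can be made so that: whenever $f=f_\zeta$ (as an element of $C^\omega_{\rho_0}$) and $\chi=\chi(\zeta)$ depend analytically on $\zeta\in\mathbb R^2$ in a neighborhood of the origin, with $\|f_\zeta\|_{\rho_0}\le\epsilon$ and $|\chi(\zeta)|\le1$ there, then $\xi^*(f_\zeta,\chi(\zeta))$ and $X(f_\zeta,\chi(\zeta))$ (as an element of $C^\omega_{\rho_0/2}$) depend analytically on $\zeta$ in a possibly smaller neighborhood of the origin. Here a family $f_\zeta\in C^\omega_\rho$ depends analytically on $\zeta$ near $0$ if it extends to a bounded jointly holomorphic function on $\{|\zeta|<\delta\}\times\{|\Im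 x|<\rho\}$ for some $\delta>0$, where $\{|\zeta|<\delta\}\subset\mathbb C^2$. -/

import Mathlib

open scoped Matrix.Norms.L2Operator Topology

/-- Real `2 × 2` matrices. -/
abbrev Mat2 : Type := Matrix (Fin 2) (Fin 2) ℝ

/-- The Lie algebra `sl(2,ℝ)` of trace-zero real `2 × 2` matrices. -/
abbrev SL2Alg : Type := LieAlgebra.SpecialLinear.sl (Fin 2) ℝ

/-- The complex strip `|Im z| < ρ` around `ℝ^d` (maximum norm of the imaginary parts). -/
def strip (d : ℕ) (ρ : ℝ) : Set (Fin d → ℂ) := {z | ∀ i, |(z i).im| < ρ}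

/-- A real point (or parameter) regarded as a complex one. -/
def toC {n : ℕ} (x : Fin n → ℝ) : Fin n → ℂ := fun i => (x i : ℂ)

/-- `‖f‖_ρ ≤ M`: the matrix function `f` has a holomorphic extension to the strip `|Im z| < ρ`
whose operator norm is bounded by `M` there.  (The extension is unique.) -/
def StripNormLE {d : ℕ} (ρ : ℝ) (f : (Fin d → ℝ) → Mat2) (M : ℝ) : Prop :=
  ∃ F : (Fin d → ℂ) → Matrix (Fin 2) (Fin 2) ℂ,
    DifferentiableOn ℂ F (strip d ρ) ∧
    (∀ x : Fin d → ℝ, F (toC x) = (f x).map Complex.ofReal) ∧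
    ∀ z ∈ strip d ρ, ‖F z‖ ≤ M

/-- Functions on `ℝ^d` that are periodic with respect to `N ℤ^d`, i.e. functions on `N 𝕋^d`. -/
def TorusPeriodic {d : ℕ} {α : Type*} (N : ℕ) (f : (Fin d → ℝ) → α) : Prop :=
  ∀ (x : Fin d → ℝ) (k : Fin d → ℤ), f (x + fun i => (N : ℝ) * (k i : ℝ)) = f x

/-- `f ∈ C^ω_ρ(N 𝕋^d)`: a bounded holomorphic extension to the strip of width `ρ` exists. -/
def IsAnalyticWidth {d : ℕ} (N : ℕ) (ρ : ℝ) (f : (Fin d → ℝ) → Mat2) : Prop :=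
  TorusPeriodic N f ∧ ∃ M : ℝ, StripNormLE ρ f M

/-- `f ∈ C^ω(N 𝕋^d) = ⋃_{ρ > 0} C^ω_ρ(N 𝕋^d)`. -/
def IsAnalyticTorus {d : ℕ} (N : ℕ) (f : (Fin d → ℝ) → Mat2) : Prop :=
  ∃ ρ : ℝ, 0 < ρ ∧ IsAnalyticWidth N ρ f

/-- The average `[f]` of `f : N 𝕋^d → sl(2,ℝ)` with respect to normalized Lebesgue measure. -/
noncomputable def torusMean {d : ℕ} (N : ℕ) (f : (Fin d → ℝ) → SL2Alg) : SL2Alg :=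
  ⟨Matrix.of fun i j =>
      ⨍ x in Set.Icc (0 : Fin d → ℝ) (fun _ => (N : ℝ)), (f x : Mat2) i j, by
    have h : ∀ x, (f x : Mat2) 1 1 = -(f x : Mat2) 0 0 := by
      intro x
      have hx : Matrix.trace (f x : Mat2) = 0 := (f x).2
      rw [Matrix.trace_fin_two] at hx
      linarith
    change Matrix.trace (_ : Mat2) = 0
    rw [Matrix.trace_fin_two]
    simp only [Matrix.of_apply, h, MeasureTheory.average_neg]
    ring⟩

/-- `X : 2𝕋^d → sl(2,ℝ)` is a real analytic solution of
`-e^{-A₀} X(x+ω) e^{A₀} + X(x) = -(P(x) - C([P]))`, `[X] = S([P])`. -/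
def IsHomologicalSolution {d : ℕ} (ω : Fin d → ℝ) (A₀ : SL2Alg) (C S : SL2Alg →ₗ[ℝ] SL2Alg)
    (P X : (Fin d → ℝ) → SL2Alg) : Prop :=
  IsAnalyticTorus 2 (fun x => (X x : Mat2)) ∧
  (∀ x : Fin d → ℝ,
    -(NormedSpace.exp (-(A₀ : Mat2)) * (X (x + ω) : Mat2) * NormedSpace.exp (A₀ : Mat2))
      + (X x : Mat2) = -((P x : Mat2) - (C (torusMean 1 P) : Mat2))) ∧
  torusMean 2 X = S (torusMean 1 P)

/-- The quartet `(A₀, C, S, ω)` is admissible with constants `c', ν` on strips of width at most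
`ρ₀`: `C² = C`, and for every `P ∈ C^ω_ρ(𝕋^d, sl(2,ℝ))` with `0 < ρ ≤ ρ₀` the homological
equation has a unique real analytic solution `X` on `2𝕋^d`, which satisfies
`‖X‖_{ρ-r} ≤ c' ‖P‖_ρ / r^ν` for all `0 < r < ρ`. -/
def IsAdmissible {d : ℕ} (ω : Fin d → ℝ) (A₀ : SL2Alg) (C S : SL2Alg →ₗ[ℝ] SL2Alg)
    (c' ν ρ₀ : ℝ) : Prop :=
  (∀ Y, C (C Y) = C Y) ∧
  ∀ ρ : ℝ, 0 < ρ → ρ ≤ ρ₀ → ∀ P : (Fin d → ℝ) → SL2Alg,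
    IsAnalyticWidth 1 ρ (fun x => (P x : Mat2)) →
    ∃ X : (Fin d → ℝ) → SL2Alg,
      IsHomologicalSolution ω A₀ C S P X ∧
      (∀ Y, IsHomologicalSolution ω A₀ C S P Y → Y = X) ∧
      ∀ M : ℝ, StripNormLE ρ (fun x => (P x : Mat2)) M →
        ∀ r : ℝ, 0 < r → r < ρ →
          StripNormLE (ρ - r) (fun x => (X x : Mat2)) (c' * M / r ^ ν)

/-- The matrix `(0 c; 0 0)` as an element of `sl(2,ℝ)`. -/
def nilpotentA (c : ℝ) : SL2Alg :=
  ⟨!![0, c; 0, 0], by change Matrix.trace (_ : Mat2) = 0; simp [Matrix.trace_fin_two]⟩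

/-- The cocycle `(ω, A)` is analytically conjugated into `(ω, B)` by
`Z ∈ C^ω(2𝕋^d, SL(2,ℝ))`: `Z(x+ω)⁻¹ A(x) Z(x) = B(x)`. -/
def AnalyticallyConjugatedBy {d : ℕ} (ω : Fin d → ℝ) (A B Z : (Fin d → ℝ) → Mat2) : Prop :=
  IsAnalyticTorus 2 Z ∧ (∀ x, (Z x).det = 1) ∧ ∀ x, (Z (x + ω))⁻¹ * A x * Z x = B x

/-- `f ζ ∈ C^ω_ρ`, depending analytically on `ζ ∈ ℝ²` near the origin (as a function with
values in the Banach space of bounded holomorphic functions on the strip): there is a bounded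
jointly holomorphic extension to `{|ζ| < δ} × {|Im z| < ρ}`. -/
def AnalyticFamilyNearZero {d : ℕ} (ρ : ℝ) (f : (Fin 2 → ℝ) → (Fin d → ℝ) → Mat2) : Prop :=
  ∃ (δ M : ℝ) (F : (Fin 2 → ℂ) × (Fin d → ℂ) → Matrix (Fin 2) (Fin 2) ℂ),
    0 < δ ∧
    DifferentiableOn ℂ F (Metric.ball 0 δ ×ˢ strip d ρ) ∧
    (∀ w ∈ Metric.ball (0 : Fin 2 → ℂ) δ ×ˢ strip d ρ, ‖F w‖ ≤ M) ∧
    ∀ ζ : Fin 2 → ℝ, ‖ζ‖ < δ → ∀ x : Fin d → ℝ,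
      F (toC ζ, toC x) = (f ζ x).map Complex.ofReal

/-! The conjugacy is built by an iteration of KAM type that carries a counterterm. Write `t = χ^p`,
`s = χ t`, and let `T = 1 + t N` be the exponential of `t A₀`, where `N` is the nilpotent matrix. A
state consists of a conjugacy `Z = 1 + χ U`, a trace-zero counterterm `κ` and an error `h`, tied by
the exact relation `T e^{s f} cay(-(s/2) κ) Z = Z(· + ω) T (1 + s h)`. In the limit `h = 0`.

The first obstacle is that admissibility concerns `A₀`, whereas each step needs the linearized
equation for `t A₀`, uniformly down to `t = 0`. Conjugation by a diagonal matrix would rescale `A₀`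
to `t A₀`, but it is singular at `t = 0`. Since the equation is triangular in the matrix entries,
the three entries of the centred right-hand side can instead be treated separately; reassembling the
pieces gives a solution that is a cubic polynomial in `t` (`scaledReal_eq`, `scaledSol_eq`).
Admissibility is also the only source of arithmetic information. Its uniqueness clause forces
functions invariant under translation by `ω` to be constant (`const_of_invariant`), makes the
solutions 1-periodic (`homSol_periodic`) and linear in the data; on constants it bounds both `S` and
`C` (`norm_S_le`, `norm_C_le`), so smallness can be fixed before `C`, `S` and `ω` are known.

The second obstacle is uniformity and analyticity at `χ = 0`: no step may divide by `χ` or `s`. The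
group elements are therefore Cayley transforms. A quotient of two of them is an exact rational
expression in which the factor `s` is visible (`CMat2.cay_neg_mul_cay_eq`), and the condition of
determinant one is recorded in the divided form `CMat2.Unimod`. That condition makes the trace of
`h` quadratically small, so only its trace-zero part enters the linear equation.

A step reduces the error by the factor `120 τ Q` (`CMat2.norm_errStep_le`). Convergence is only
geometric: the counterterm stands on the far side of `Z`, so its update is distorted by the
accumulated conjugacy, and `τ` does not tend to zero. This suffices, because the strip is narrowed
by `ρ₀/4 · 2^{-n}` at step `n`, and a contraction rate `2^{-ν-1}` beats the loss `r^{-ν}` by a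
further `2^{-n}` (`kamRate_pow_div`, `KamHyp.kamInv_succ`). The limit has the form `1 + χ U`, and
explicit inverses of the Cayley transform and of the exponential yield `X` with `e^{χ X} = 1 + χ U`
(`CMat2.exp_log_conj`). The logarithm of the counterterm is a real scalar multiple of it, hence
still fixed by `C` (`KamHyp.counterLog_spec`).

For analytic dependence the whole iteration is run for holomorphic families with complex parameters.
The real solution operators are complexified (`RealOp.bddOp`), bounded linear operators preserve
joint holomorphy (`BddOp.family`), and uniform limits do too (`differentiableOn_of_uniform_limit`).
Real data remain real (`KamHyp.kam_real`), so a single complex scheme gives both the existence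
statement and the dependence on parameters. -/

section Helpers

open Metric Filter Set

/-! ### Cauchy and Schwarz estimates, Weierstrass limits and an identity theorem in Banach spaces.
-/

section ComplexAnalysis

variable {E F G : Type*} [NormedAddCommGroup E] [NormedSpace ℂ E]
  [NormedAddCommGroup F] [NormedSpace ℂ F] [NormedAddCommGroup G] [NormedSpace ℂ G]

theorem norm_fderiv_le_of_bounded {φ : E → F} {c : E} {R M : ℝ} (hR : 0 < R)
    (hd : DifferentiableOn ℂ φ (ball c R)) (hM : ∀ z ∈ ball c R, ‖φ z‖ ≤ M) :
    ‖fderiv ℂ φ c‖ ≤ 2 * M / R := by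
  refine Complex.norm_fderiv_le_div_of_mapsTo_ball hd (fun z hz => ?_) hR
  rw [mem_closedBall, dist_eq_norm]
  have h1 := hM z hz
  have h2 := hM c (mem_ball_self hR)
  linarith [norm_sub_le (φ z) (φ c)]

theorem norm_sub_le_of_bounded {φ : E → F} {c : E} {R M : ℝ} (hR : 0 < R)
    (hd : DifferentiableOn ℂ φ (ball c R)) (hM : ∀ z ∈ ball c R, ‖φ z‖ ≤ M) {z : E}
    (hz : z ∈ ball c R) : ‖φ z - φ c‖ ≤ 2 * M / R * ‖z - c‖ := by
  rw [← dist_eq_norm, ← dist_eq_norm]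
  refine Complex.dist_le_div_mul_dist_of_mapsTo_ball hd (fun z hz => ?_) hz
  rw [mem_closedBall, dist_eq_norm]
  have h1 := hM z hz
  have h2 := hM c (mem_ball_self hR)
  linarith [norm_sub_le (φ z) (φ c)]

/-- Once its linear part is removed, the map vanishes to second order at `c` and is bounded by `4
M`: `M` for `φ`, `M` for `φ c` and `2 M` for the linear part. The second-order Schwarz lemma then
applies. The remainder is uniform in any auxiliary variable, which is how it is used below. -/
theorem norm_taylor_one_le {φ : E → F} {c : E} {R M : ℝ} (hR : 0 < R)
    (hd : DifferentiableOn ℂ φ (ball c R)) (hM : ∀ z ∈ ball c R, ‖φ z‖ ≤ M) {z : E}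
    (hz : z ∈ ball c R) :
    ‖φ z - φ c - fderiv ℂ φ c (z - c)‖ ≤ 4 * M * (‖z - c‖ / R) ^ 2 := by
  have hdc : HasFDerivAt φ (fderiv ℂ φ c) c :=
    (hd.differentiableAt (ball_mem_nhds c hR)).hasFDerivAt
  have key := Complex.dist_le_mul_div_pow_of_mapsTo_ball_of_isLittleO (n := 1) (R₂ := 4 * M)
    (f := fun w => φ w - fderiv ℂ φ c (w - c)) (c := c) (R₁ := R)
    (hd.sub (by fun_prop)) ?_ ?_ hz
  · simp only [dist_eq_norm, sub_self, map_zero, sub_zero] at key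
    rw [sub_right_comm]
    exact key
  · intro w hw
    rw [mem_closedBall, dist_eq_norm]
    have h1 := hM w hw
    have h2 := hM c (mem_ball_self hR)
    have h3 := norm_fderiv_le_of_bounded hR hd hM
    have hM0 : 0 ≤ M := (norm_nonneg _).trans h2
    have h4 : ‖fderiv ℂ φ c (w - c)‖ ≤ 2 * M := by
      refine ((fderiv ℂ φ c).le_opNorm _).trans ?_
      have h5 : ‖w - c‖ ≤ R := by rw [← dist_eq_norm]; exact (mem_ball.1 hw).le
      calc ‖fderiv ℂ φ c‖ * ‖w - c‖ ≤ (2 * M / R) * R := by gcongr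
        _ = 2 * M := by field_simp
    simp only [sub_self, map_zero, sub_zero]
    have h6 := norm_sub_le (φ w - fderiv ℂ φ c (w - c)) (φ c)
    have h7 := norm_sub_le (φ w) (fderiv ℂ φ c (w - c))
    linarith
  · have := hdc.isLittleO
    simp only [sub_self, map_zero, sub_zero, pow_one]
    refine (this.norm_right).congr_left fun w => ?_
    abel

/-- Weierstrass' theorem: Cauchy estimates on smaller balls turn uniform closeness of the functions
into a uniformly Cauchy sequence of derivatives. -/
theorem differentiableOn_of_uniform_limit [CompleteSpace F] {V : Set E} (hV : IsOpen V)
    {f : ℕ → E → F} {g : E → F} {b : ℕ → ℝ} (hf : ∀ n, DifferentiableOn ℂ (f n) V)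
    (hb : Tendsto b atTop (𝓝 0)) (hfg : ∀ n, ∀ x ∈ V, ‖f n x - g x‖ ≤ b n) :
    DifferentiableOn ℂ g V := by
  intro x hx
  obtain ⟨r, hr, hrV⟩ := Metric.isOpen_iff.1 hV x hx
  set s := r / 2 with hs
  have hs0 : 0 < s := by positivity
  have hsub : ∀ y ∈ ball x s, ball y s ⊆ V := fun y hy =>
    (ball_subset_ball' (by rw [mem_ball] at hy; linarith)).trans hrV
  have hder : ∀ n m, ∀ y ∈ ball x s,
      ‖fderiv ℂ (f n) y - fderiv ℂ (f m) y‖ ≤ 2 * (b n + b m) / s := by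
    intro n m y hy
    have hyV : V ∈ 𝓝 y := hV.mem_nhds (hsub y hy (mem_ball_self hs0))
    rw [← fderiv_sub ((hf n).differentiableAt hyV) ((hf m).differentiableAt hyV)]
    refine norm_fderiv_le_of_bounded hs0 (((hf n).sub (hf m)).mono (hsub y hy)) fun z hz => ?_
    have h1 := hfg n z (hsub y hy hz)
    have h2 := hfg m z (hsub y hy hz)
    have : (f n - f m) z = (f n z - g z) - (f m z - g z) := by simp
    rw [this]
    exact (norm_sub_le _ _).trans (add_le_add h1 h2)
  have hcau : UniformCauchySeqOn (fun n => fderiv ℂ (f n)) atTop (ball x s) := by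
    rw [Metric.uniformCauchySeqOn_iff]
    intro ε hε
    have : ∀ᶠ n in atTop, |b n| < ε * s / 4 := by
      have := (tendsto_order.1 hb.abs).2 (ε * s / 4) (by simp; positivity)
      exact this
    obtain ⟨N, hN⟩ := eventually_atTop.1 this
    refine ⟨N, fun m hm n hn y hy => ?_⟩
    rw [dist_eq_norm]
    refine (hder m n y hy).trans_lt ?_
    have h1 := (abs_lt.1 (hN m hm)).2
    have h2 := (abs_lt.1 (hN n hn)).2
    rw [div_lt_iff₀ hs0]
    linarith
  have hlim : ∀ y ∈ ball x s, ∃ L, Tendsto (fun n => fderiv ℂ (f n) y) atTop (𝓝 L) :=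
    fun y hy => cauchySeq_tendsto_of_complete (hcau.cauchySeq hy)
  choose! g' hg' using hlim
  have hunif : TendstoUniformlyOn (fun n => fderiv ℂ (f n)) g' atTop (ball x s) :=
    hcau.tendstoUniformlyOn_of_tendsto hg'
  have := hasFDerivAt_of_tendstoUniformlyOn isOpen_ball hunif
    (fun n y hy => ((hf n).differentiableAt
      (hV.mem_nhds (hsub y hy (mem_ball_self hs0)))).hasFDerivAt)
    (g := g) (fun y hy => by
      rw [tendsto_iff_norm_sub_tendsto_zero]
      exact squeeze_zero (fun _ => norm_nonneg _)
        (fun n => hfg n y (hsub y hy (mem_ball_self hs0))) hb)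
    (mem_ball_self hs0)
  exact this.differentiableAt.differentiableWithinAt

/-- Identity theorem along the real direction `p + ℝ q`. -/
theorem eq_zero_of_eq_zero_on_real_line [CompleteSpace F] {V : Set E} (hV : IsOpen V)
    (hc : Convex ℝ V) {f : E → F} (hf : DifferentiableOn ℂ f V) {p q : E} (hp : p ∈ V)
    (hq : p + Complex.I • q ∈ V) (h0 : ∀ s : ℝ, p + (s : ℂ) • q ∈ V → f (p + (s : ℂ) • q) = 0) :
    f (p + Complex.I • q) = 0 := by
  set ℓ : ℂ → E := fun s => p + s • q with hℓ
  have hℓd : Differentiable ℂ ℓ := by fun_prop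
  set W : Set ℂ := ℓ ⁻¹' V with hW
  have hWo : IsOpen W := hV.preimage hℓd.continuous
  have hWc : Convex ℝ W := by
    intro a ha b hb u v hu hv huv
    have : ℓ (u • a + v • b) = u • ℓ a + v • ℓ b := by
      simp only [hℓ, smul_add, add_smul, ← smul_assoc]
      have : p = u • p + v • p := by rw [← add_smul, huv, one_smul]
      nth_rw 1 [this]
      abel
    change ℓ _ ∈ V
    rw [this]
    exact hc ha hb hu hv huv
  have han : AnalyticOnNhd ℂ (f ∘ ℓ) W :=
    (hf.comp hℓd.differentiableOn (fun _ h => h)).analyticOnNhd hWo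
  have h0W : (0 : ℂ) ∈ W := by simpa [hW, hℓ] using hp
  -- The real zeros `1 / (n + 1)` accumulate at `0`; the part of the complex line inside `V` is
  -- convex, hence connected, so the one-variable identity theorem reaches the parameter `I`.
  have hfreq : ∃ᶠ z in 𝓝[≠] (0 : ℂ), (f ∘ ℓ) z = 0 := by
    have ht : Tendsto (fun n : ℕ => ((1 / ((n : ℝ) + 1) : ℝ) : ℂ)) atTop (𝓝[≠] 0) := by
      rw [tendsto_nhdsWithin_iff]
      refine ⟨?_, .of_forall fun n => ?_⟩
      · have := (Complex.continuous_ofReal.tendsto 0).comp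
          (tendsto_one_div_add_atTop_nhds_zero_nat (𝕜 := ℝ))
        simpa [Function.comp_def] using this
      · simp only [mem_compl_iff, mem_singleton_iff, Complex.ofReal_eq_zero]
        positivity
    refine ht.frequently (Eventually.frequently ?_)
    have hnh : ∀ᶠ z in 𝓝[≠] (0 : ℂ), z ∈ W :=
      mem_nhdsWithin_of_mem_nhds (hWo.mem_nhds h0W)
    filter_upwards [ht.eventually hnh] with n hn
    exact h0 _ hn
  have := han.eqOn_zero_of_preconnected_of_frequently_eq_zero hWc.isPreconnected h0W hfreq
  exact this (show Complex.I ∈ W from hq)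

end ComplexAnalysis

/-! ### Analyticity of complex differentiable functions of two variables. -/

section Osgood

open scoped BoundedContinuousFunction

variable {G : Type*} [NormedAddCommGroup G] [NormedSpace ℂ G]

/-- The Taylor remainder is uniform in `θ`. Hence the pointwise derivative is a uniform limit of
continuous difference quotients and belongs to the function space, and the same remainder bounds the
increment in the sup norm. -/
theorem differentiableAt_boundedContinuousFunction {R M : ℝ} (hR : 0 < R) {c : ℂ}
    {g : ℂ → ℝ → G} (hd : ∀ θ, DifferentiableOn ℂ (fun ζ => g ζ θ) (ball c R))
    (hM : ∀ ζ ∈ ball c R, ∀ θ, ‖g ζ θ‖ ≤ M) {Γ : ℂ → ℝ →ᵇ G}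
    (hΓ : ∀ ζ ∈ ball c R, ∀ θ, Γ ζ θ = g ζ θ) : DifferentiableAt ℂ Γ c := by
  have hM0 : 0 ≤ M := (norm_nonneg _).trans (hM c (mem_ball_self hR) 0)
  set D : ℝ → G := fun θ => deriv (fun ζ => g ζ θ) c with hD
  have htay : ∀ z ∈ ball c R, ∀ θ, ‖g z θ - g c θ - (z - c) • D θ‖ ≤ 4 * M * (‖z - c‖ / R) ^ 2 := by
    intro z hz θ
    have := norm_taylor_one_le hR (hd θ) (fun w hw => hM w hw θ) hz
    rwa [fderiv_eq_smul_deriv] at this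
  have hDb : ∀ θ, ‖D θ‖ ≤ 2 * M / R := by
    intro θ
    have := norm_fderiv_le_of_bounded hR (hd θ) (fun w hw => hM w hw θ)
    rwa [← norm_deriv_eq_norm_fderiv] at this
  have hDc : Continuous D := by
    set τ : ℕ → ℝ := fun n => (R / 2) * (1 / ((n : ℝ) + 1)) with hτ
    have hτ0 : ∀ n, 0 < τ n := fun n => by positivity
    have hτR : ∀ n, τ n < R := fun n => by
      have : 1 / ((n : ℝ) + 1) ≤ 1 := by
        rw [div_le_one (by positivity)]; linarith [(Nat.cast_nonneg n : (0 : ℝ) ≤ n)]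
      calc τ n ≤ R / 2 * 1 := by simp only [hτ]; gcongr
        _ < R := by linarith
    have hτl : Tendsto τ atTop (𝓝 0) := by
      simpa [hτ] using (tendsto_one_div_add_atTop_nhds_zero_nat (𝕜 := ℝ)).const_mul (R / 2)
    have hmem : ∀ n, c + (τ n : ℂ) ∈ ball c R := fun n => by
      simp [abs_of_pos (hτ0 n), hτR n]
    have hlim : TendstoUniformly
        (fun n θ => ((τ n : ℂ)⁻¹) • (Γ (c + τ n) - Γ c : ℝ →ᵇ G) θ) D atTop := by
      rw [Metric.tendstoUniformly_iff]
      intro ε hε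
      have : ∀ᶠ n in atTop, 4 * M * τ n / R ^ 2 < ε := by
        have h := (hτl.const_mul (4 * M)).div_const (R ^ 2)
        simp only [mul_zero, zero_div] at h
        exact (tendsto_order.1 h).2 ε hε
      filter_upwards [this] with n hn θ
      have h1 := htay _ (hmem n) θ
      have hne : (τ n : ℂ) ≠ 0 := by exact_mod_cast (hτ0 n).ne'
      rw [BoundedContinuousFunction.sub_apply, hΓ _ (hmem n), hΓ _ (mem_ball_self hR), dist_comm,
        dist_eq_norm]
      have h2 : ((τ n : ℂ)⁻¹) • (g (c + τ n) θ - g c θ) - D θ =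
          ((τ n : ℂ)⁻¹) • (g (c + τ n) θ - g c θ - (c + τ n - c) • D θ) := by
        rw [add_sub_cancel_left, smul_sub _ _ ((τ n : ℂ) • D θ), smul_smul, inv_mul_cancel₀ hne,
          one_smul]
      rw [h2, norm_smul]
      refine lt_of_le_of_lt ?_ hn
      rw [add_sub_cancel_left] at h1 ⊢
      have h3 : ‖(τ n : ℂ)‖ = τ n := by simp [abs_of_pos (hτ0 n)]
      rw [h3] at h1
      rw [norm_inv, h3]
      calc (τ n)⁻¹ * _ ≤ (τ n)⁻¹ * (4 * M * (τ n / R) ^ 2) := by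
            gcongr
        _ = 4 * M * τ n / R ^ 2 := by have := (hτ0 n).ne'; field_simp
    refine hlim.continuous (Frequently.of_forall fun n => ?_)
    exact (Γ (c + τ n) - Γ c).continuous.const_smul _
  set D' : ℝ →ᵇ G := BoundedContinuousFunction.ofNormedAddCommGroup D hDc _ hDb
  have : HasDerivAt Γ D' c := by
    rw [hasDerivAt_iff_isLittleO]
    have hO : (fun z => Γ z - Γ c - (z - c) • D') =O[𝓝 c] fun z => ‖z - c‖ ^ 2 := by
      refine Asymptotics.IsBigO.of_bound (4 * M / R ^ 2) ?_
      filter_upwards [ball_mem_nhds c hR] with z hz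
      rw [BoundedContinuousFunction.norm_le (by positivity)]
      intro θ
      have := htay z hz θ
      simp only [BoundedContinuousFunction.sub_apply, BoundedContinuousFunction.smul_apply,
        hΓ z hz, hΓ c (mem_ball_self hR)]
      refine this.trans (le_of_eq ?_)
      rw [norm_pow, norm_norm]; ring
    refine hO.trans_isLittleO ?_
    exact Asymptotics.isLittleO_pow_sub_sub c (by norm_num)
  exact this.differentiableAt

/-- The pairing `(k, Φ) ↦ ∫ k Φ` over `[0, 2π]`. -/
noncomputable def circlePairing (G : Type*) [NormedAddCommGroup G] [NormedSpace ℂ G] :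
    (ℝ →ᵇ ℂ) →L[ℂ] (ℝ →ᵇ G) →L[ℂ] G :=
  LinearMap.mkContinuous₂
    (LinearMap.mk₂ ℂ (fun k Φ => ∫ θ in (0 : ℝ)..(2 * Real.pi), k θ • Φ θ)
      (fun k l Φ => by
        simp only [BoundedContinuousFunction.add_apply, add_smul]
        exact intervalIntegral.integral_add
          ((k.continuous.smul Φ.continuous).intervalIntegrable _ _)
          ((l.continuous.smul Φ.continuous).intervalIntegrable _ _))
      (fun a k Φ => by
        simp only [BoundedContinuousFunction.smul_apply, smul_eq_mul, mul_smul]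
        exact intervalIntegral.integral_smul _ _)
      (fun k Φ Ψ => by
        simp only [BoundedContinuousFunction.add_apply, smul_add]
        exact intervalIntegral.integral_add
          ((k.continuous.smul Φ.continuous).intervalIntegrable _ _)
          ((k.continuous.smul Ψ.continuous).intervalIntegrable _ _))
      (fun a k Φ => by
        simp only [BoundedContinuousFunction.smul_apply, smul_comm _ a]
        exact intervalIntegral.integral_smul _ _))
    (2 * Real.pi) (fun k Φ => by
      have h := intervalIntegral.norm_integral_le_of_norm_le_const (a := 0) (b := 2 * Real.pi)
        (C := ‖k‖ * ‖Φ‖) (f := fun θ => k θ • Φ θ) (fun θ _ => by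
          rw [norm_smul]
          exact mul_le_mul (k.norm_coe_le_norm θ) (Φ.norm_coe_le_norm θ) (norm_nonneg _)
            (norm_nonneg _))
      rw [sub_zero, abs_of_pos Real.two_pi_pos] at h
      simp only [LinearMap.mk₂_apply]
      linarith)

theorem circlePairing_apply (k : ℝ →ᵇ ℂ) (Φ : ℝ →ᵇ G) :
    circlePairing G k Φ = ∫ θ in (0 : ℝ)..(2 * Real.pi), k θ • Φ θ := rfl

/-- Cauchy's formula in the second variable writes `φ (ζ, w)` as a continuous bilinear pairing of a
kernel depending on `w` with boundary values depending on `ζ`. Each is a holomorphic map of one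
variable into a Banach space, hence analytic, and the pairing preserves analyticity. -/
theorem analyticAt_of_differentiableOn_prod [CompleteSpace G] {φ : ℂ × ℂ → G} {R M : ℝ}
    (hR : 0 < R) (hd : DifferentiableOn ℂ φ (ball 0 R ×ˢ ball 0 R))
    (hM : ∀ p ∈ (ball 0 R ×ˢ ball 0 R : Set (ℂ × ℂ)), ‖φ p‖ ≤ M) : AnalyticAt ℂ φ 0 := by
  set r := R / 2 with hr
  have hr0 : 0 < r := by positivity
  have hcm : ∀ θ, circleMap 0 r θ ∈ ball (0 : ℂ) R := fun θ => by
    simp [circleMap, abs_of_pos hr0]; linarith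
  have hΦc : ∀ ζ ∈ ball (0 : ℂ) R, Continuous fun θ : ℝ => φ (ζ, circleMap 0 r θ) := fun ζ hζ =>
    hd.continuousOn.comp_continuous (by fun_prop) (fun θ => ⟨hζ, hcm θ⟩)
  classical
  set Φ : ℂ → ℝ →ᵇ G := fun ζ => if h : ζ ∈ ball (0 : ℂ) R then
    BoundedContinuousFunction.ofNormedAddCommGroup (fun θ : ℝ => φ (ζ, circleMap 0 r θ))
      (hΦc ζ h) M (fun θ => hM _ ⟨h, hcm θ⟩) else 0 with hΦ
  have hΦa : ∀ ζ ∈ ball (0 : ℂ) R, ∀ θ, Φ ζ θ = φ (ζ, circleMap 0 r θ) := fun ζ hζ θ => by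
    simp only [hΦ, dif_pos hζ]; rfl
  have hden : ∀ ζ ∈ ball (0 : ℂ) (r / 2), ∀ θ, r / 2 ≤ ‖circleMap 0 r θ - ζ‖ := fun ζ hζ θ => by
    have h1 : ‖circleMap 0 r θ‖ = r := by simp [circleMap, abs_of_pos hr0]
    have h2 := norm_sub_norm_le (circleMap 0 r θ) ζ
    rw [mem_ball_zero_iff] at hζ
    linarith
  have hne : ∀ ζ ∈ ball (0 : ℂ) (r / 2), ∀ θ, circleMap 0 r θ - ζ ≠ 0 := fun ζ hζ θ h => by
    have := hden ζ hζ θ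
    rw [h, norm_zero] at this
    linarith
  set κ : ℂ → ℝ → ℂ := fun ζ θ => (circleMap 0 r θ * Complex.I) * (circleMap 0 r θ - ζ)⁻¹ with hκ
  have hκM : ∀ ζ ∈ ball (0 : ℂ) (r / 2), ∀ θ, ‖κ ζ θ‖ ≤ 2 := fun ζ hζ θ => by
    have h1 : ‖circleMap 0 r θ‖ = r := by simp [circleMap, abs_of_pos hr0]
    simp only [hκ, norm_mul, norm_inv, h1, Complex.norm_I, mul_one]
    rw [← div_eq_mul_inv, div_le_iff₀ (lt_of_lt_of_le (by positivity) (hden ζ hζ θ))]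
    linarith [hden ζ hζ θ]
  have hκc : ∀ ζ ∈ ball (0 : ℂ) (r / 2), Continuous (κ ζ) := fun ζ hζ => by
    refine Continuous.mul (by fun_prop) (Continuous.inv₀ (by fun_prop) (hne ζ hζ))
  set K : ℂ → ℝ →ᵇ ℂ := fun ζ => if h : ζ ∈ ball (0 : ℂ) (r / 2) then
    BoundedContinuousFunction.ofNormedAddCommGroup (κ ζ) (hκc ζ h) 2 (hκM ζ h) else 0 with hK
  have hKa : ∀ ζ ∈ ball (0 : ℂ) (r / 2), ∀ θ, K ζ θ = κ ζ θ := fun ζ hζ θ => by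
    simp only [hK, dif_pos hζ]; rfl
  have hΦd : DifferentiableOn ℂ Φ (ball 0 (R / 2)) := fun c hc => by
    have hsub : ball c (R / 2) ⊆ ball 0 R := ball_subset_ball' (by
      rw [mem_ball] at hc; linarith)
    refine (differentiableAt_boundedContinuousFunction (R := R / 2) (M := M) hr0
      (g := fun ζ θ => φ (ζ, circleMap 0 r θ)) (fun θ => ?_)
      (fun ζ hζ θ => hM _ ⟨hsub hζ, hcm θ⟩) (fun ζ hζ => hΦa ζ (hsub hζ))).differentiableWithinAt
    exact hd.comp (by fun_prop) (fun ζ hζ => ⟨hsub hζ, hcm θ⟩)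
  have hKd : DifferentiableOn ℂ K (ball 0 (r / 4)) := fun c hc => by
    have hsub : ball c (r / 4) ⊆ ball 0 (r / 2) := ball_subset_ball' (by
      rw [mem_ball] at hc; linarith)
    refine (differentiableAt_boundedContinuousFunction (R := r / 4) (M := 2) (by positivity)
      (g := κ) (fun θ => ?_)
      (fun ζ hζ θ => hκM _ (hsub hζ) θ) (fun ζ hζ => hKa ζ (hsub hζ))).differentiableWithinAt
    refine DifferentiableOn.const_mul (DifferentiableOn.inv (by fun_prop) ?_) _
    exact fun ζ hζ => hne ζ (hsub hζ) θ
  have hΦA : AnalyticAt ℂ Φ 0 :=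
    hΦd.analyticAt (ball_mem_nhds _ (by positivity))
  have hKA : AnalyticAt ℂ K 0 :=
    hKd.analyticAt (ball_mem_nhds _ (by positivity))
  have hA : AnalyticAt ℂ (fun p : ℂ × ℂ =>
      (2 * Real.pi * Complex.I : ℂ)⁻¹ • circlePairing G (K p.2) (Φ p.1)) 0 := by
    have h1 : AnalyticAt ℂ (fun p : ℂ × ℂ => Φ p.1) 0 :=
      AnalyticAt.fun_comp (g := Φ) (f := Prod.fst) hΦA analyticAt_fst
    have h2 : AnalyticAt ℂ (fun p : ℂ × ℂ => K p.2) 0 :=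
      AnalyticAt.fun_comp (g := K) (f := Prod.snd) hKA analyticAt_snd
    have h3 : AnalyticAt ℂ (fun p : ℂ × ℂ => circlePairing G (K p.2) (Φ p.1)) 0 :=
      AnalyticAt.comp₂ (h := fun x : (ℝ →ᵇ ℂ) × (ℝ →ᵇ G) => circlePairing G x.1 x.2)
        ((circlePairing G).analyticAt_bilinear _) h2 h1
    exact analyticAt_const.smul h3
  refine hA.congr ?_
  have hnh : (ball 0 (r / 2) ×ˢ ball 0 (r / 2) : Set (ℂ × ℂ)) ∈ 𝓝 (0 : ℂ × ℂ) :=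
    (isOpen_ball.prod isOpen_ball).mem_nhds ⟨mem_ball_self (by positivity),
      mem_ball_self (by positivity)⟩
  filter_upwards [hnh] with p hp
  have hp1 : p.1 ∈ ball (0 : ℂ) R := ball_subset_ball (by linarith) hp.1
  have hball : closedBall (0 : ℂ) r ⊆ ball 0 R := closedBall_subset_ball (by linarith)
  have hdd : DifferentiableOn ℂ (fun w => φ (p.1, w)) (closedBall 0 r) :=
    hd.comp (by fun_prop) (fun w hw => ⟨hp1, hball hw⟩)
  have hci := hdd.circleIntegral_sub_inv_smul (ball_subset_ball (by linarith) hp.2)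
  rw [inv_smul_eq_iff₀ Complex.two_pi_I_ne_zero]
  change _ = _ • (fun w => φ (p.1, w)) p.2
  rw [← hci, circlePairing_apply, circleIntegral]
  refine intervalIntegral.integral_congr fun θ _ => ?_
  simp only [hKa _ hp.2, hΦa _ hp1, hκ, deriv_circleMap, mul_smul]

theorem analyticAt_zero_of_differentiableOn [CompleteSpace G] {φ : (Fin 2 → ℂ) → G} {R : ℝ}
    (hR : 0 < R) (hd : DifferentiableOn ℂ φ (ball 0 R)) : AnalyticAt ℂ φ 0 := by
  have hcont : ContinuousAt φ 0 := (hd.differentiableAt (ball_mem_nhds _ hR)).continuousAt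
  obtain ⟨r, hr, hrb⟩ := Metric.continuousAt_iff.1 hcont 1 one_pos
  set s := min r R
  have hs : 0 < s := lt_min hr hR
  set ι : ℂ × ℂ → Fin 2 → ℂ := fun p => ![p.1, p.2] with hι
  have hιd : Differentiable ℂ ι := by
    rw [differentiable_pi]
    intro i
    fin_cases i
    · exact differentiable_fst
    · exact differentiable_snd
  have hmaps : ∀ p ∈ (ball 0 s ×ˢ ball 0 s : Set (ℂ × ℂ)), ι p ∈ ball (0 : Fin 2 → ℂ) s := by
    intro p hp
    rw [mem_ball_zero_iff, pi_norm_lt_iff hs]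
    intro i
    fin_cases i
    · simpa [hι] using hp.1
    · simpa [hι] using hp.2
  have h1 : AnalyticAt ℂ (φ ∘ ι) 0 := by
    refine analyticAt_of_differentiableOn_prod (R := s) (M := ‖φ 0‖ + 1) hs ?_ ?_
    · exact hd.comp hιd.differentiableOn
        fun p hp => ball_subset_ball (min_le_right _ _) (hmaps p hp)
    · intro p hp
      have := hrb (lt_of_lt_of_le (mem_ball.1 (hmaps p hp)) (min_le_left _ _))
      rw [dist_eq_norm] at this
      have h2 := norm_sub_norm_le (φ (ι p)) (φ 0)
      simp only [Function.comp]
      linarith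
  set π : (Fin 2 → ℂ) →L[ℂ] ℂ × ℂ :=
    (ContinuousLinearMap.proj 0).prod (ContinuousLinearMap.proj 1)
  have h2 : AnalyticAt ℂ ((φ ∘ ι) ∘ π) 0 :=
    AnalyticAt.comp (by rw [map_zero]; exact h1) (π.analyticAt 0)
  refine h2.congr (.of_forall fun z => ?_)
  simp only [Function.comp]
  congr 1
  ext i
  fin_cases i <;> rfl

end Osgood

/-! ### Holomorphic extension of real analytic functions of two variables. -/

section Complexification

variable {E F : Type*} [NormedAddCommGroup E] [NormedSpace ℂ E]
  [NormedAddCommGroup F] [NormedSpace ℂ F]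

theorem differentiableOn_tsum_of_bounded [CompleteSpace F] {V : Set E} (hV : IsOpen V)
    {f : ℕ → E → F} {u : ℕ → ℝ} (hu : Summable u) (hf : ∀ n, DifferentiableOn ℂ (f n) V)
    (hb : ∀ n, ∀ x ∈ V, ‖f n x‖ ≤ u n) : DifferentiableOn ℂ (fun x => ∑' n, f n x) V := by
  refine differentiableOn_of_uniform_limit hV
    (f := fun N x => ∑ n ∈ Finset.range N, f n x) (b := fun N => ∑' n, u (n + N))
    (fun N => DifferentiableOn.fun_sum fun n _ => hf n) (tendsto_sum_nat_add u) fun N x hx => ?_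
  have hs : Summable fun n => f n x := Summable.of_norm_bounded hu fun n => hb n x hx
  rw [← hs.sum_add_tsum_nat_add N, sub_add_cancel_left, norm_neg]
  exact tsum_of_norm_bounded ((summable_nat_add_iff N).2 hu).hasSum fun n => hb _ x hx

theorem norm_toC {n : ℕ} (x : Fin n → ℝ) : ‖toC x‖ = ‖x‖ := by
  simp [toC, Pi.norm_def]

/-- Each homogeneous term of the power series, expanded into monomials in the coordinates, makes
sense for complex arguments. Degree `n` contributes `2 ^ n` monomials, so the radius is cut to `r' /
4` to retain a factor `(1 / 2) ^ n`. -/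
theorem exists_holomorphic_extension {χ : (Fin 2 → ℝ) → ℝ} (h : AnalyticAt ℝ χ 0) :
    ∃ δ : ℝ, 0 < δ ∧ ∃ X : (Fin 2 → ℂ) → ℂ, DifferentiableOn ℂ X (ball 0 δ) ∧
      ∀ ζ : Fin 2 → ℝ, ‖ζ‖ < δ → X (toC ζ) = χ ζ := by
  obtain ⟨p, r, hp⟩ := h
  obtain ⟨r', hr'0, hr'⟩ := ENNReal.lt_iff_exists_nnreal_btwn.1 hp.r_pos
  have hr'pos : 0 < (r' : ℝ) := by exact_mod_cast hr'0
  obtain ⟨K, hK, hKb⟩ := p.norm_mul_pow_le_of_lt_radius (hr'.trans_le hp.r_le)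
  set P : ℕ → (Fin 2 → ℂ) → ℂ := fun n z =>
    ∑ σ : Fin n → Fin 2, ((p n (fun i => Pi.single (σ i) 1) : ℝ) : ℂ) * ∏ i, z (σ i) with hP
  have hPd : ∀ n, Differentiable ℂ (P n) := fun n => by
    simp only [hP]
    fun_prop
  have hPreal : ∀ n (ζ : Fin 2 → ℝ), P n (toC ζ) = ((p n (fun _ => ζ) : ℝ) : ℂ) := by
    intro n ζ
    have h1 : ζ = ∑ j, ζ j • (Pi.single j 1 : Fin 2 → ℝ) := by
      ext i
      fin_cases i <;> simp
    have h2 : p n (fun _ => ζ) = ∑ σ : Fin n → Fin 2,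
        (∏ i, ζ (σ i)) * p n (fun i => Pi.single (σ i) 1) := by
      conv_lhs => rw [h1]
      have := (p n).toMultilinearMap.map_sum
        (fun (_ : Fin n) (j : Fin 2) => ζ j • (Pi.single j 1 : Fin 2 → ℝ))
      refine this.trans (Finset.sum_congr rfl fun σ _ => ?_)
      exact (p n).toMultilinearMap.map_smul_univ (fun i => ζ (σ i)) _
    rw [h2]
    simp only [hP, toC]
    push_cast
    exact Finset.sum_congr rfl fun σ _ => mul_comm _ _
  have hPb : ∀ n, ∀ z ∈ ball (0 : Fin 2 → ℂ) (r' / 4), ‖P n z‖ ≤ K * (1 / 2) ^ n := by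
    intro n z hz
    rw [mem_ball_zero_iff] at hz
    have h1 : ∀ σ : Fin n → Fin 2, ‖((p n (fun i => Pi.single (σ i) 1) : ℝ) : ℂ) * ∏ i, z (σ i)‖
        ≤ ‖p n‖ * (r' / 4) ^ n := by
      intro σ
      rw [norm_mul, norm_prod, Complex.norm_real]
      have h2 : ‖p n (fun i => Pi.single (σ i) 1)‖ ≤ ‖p n‖ := by
        refine ((p n).le_opNorm _).trans ?_
        have : ∏ i : Fin n, ‖(Pi.single (σ i) 1 : Fin 2 → ℝ)‖ = 1 := by
          refine Finset.prod_eq_one fun i _ => ?_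
          rw [Pi.norm_single, norm_one]
        rw [this, mul_one]
      have h3 : ∏ i, ‖z (σ i)‖ ≤ (r' / 4 : ℝ) ^ n := by
        calc ∏ i, ‖z (σ i)‖ ≤ ∏ _i : Fin n, (r' / 4 : ℝ) :=
              Finset.prod_le_prod (fun _ _ => norm_nonneg _)
                fun i _ => (norm_le_pi_norm z _).trans hz.le
          _ = _ := by simp [div_pow]
      exact mul_le_mul h2 h3 (Finset.prod_nonneg fun _ _ => norm_nonneg _) (norm_nonneg _)
    calc ‖P n z‖ ≤ ∑ _σ : Fin n → Fin 2, ‖p n‖ * (r' / 4 : ℝ) ^ n :=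
          (norm_sum_le _ _).trans (Finset.sum_le_sum fun σ _ => h1 σ)
      _ = (‖p n‖ * r' ^ n) * (1 / 2) ^ n := by
          rw [Finset.sum_const, Finset.card_univ, Fintype.card_fun, Fintype.card_fin,
            Fintype.card_fin, nsmul_eq_mul]
          push_cast
          have : (r' / 4 : ℝ) ^ n * 2 ^ n = r' ^ n * (1 / 2) ^ n := by
            rw [← mul_pow, ← mul_pow]; congr 1; ring
          linear_combination ‖p n‖ * this
      _ ≤ K * (1 / 2) ^ n := by gcongr; exact hKb n
  refine ⟨r' / 4, by positivity, fun z => ∑' n, P n z, ?_, ?_⟩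
  · exact differentiableOn_tsum_of_bounded isOpen_ball
      ((summable_geometric_of_lt_one (by norm_num) (by norm_num)).mul_left K)
      (fun n => (hPd n).differentiableOn) hPb
  · intro ζ hζ
    have hmem : ζ ∈ Metric.eball (0 : Fin 2 → ℝ) r := by
      rw [Metric.mem_eball, edist_zero_right]
      refine lt_of_lt_of_le ?_ hr'.le
      rw [← ofReal_norm, ENNReal.ofReal_lt_coe_iff (norm_nonneg _)]
      linarith
    have hs := hp.hasSum hmem
    rw [zero_add] at hs
    have := (Complex.hasSum_ofReal.2 hs).tsum_eq
    rw [← this]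
    exact tsum_congr fun n => hPreal n ζ

end Complexification

/-! ### Algebra of complex 2 × 2 matrices: norms, Cayley transforms, unimodularity. -/

/-- Complex `2 × 2` matrices. -/
abbrev CMat2 : Type := Matrix (Fin 2) (Fin 2) ℂ

namespace CMat2

theorem norm_entry_le (M : CMat2) (i j : Fin 2) : ‖M i j‖ ≤ ‖M‖ := by
  rw [Matrix.l2_opNorm_def]
  have h1 := (LinearEquiv.trans (Matrix.toEuclideanLin (𝕜 := ℂ) (m := Fin 2) (n := Fin 2))
    LinearMap.toContinuousLinearMap M).le_opNorm (EuclideanSpace.single j 1)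
  have h2 : ‖(EuclideanSpace.single j (1 : ℂ))‖ = 1 := by simp
  rw [h2, mul_one] at h1
  refine le_trans ?_ h1
  refine le_trans (le_of_eq ?_) (PiLp.norm_apply_le _ i)
  simp [Matrix.toEuclideanLin, Matrix.toLpLin]

theorem norm_single (i j : Fin 2) (x : ℂ) : ‖(Matrix.single i j x : CMat2)‖ = ‖x‖ := by
  have h := Matrix.l2_opNorm_conjTranspose_mul_self (Matrix.single i j x : CMat2)
  have h2 : (Matrix.single i j x : CMat2).conjTranspose * Matrix.single i j x
      = Matrix.diagonal (Pi.single j (star x * x)) := by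
    rw [Matrix.conjTranspose_single, Matrix.single_mul_single_same, Matrix.diagonal_single]
  rw [h2, Matrix.l2_opNorm_diagonal, Pi.norm_single, norm_mul, norm_star] at h
  nlinarith [norm_nonneg x, norm_nonneg (Matrix.single i j x : CMat2)]

theorem norm_le_of_entry_le {M : CMat2} {B : ℝ} (h : ∀ i j, ‖M i j‖ ≤ B) : ‖M‖ ≤ 4 * B := by
  rw [Matrix.matrix_eq_sum_single M]
  refine (norm_sum_le _ _).trans ?_
  refine (Finset.sum_le_sum fun i _ => norm_sum_le _ _).trans ?_
  simp only [norm_single, Fin.sum_univ_two]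
  linarith [h 0 0, h 0 1, h 1 0, h 1 1]

theorem norm_trace_le (M : CMat2) : ‖M.trace‖ ≤ 2 * ‖M‖ := by
  rw [Matrix.trace_fin_two]
  linarith [norm_add_le (M 0 0) (M 1 1), norm_entry_le M 0 0, norm_entry_le M 1 1]

theorem norm_det_le (M : CMat2) : ‖M.det‖ ≤ 2 * ‖M‖ ^ 2 := by
  rw [Matrix.det_fin_two]
  refine (norm_sub_le _ _).trans ?_
  rw [norm_mul, norm_mul]
  have h := norm_nonneg M
  nlinarith [mul_le_mul (norm_entry_le M 0 0) (norm_entry_le M 1 1) (norm_nonneg _) h,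
    mul_le_mul (norm_entry_le M 0 1) (norm_entry_le M 1 0) (norm_nonneg _) h]

/-- Cayley–Hamilton; it makes the inverse of `1 - a`, the Cayley transform and the exponential of a
trace-zero matrix explicit. -/
theorem mul_self_of_trace_zero {a : CMat2} (ha : a.trace = 0) :
    a * a = -a.det • (1 : CMat2) := by
  rw [Matrix.trace_fin_two] at ha
  have h : a 1 1 = -a 0 0 := by linear_combination ha
  ext i j
  fin_cases i <;> fin_cases j <;>
    simp [Matrix.mul_apply, Fin.sum_univ_two, Matrix.det_fin_two, h] <;> ring

theorem norm_det_le_of_trace_zero {a : CMat2} (ha : a.trace = 0) : ‖a.det‖ ≤ ‖a‖ ^ 2 := by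
  have h := norm_mul_le a a
  rw [mul_self_of_trace_zero ha, norm_smul, norm_neg, norm_one, mul_one] at h
  rwa [sq]

/-- The inverse of `1 - a` for a trace-zero matrix `a`. -/
noncomputable def inv1 (a : CMat2) : CMat2 := (1 + a.det)⁻¹ • (1 + a)

/-- The Cayley transform `(1 + a) (1 - a)⁻¹`. -/
noncomputable def cay (a : CMat2) : CMat2 := (1 + a) * inv1 a

section

variable {a : CMat2} (ha : a.trace = 0) (hd : 1 + a.det ≠ 0)
include ha hd

theorem one_sub_mul_inv1 : (1 - a) * inv1 a = 1 := by
  have : (1 - a) * (1 + a) = (1 + a.det) • (1 : CMat2) := by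
    calc (1 - a) * (1 + a) = 1 - a * a := by noncomm_ring
      _ = _ := by rw [mul_self_of_trace_zero ha, add_smul, one_smul, neg_smul, sub_neg_eq_add]
  rw [inv1, mul_smul_comm, this, inv_smul_smul₀ hd]

theorem inv1_mul_one_sub : inv1 a * (1 - a) = 1 :=
  mul_eq_one_comm.1 (one_sub_mul_inv1 ha hd)

end

theorem det_neg' (a : CMat2) : (-a).det = a.det := by
  simp [Matrix.det_fin_two]

theorem trace_neg' {a : CMat2} (ha : a.trace = 0) : (-a).trace = 0 := by
  rw [Matrix.trace_neg, ha, neg_zero]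

section

variable {a : CMat2} (ha : a.trace = 0) (hd : 1 + a.det ≠ 0)
include ha hd

theorem one_add_mul_inv1_neg : (1 + a) * inv1 (-a) = 1 := by
  have := one_sub_mul_inv1 (trace_neg' ha) (by rwa [det_neg'])
  rwa [sub_neg_eq_add] at this

theorem inv1_neg_mul_one_add : inv1 (-a) * (1 + a) = 1 := by
  have := inv1_mul_one_sub (trace_neg' ha) (by rwa [det_neg'])
  rwa [sub_neg_eq_add] at this

theorem cay_mul_cay_neg : cay a * cay (-a) = 1 := by
  have h1 := inv1_mul_one_sub ha hd
  have h2 := one_add_mul_inv1_neg ha hd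
  rw [cay, cay, ← sub_eq_add_neg]
  calc (1 + a) * inv1 a * ((1 - a) * inv1 (-a))
      = (1 + a) * (inv1 a * (1 - a)) * inv1 (-a) := by simp only [mul_assoc]
    _ = 1 := by rw [h1, mul_one, h2]

theorem cay_neg_mul_cay : cay (-a) * cay a = 1 := by
  have := cay_mul_cay_neg (trace_neg' ha) (by rwa [det_neg'])
  rwa [neg_neg] at this

end

/-- `W(a+b)⁻¹ W(a) = 1 - (1+a+b)⁻¹ (2b) (1-a)⁻¹` for the Cayley transform `W`. -/
theorem cay_neg_mul_cay_eq {a a' : CMat2} (ha : a.trace = 0) (hd : 1 + a.det ≠ 0)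
    (ha' : a'.trace = 0) (hd' : 1 + a'.det ≠ 0) :
    cay (-a') * cay a = 1 - inv1 (-a') * ((2 : ℂ) • (a' - a)) * inv1 a := by
  have h1 := one_sub_mul_inv1 ha hd
  have h2 := inv1_neg_mul_one_add ha' hd'
  have h3 := one_add_mul_inv1_neg ha' hd'
  have h4 : cay (-a') = inv1 (-a') * (1 - a') := by
    have hcomm : (1 + -a') * inv1 (-a') = inv1 (-a') * (1 + -a') := by
      simp only [inv1]
      rw [mul_smul_comm, smul_mul_assoc]
    rw [cay, hcomm, ← sub_eq_add_neg]
  have h5 : inv1 (-a') * (1 - a') * ((1 + a) * inv1 a)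
      = inv1 (-a') * ((1 + a') * (1 - a) - (2 : ℂ) • (a' - a)) * inv1 a := by
    have : (1 - a') * (1 + a) = (1 + a') * (1 - a) - (2 : ℂ) • (a' - a) := by
      rw [two_smul]; noncomm_ring
    rw [← this]; simp only [mul_assoc]
  rw [h4, cay, h5, mul_sub, sub_mul, ← mul_assoc, h2, one_mul, h1]

theorem cay_mul_cay_neg_eq {a a' : CMat2} (ha : a.trace = 0) (hd : 1 + a.det ≠ 0)
    (ha' : a'.trace = 0) (hd' : 1 + a'.det ≠ 0) :
    cay a * cay (-a') = 1 - inv1 a * ((2 : ℂ) • (a' - a)) * inv1 (-a') := by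
  have := cay_neg_mul_cay_eq (a := -a') (a' := -a) (trace_neg' ha') (by rwa [det_neg'])
    (trace_neg' ha) (by rwa [det_neg'])
  rw [neg_neg] at this
  rw [this, show -a - -a' = a' - a by abel]

/-- The infinitesimal form `(det (1 + s h) - 1) / s = 0` of `det (1 + s h) = 1`. -/
def Unimod (s : ℂ) (h : CMat2) : Prop := h.trace + s * h.det = 0

/-- This is the identity `(1 + s h)(1 + s g) = 1 + s (h + g + s h g)` for determinants, divided by
`s`. As a polynomial identity it survives at `s = 0`. -/
theorem Unimod.comp {s : ℂ} {h g : CMat2} (hh : Unimod s h) (hg : Unimod s g) :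
    Unimod s (h + g + s • (h * g)) := by
  unfold Unimod at *
  simp only [Matrix.det_fin_two, Matrix.trace_fin_two, Matrix.add_apply, Matrix.smul_apply,
    Matrix.mul_apply, Fin.sum_univ_two, smul_eq_mul] at *
  linear_combination (1 + s * (g 0 0 + g 1 1 + s * (g 0 0 * g 1 1 - g 0 1 * g 1 0))) * hh + hg

theorem Unimod.conj {s : ℂ} {h x y : CMat2} (hh : Unimod s h) (hxy : x * y = 1) :
    Unimod s (x * h * y) := by
  have hyx : y * x = 1 := mul_eq_one_comm.1 hxy
  unfold Unimod at *
  have h1 : (x * h * y).trace = h.trace := by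
    rw [Matrix.trace_mul_cycle, hyx, one_mul]
  have h2 : (x * h * y).det = h.det := by
    have : x.det * y.det = 1 := by rw [← Matrix.det_mul, hxy, Matrix.det_one]
    rw [Matrix.det_mul, Matrix.det_mul]
    linear_combination h.det * this
  rw [h1, h2, hh]

/-- For `s ≠ 0` this says that a quotient of two Cayley transforms has determinant one, by
`cay_neg_mul_cay_eq`. To cover `s = 0` it is reduced to the polynomial identity `tr ((1 - a') P (1 +
a)) = s det P`, which uses `a' - a = (s / 2) P`. -/
theorem unimod_neg_sandwich {s : ℂ} {a a' P : CMat2} (ha : a.trace = 0) (hd : 1 + a.det ≠ 0)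
    (hP : P.trace = 0) (hd' : 1 + a'.det ≠ 0)
    (haP : a' = a + (s / 2) • P) : Unimod s (-(inv1 (-a') * P * inv1 a)) := by
  have hPd : ∀ M : CMat2, Unimod s M ↔ M.trace = - (s * M.det) := fun M => by
    rw [Unimod, add_eq_zero_iff_eq_neg]
  have h2 : (1 + -a').det = 1 + a'.det := by
    have ha' : a'.trace = 0 := by rw [haP, Matrix.trace_add, Matrix.trace_smul, ha, hP]; simp
    rw [Matrix.trace_fin_two] at ha'
    simp only [Matrix.det_fin_two, Matrix.add_apply, Matrix.one_apply, Matrix.neg_apply]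
    simp
    linear_combination -ha'
  have h1 : (1 + a).det = 1 + a.det := by
    rw [Matrix.trace_fin_two] at ha
    simp only [Matrix.det_fin_two, Matrix.add_apply, Matrix.one_apply]
    simp
    linear_combination ha
  have h3 : ((1 + -a') * P * (1 + a)).trace = s * P.det := by
    subst haP
    rw [Matrix.trace_fin_two] at ha hP
    have ha1 : a 1 1 = -a 0 0 := by linear_combination ha
    have hP1 : P 1 1 = -P 0 0 := by linear_combination hP
    simp only [Matrix.det_fin_two, Matrix.trace_fin_two, Matrix.add_apply, Matrix.smul_apply,
      Matrix.mul_apply, Fin.sum_univ_two, smul_eq_mul, Matrix.neg_apply, Matrix.one_apply_eq]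
    simp [ha1, hP1]
    ring
  unfold Unimod
  rw [inv1, inv1, det_neg', det_neg']
  rw [smul_mul_assoc, mul_smul_comm, smul_mul_assoc, Matrix.trace_neg, Matrix.trace_smul,
    Matrix.trace_smul, h3, Matrix.det_smul, Matrix.det_smul, Matrix.det_mul, Matrix.det_mul, h1, h2,
    Fintype.card_fin]
  simp only [smul_eq_mul]
  field_simp
  ring

theorem norm_sandwich_sub_le (x k y : CMat2) :
    ‖x * k * y - k‖ ≤ (‖x - 1‖ * ‖y‖ + ‖y - 1‖) * ‖k‖ := by
  have : x * k * y - k = (x - 1) * k * y + k * (y - 1) := by noncomm_ring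
  rw [this]
  refine (norm_add_le _ _).trans ?_
  have h1 := norm_mul₃_le (a := x - 1) (b := k) (c := y)
  have h2 := norm_mul_le k (y - 1)
  linarith

section

variable {a : CMat2} {τ : ℝ} (ha : a.trace = 0) (hτ : ‖a‖ ≤ τ) (hτ1 : τ ≤ 1 / 4)
include ha hτ hτ1

theorem one_add_det_ne_zero : 1 + a.det ≠ 0 := by
  intro h
  have h1 := norm_det_le_of_trace_zero ha
  have h2 : a.det = -1 := by linear_combination h
  rw [h2, norm_neg, norm_one] at h1
  nlinarith [norm_nonneg a]

theorem norm_inv1_le : ‖inv1 a‖ ≤ 4 / 3 := by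
  have h0 := norm_nonneg a
  have h1 := norm_det_le_of_trace_zero ha
  have h2 : 15 / 16 ≤ ‖1 + a.det‖ := by
    have := norm_sub_norm_le (1 : ℂ) (-a.det)
    rw [sub_neg_eq_add, norm_neg, norm_one] at this
    nlinarith
  rw [inv1, norm_smul, norm_inv, inv_mul_le_iff₀ (by linarith)]
  have h3 := norm_add_le (1 : CMat2) a
  rw [norm_one] at h3
  nlinarith

theorem norm_inv1_sub_one_le : ‖inv1 a - 1‖ ≤ 4 / 3 * τ := by
  have h1 := one_sub_mul_inv1 ha (one_add_det_ne_zero ha hτ hτ1)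
  have : inv1 a - 1 = a * inv1 a := by rw [← h1]; noncomm_ring
  rw [this]
  have h2 := norm_inv1_le ha hτ hτ1
  have h3 := norm_mul_le a (inv1 a)
  nlinarith [norm_nonneg a, norm_nonneg (inv1 a)]

theorem norm_cay_le : ‖cay a‖ ≤ 5 / 3 := by
  rw [cay]
  have h2 := norm_inv1_le ha hτ hτ1
  have h3 := norm_mul_le (1 + a) (inv1 a)
  have h4 := norm_add_le (1 : CMat2) a
  rw [norm_one] at h4
  nlinarith [norm_nonneg (1 + a), norm_nonneg (inv1 a)]

theorem norm_cay_sub_one_le : ‖cay a - 1‖ ≤ 8 / 3 * τ := by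
  have h1 := one_sub_mul_inv1 ha (one_add_det_ne_zero ha hτ hτ1)
  have : cay a - 1 = (a + a) * inv1 a := by
    calc cay a - 1 = (1 + a) * inv1 a - (1 - a) * inv1 a := by rw [h1, cay]
      _ = _ := by rw [← sub_mul]; congr 1; abel
  rw [this]
  have h2 := norm_inv1_le ha hτ hτ1
  have h3 := norm_mul_le (a + a) (inv1 a)
  have h4 := norm_add_le a a
  nlinarith [norm_nonneg (a + a), norm_nonneg (inv1 a), norm_nonneg a]

end

end CMat2

/-! ### Exact algebra of one iteration step. -/

namespace CMat2

/-- `cay (s κ / 2) * cay (-(s (κ + η) / 2)) = 1 - s * counterStep s κ η`. -/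
noncomputable def counterStep (s : ℂ) (κ η : CMat2) : CMat2 :=
  inv1 ((s / 2) • κ) * η * inv1 (-((s / 2) • (κ + η)))

/-- The error after inserting the counterterm, before conjugation. -/
noncomputable def midStep (s : ℂ) (Z κ h η : CMat2) : CMat2 :=
  h - Z.adjugate * counterStep s κ η * Z - s • (h * (Z.adjugate * counterStep s κ η * Z))

/-- The new error of one step of the iteration. -/
noncomputable def errStep (χ s : ℂ) (Z κ h η Y P : CMat2) : CMat2 :=
  cay (-((χ / 2) • Y + (s / 2) • P)) * midStep s Z κ h η * cay ((χ / 2) • Y)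
    - inv1 (-((χ / 2) • Y + (s / 2) • P)) * P * inv1 ((χ / 2) • Y)

variable {χ s : ℂ} {Z κ h η Y P : CMat2} {τ H Q : ℝ}

/-- Replacing `κ` by `κ + η` is an exact multiplication by a factor `1 - s (...)`. The counterterm
update leaves no remainder outside the error and involves no division by `s`. -/
theorem cay_neg_mul_one_sub_counterStep (hκ : κ.trace = 0) (hη : η.trace = 0)
    (hd : 1 + ((s / 2) • κ).det ≠ 0) (hd' : 1 + ((s / 2) • (κ + η)).det ≠ 0) :
    cay (-((s / 2) • κ)) * (1 - s • counterStep s κ η) = cay (-((s / 2) • (κ + η))) := by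
  have ha : ((s / 2) • κ).trace = 0 := by rw [Matrix.trace_smul, hκ, smul_zero]
  have ha' : ((s / 2) • (κ + η)).trace = 0 := by
    rw [Matrix.trace_smul, Matrix.trace_add, hκ, hη, add_zero, smul_zero]
  have h1 := cay_mul_cay_neg_eq ha hd ha' hd'
  have h2 : (2 : ℂ) • ((s / 2) • (κ + η) - (s / 2) • κ) = s • η := by
    rw [← smul_sub, add_sub_cancel_left, smul_smul]; congr 1; ring
  have h3 : 1 - s • counterStep s κ η = cay ((s / 2) • κ) * cay (-((s / 2) • (κ + η))) := by
    rw [h1, h2, counterStep, mul_smul_comm, smul_mul_assoc]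
  rw [h3, ← mul_assoc, cay_neg_mul_cay ha hd, one_mul]

theorem unimod_counterStep (hκ : κ.trace = 0) (hη : η.trace = 0)
    (hd : 1 + ((s / 2) • κ).det ≠ 0) (hd' : 1 + ((s / 2) • (κ + η)).det ≠ 0) :
    Unimod s (-counterStep s κ η) := by
  have ha' : (-((s / 2) • (κ + η))).trace = 0 := by
    rw [Matrix.trace_neg, Matrix.trace_smul, Matrix.trace_add, hκ, hη, add_zero, smul_zero, neg_zero]
  have := unimod_neg_sandwich (s := s) (a := -((s / 2) • (κ + η))) (a' := -((s / 2) • κ)) (P := η)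
    ha' (by rwa [det_neg']) hη (by rwa [det_neg']) (by rw [smul_add]; abel)
  rwa [neg_neg] at this

section

variable (hZ : Z.det = 1)
include hZ

theorem adjugate_mul_self : Z.adjugate * Z = 1 := by
  rw [Matrix.adjugate_mul, hZ, one_smul]

theorem mul_adjugate_self : Z * Z.adjugate = 1 := by
  rw [Matrix.mul_adjugate, hZ, one_smul]

/-- The update of the counterterm acts on the left of `Z`; moving it to the right conjugates it by
`Z`, whose inverse is its adjugate. -/
theorem one_add_smul_midStep :
    Z * (1 + s • midStep s Z κ h η)
      = Z * (1 + s • h) * Z.adjugate * (1 - s • counterStep s κ η) * Z := by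
  have h1 := adjugate_mul_self hZ
  have h2 : Z.adjugate * (1 - s • counterStep s κ η) * Z
      = 1 - s • (Z.adjugate * counterStep s κ η * Z) := by
    rw [mul_sub, sub_mul, mul_one, h1, mul_smul_comm, smul_mul_assoc]
  have h3 : Z * (1 + s • h) * Z.adjugate * (1 - s • counterStep s κ η) * Z
      = Z * ((1 + s • h) * (Z.adjugate * (1 - s • counterStep s κ η) * Z)) := by
    simp only [mul_assoc]
  rw [h3, h2, midStep]
  congr 1
  rw [add_mul, one_mul, mul_sub, mul_one, smul_mul_smul_comm, smul_sub, smul_sub, smul_smul]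
  abel

end

variable (hY : Y.trace = 0) (hP : P.trace = 0)
  (hd : 1 + ((χ / 2) • Y).det ≠ 0) (hd' : 1 + ((χ / 2) • Y + (s / 2) • P).det ≠ 0)
include hY hP hd hd'

theorem cay_mul_one_sub :
    cay (-((χ / 2) • Y + (s / 2) • P)) * cay ((χ / 2) • Y)
      = 1 - s • (inv1 (-((χ / 2) • Y + (s / 2) • P)) * P * inv1 ((χ / 2) • Y)) := by
  have ha : ((χ / 2) • Y).trace = 0 := by rw [Matrix.trace_smul, hY, smul_zero]
  have ha' : ((χ / 2) • Y + (s / 2) • P).trace = 0 := by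
    rw [Matrix.trace_add, ha, Matrix.trace_smul, hP, smul_zero, add_zero]
  rw [cay_neg_mul_cay_eq ha hd ha' hd', add_sub_cancel_left, smul_smul, mul_div_cancel₀ _ two_ne_zero,
    mul_smul_comm, smul_mul_assoc]

/-- The new conjugacy factor is `cay ((χ / 2) Y)`. The factor extracted on the left differs from it
by the shift `(s / 2) P`, because the scaled homological equation carries exactly `(χ / 2) Y + (s /
2) P` through `T` to `(χ / 2) Y(· + ω)`. -/
theorem cay_mul_one_add_errStep :
    (1 + s • midStep s Z κ h η) * cay ((χ / 2) • Y)
      = cay ((χ / 2) • Y + (s / 2) • P) * (1 + s • errStep χ s Z κ h η Y P) := by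
  have ha : ((χ / 2) • Y).trace = 0 := by rw [Matrix.trace_smul, hY, smul_zero]
  have ha' : ((χ / 2) • Y + (s / 2) • P).trace = 0 := by
    rw [Matrix.trace_add, ha, Matrix.trace_smul, hP, smul_zero, add_zero]
  have h1 := cay_mul_one_sub hY hP hd hd'
  have h2 := cay_mul_cay_neg ha' hd'
  have h3 : 1 + s • errStep χ s Z κ h η Y P
      = cay (-((χ / 2) • Y + (s / 2) • P)) * ((1 + s • midStep s Z κ h η) * cay ((χ / 2) • Y)) := by
    rw [add_mul, one_mul, mul_add, h1, errStep, smul_sub, smul_mul_assoc, mul_smul_comm, ← mul_assoc]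
    abel
  rw [h3, ← mul_assoc, h2, one_mul]

/-- In the group law of `Unimod.comp`, the new error is the product of the quotient of Cayley
transforms in `cay_mul_one_sub` and a conjugate of `midStep`, and `midStep` is itself a product of
the old error and a conjugated counterterm factor. -/
theorem unimod_errStep (hZ : Z.det = 1) (hκ : κ.trace = 0) (hη : η.trace = 0)
    (hdκ : 1 + ((s / 2) • κ).det ≠ 0) (hdκ' : 1 + ((s / 2) • (κ + η)).det ≠ 0)
    (hh : Unimod s h) : Unimod s (errStep χ s Z κ h η Y P) := by
  have ha : ((χ / 2) • Y).trace = 0 := by rw [Matrix.trace_smul, hY, smul_zero]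
  have ha' : ((χ / 2) • Y + (s / 2) • P).trace = 0 := by
    rw [Matrix.trace_add, ha, Matrix.trace_smul, hP, smul_zero, add_zero]
  have h1 := cay_mul_one_sub hY hP hd hd'
  have h4 := cay_mul_cay_neg ha hd
  have h5 := cay_neg_mul_cay ha hd
  have hk := (unimod_counterStep hκ hη hdκ hdκ').conj (adjugate_mul_self hZ)
  have hm : Unimod s (midStep s Z κ h η) := by
    convert hh.comp hk using 1
    rw [midStep]
    simp only [mul_neg, neg_mul, smul_neg]
    abel
  have hq := unimod_neg_sandwich (s := s) ha hd hP hd' rfl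
  have hm' := hm.conj h5
  convert hq.comp hm' using 1
  have h6 : cay (-((χ / 2) • Y + (s / 2) • P))
      = (1 - s • (inv1 (-((χ / 2) • Y + (s / 2) • P)) * P * inv1 ((χ / 2) • Y)))
        * cay (-((χ / 2) • Y)) := by
    rw [← h1, mul_assoc, h4, mul_one]
  rw [errStep, h6]
  set q := inv1 (-((χ / 2) • Y + (s / 2) • P)) * P * inv1 ((χ / 2) • Y)
  rw [sub_mul, sub_mul, one_mul, sub_mul, smul_mul_assoc, smul_mul_assoc, smul_mul_assoc, neg_mul,
    smul_neg]
  simp only [mul_assoc]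
  abel

end CMat2

/-! ### Estimates for one iteration step. -/

namespace CMat2

variable {χ s : ℂ} {Z κ h η P a a' k m : CMat2} {τ H B : ℝ}

theorem norm_counterStep_sub_le (hτ0 : 0 ≤ τ) (hτ : τ ≤ 1 / 4) (hB0 : 0 ≤ B)
    (hκ : κ.trace = 0) (hη : η.trace = 0) (hηB : ‖η‖ ≤ B)
    (hκτ : ‖(s / 2) • κ‖ ≤ τ) (hκτ' : ‖(s / 2) • (κ + η)‖ ≤ τ) :
    ‖counterStep s κ η - η‖ ≤ 4 * τ * B := by
  have hκ0 : ((s / 2) • κ).trace = 0 := by rw [Matrix.trace_smul, hκ, smul_zero]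
  have hκ0' : (-((s / 2) • (κ + η))).trace = 0 := by
    rw [Matrix.trace_neg, Matrix.trace_smul, Matrix.trace_add, hκ, hη, add_zero, smul_zero, neg_zero]
  rw [← norm_neg] at hκτ'
  have h1 := norm_sandwich_sub_le (inv1 ((s / 2) • κ)) η (inv1 (-((s / 2) • (κ + η))))
  have h2 := norm_inv1_sub_one_le hκ0 hκτ hτ
  have h3 := norm_inv1_sub_one_le hκ0' hκτ' hτ
  have h4 := norm_inv1_le hκ0' hκτ' hτ
  have hτB := mul_nonneg hτ0 hB0
  refine h1.trans ?_
  calc _ ≤ (4 / 3 * τ * (4 / 3) + 4 / 3 * τ) * B := by gcongr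
    _ ≤ _ := by linarith

theorem norm_conj_sub_le (hτ0 : 0 ≤ τ) (hτ : τ ≤ 1 / 4) (hB0 : 0 ≤ B)
    (hk : ‖k‖ ≤ 2 * B) (hZτ : ‖Z - 1‖ ≤ τ) :
    ‖Z.adjugate * k * Z - k‖ ≤ 10 * τ * B ∧ ‖Z.adjugate * k * Z‖ ≤ 9 / 2 * B := by
  have hadj : ‖Z.adjugate - 1‖ ≤ 3 * τ := by
    have : Z.adjugate - 1 = (Z - 1).trace • (1 : CMat2) - (Z - 1) := by
      ext i j
      fin_cases i <;> fin_cases j <;>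
        simp [Matrix.adjugate_fin_two, Matrix.trace_fin_two] <;> ring
    rw [this]
    refine (norm_sub_le _ _).trans ?_
    rw [norm_smul, norm_one]
    linarith [norm_trace_le (Z - 1)]
  have hZn : ‖Z‖ ≤ 5 / 4 := by
    have := norm_add_le (Z - 1) 1
    rw [sub_add_cancel, norm_one] at this
    linarith
  have hτB := mul_nonneg hτ0 hB0
  have hzk : ‖Z.adjugate * k * Z - k‖ ≤ 10 * τ * B := by
    refine (norm_sandwich_sub_le _ _ _).trans ?_
    calc _ ≤ (3 * τ * (5 / 4) + τ) * (2 * B) := by gcongr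
      _ ≤ _ := by linarith
  refine ⟨hzk, ?_⟩
  have := norm_add_le (Z.adjugate * k * Z - k) k
  rw [sub_add_cancel] at this
  have h2 : τ * B ≤ 1 / 4 * B := by gcongr
  linarith

/-- To first order `midStep` is `h - η`, which differs from `P` by the trace part of `h` only. That
part is quadratic, since `Unimod` gives `tr h = -s det h`; every other discrepancy comes from a
factor within a multiple of `τ` of the identity. -/
theorem norm_midStep_sub_le (hτ : τ ≤ 1 / 4) (hs : ‖s‖ ≤ 4)
    (hκ : κ.trace = 0) (hη : η.trace = 0) (hh : Unimod s h)
    (hhH : ‖h‖ ≤ H) (hHτ : H ≤ τ) (hHB : H ≤ B) (hηB : ‖η‖ ≤ B)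
    (hPd : P = h - (h.trace / 2) • (1 : CMat2) - η)
    (hZτ : ‖Z - 1‖ ≤ τ) (hκτ : ‖(s / 2) • κ‖ ≤ τ) (hκτ' : ‖(s / 2) • (κ + η)‖ ≤ τ) :
    ‖midStep s Z κ h η - P‖ ≤ 36 * τ * B := by
  have hH0 : 0 ≤ H := (norm_nonneg _).trans hhH
  have hτ0 : 0 ≤ τ := hH0.trans hHτ
  have hB0 : 0 ≤ B := hH0.trans hHB
  have hτB := mul_nonneg hτ0 hB0
  have hτB' : τ * B ≤ 1 / 4 * B := by gcongr
  have hkη := norm_counterStep_sub_le hτ0 hτ hB0 hκ hη hηB hκτ hκτ'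
  have hkB : ‖counterStep s κ η‖ ≤ 2 * B := by
    have := norm_add_le (counterStep s κ η - η) η
    rw [sub_add_cancel] at this
    linarith
  obtain ⟨hzk, hzkn⟩ := norm_conj_sub_le hτ0 hτ hB0 hkB hZτ
  rw [midStep]
  generalize counterStep s κ η = k at *
  generalize Z.adjugate * k * Z = l at *
  have hshk : ‖s • (h * l)‖ ≤ 18 * τ * B := by
    rw [norm_smul]
    have h1 : ‖h * l‖ ≤ τ * (9 / 2 * B) :=
      (norm_mul_le _ _).trans (by gcongr; linarith)
    calc _ ≤ 4 * (τ * (9 / 2 * B)) := by gcongr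
      _ = _ := by ring
  have htr : ‖(h.trace / 2) • (1 : CMat2)‖ ≤ 4 * τ * B := by
    have h1 : h.trace = -(s * h.det) := by unfold Unimod at hh; linear_combination hh
    have h2 := norm_det_le h
    rw [norm_smul, norm_one, mul_one, h1, norm_div, norm_neg, norm_mul]
    have h3 : ‖s‖ * ‖h.det‖ ≤ 4 * (2 * (τ * B)) := by
      have : ‖h.det‖ ≤ 2 * (τ * B) := h2.trans (by
        rw [sq]; gcongr
        · exact hhH.trans hHτ
        · exact hhH.trans hHB)
      gcongr
    rw [Complex.norm_ofNat, div_le_iff₀ two_pos]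
    linarith
  have : h - l - s • (h * l) - P
      = (h.trace / 2) • (1 : CMat2) - (k - η) - (l - k) - s • (h * l) := by
    rw [hPd]; abel
  rw [this]
  have h1 := norm_sub_le ((h.trace / 2) • (1 : CMat2) - (k - η) - (l - k)) (s • (h * l))
  have h2 := norm_sub_le ((h.trace / 2) • (1 : CMat2) - (k - η)) (l - k)
  have h3 := norm_sub_le ((h.trace / 2) • (1 : CMat2)) (k - η)
  linarith

/-- Both terms approximate the same `P` up to a multiple of `τ B`, so their difference loses the
leading order. This is the cancellation achieved by solving the homological equation. -/
theorem norm_conj_cay_sub_le (hτ0 : 0 ≤ τ) (hτ : τ ≤ 1 / 4) (hB0 : 0 ≤ B)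
    (ha : a.trace = 0) (ha' : a'.trace = 0) (haτ : ‖a‖ ≤ τ) (haτ' : ‖a'‖ ≤ τ)
    (hPB : ‖P‖ ≤ B) (hmP : ‖m - P‖ ≤ 36 * τ * B) :
    ‖cay a' * m * cay a - inv1 a' * P * inv1 a‖ ≤ 120 * τ * B := by
  have hτB := mul_nonneg hτ0 hB0
  have hτB' : τ * B ≤ 1 / 4 * B := by gcongr
  have hmn : ‖m‖ ≤ 10 * B := by
    have := norm_add_le (m - P) P
    rw [sub_add_cancel] at this
    linarith
  have hconj : ‖cay a' * m * cay a - m‖ ≤ 72 * τ * B := by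
    have h2 := norm_cay_sub_one_le ha haτ hτ
    have h3 := norm_cay_sub_one_le ha' haτ' hτ
    have h4 := norm_cay_le ha haτ hτ
    refine (norm_sandwich_sub_le _ _ _).trans ?_
    calc _ ≤ (8 / 3 * τ * (5 / 3) + 8 / 3 * τ) * (10 * B) := by gcongr
      _ ≤ _ := by linarith
  have hq : ‖inv1 a' * P * inv1 a - P‖ ≤ 4 * τ * B := by
    have h2 := norm_inv1_sub_one_le ha haτ hτ
    have h3 := norm_inv1_sub_one_le ha' haτ' hτ
    have h4 := norm_inv1_le ha haτ hτ
    refine (norm_sandwich_sub_le _ _ _).trans ?_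
    calc _ ≤ (4 / 3 * τ * (4 / 3) + 4 / 3 * τ) * B := by gcongr
      _ ≤ _ := by linarith
  generalize cay a' * m * cay a = c at *
  generalize inv1 a' * P * inv1 a = q at *
  have hfin : c - q = (c - m) + (m - P) - (q - P) := by abel
  rw [hfin]
  have h1 := norm_sub_le ((c - m) + (m - P)) (q - P)
  have h2 := norm_add_le (c - m) (m - P)
  linarith

/-- The contraction factor is proportional to `τ`, which measures `Z - 1` and the accumulated
counterterm as well as the current correction. It is small but does not decay along the iteration,
so the scheme converges geometrically and not quadratically. -/
theorem norm_errStep_le {Y : CMat2} {Q : ℝ} (hY : Y.trace = 0) (hP : P.trace = 0)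
    (hτ : τ ≤ 1 / 4) (hQ : 1 ≤ Q) (hs : ‖s‖ ≤ 4)
    (hκ : κ.trace = 0) (hη : η.trace = 0) (hh : Unimod s h)
    (hhH : ‖h‖ ≤ H) (hHτ : H ≤ τ) (hηQ : ‖η‖ ≤ Q * H)
    (hPd : P = h - (h.trace / 2) • (1 : CMat2) - η) (hPQ : ‖P‖ ≤ Q * H)
    (hZτ : ‖Z - 1‖ ≤ τ) (haτ : ‖(χ / 2) • Y‖ ≤ τ) (haτ' : ‖(χ / 2) • Y + (s / 2) • P‖ ≤ τ)
    (hκτ : ‖(s / 2) • κ‖ ≤ τ) (hκτ' : ‖(s / 2) • (κ + η)‖ ≤ τ) :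
    ‖errStep χ s Z κ h η Y P‖ ≤ 120 * τ * (Q * H) := by
  have ha : ((χ / 2) • Y).trace = 0 := by rw [Matrix.trace_smul, hY, smul_zero]
  have ha' : (-((χ / 2) • Y + (s / 2) • P)).trace = 0 := by
    rw [Matrix.trace_neg, Matrix.trace_add, ha, Matrix.trace_smul, hP, smul_zero, add_zero, neg_zero]
  rw [← norm_neg] at haτ'
  have hH0 : 0 ≤ H := (norm_nonneg _).trans hhH
  exact norm_conj_cay_sub_le (hH0.trans hHτ) hτ (by positivity) ha ha' haτ haτ' hPQ
    (norm_midStep_sub_le hτ hs hκ hη hh hhH hHτ (by nlinarith) hηQ hPd hZτ hκτ hκτ')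

end CMat2

/-! ### Exponentials and logarithms of trace-zero matrices. -/

theorem exp_eq_one_add_of_mul_self_eq_zero {𝔸 : Type*} [NormedRing 𝔸] [NormedAlgebra ℝ 𝔸]
    {a : 𝔸} (ha : a * a = 0) : NormedSpace.exp a = 1 + a := by
  rw [NormedSpace.exp_eq_tsum ℝ]
  have h : ∀ n ∉ Finset.range 2, ((n.factorial : ℝ)⁻¹) • a ^ n = 0 := by
    intro n hn
    rw [Finset.mem_range, not_lt] at hn
    obtain ⟨k, rfl⟩ := Nat.exists_eq_add_of_le hn
    rw [pow_add, sq, ha, zero_mul, smul_zero]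
  simp only
  rw [tsum_eq_sum h]
  simp [Finset.sum_range_succ]

namespace CMat2

theorem exp_smul_of_mul_self {a : CMat2} {θ : ℂ} (hθ : θ ≠ 0) (ha : a * a = θ ^ 2 • (1 : CMat2))
    (μ : ℂ) : NormedSpace.exp (μ • a)
      = Complex.cosh (μ * θ) • (1 : CMat2) + (Complex.sinh (μ * θ) / θ) • a := by
  have hpow : ∀ k : ℕ, a ^ (2 * k) = θ ^ (2 * k) • (1 : CMat2) := fun k => by
    rw [pow_mul, sq, ha, smul_pow, one_pow, ← pow_mul]
  have h1 := (Complex.hasSum_cosh (μ * θ)).smul_const (1 : CMat2)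
  have h2 := ((Complex.hasSum_sinh (μ * θ)).div_const θ).smul_const a
  rw [NormedSpace.exp_eq_tsum ℂ]
  refine (HasSum.even_add_odd (f := fun n => ((n.factorial : ℂ)⁻¹) • (μ • a) ^ n) ?_ ?_).tsum_eq
  · convert h1 using 2 with k
    rw [smul_pow, hpow, smul_smul, smul_smul]
    congr 1
    rw [mul_pow]; ring
  · convert h2 using 2 with k
    rw [smul_pow, pow_succ a, hpow, smul_mul_assoc, one_mul, smul_smul, smul_smul]
    congr 1
    rw [mul_pow, pow_succ θ]
    field_simp

theorem exists_sq_eq (w : ℂ) : ∃ θ : ℂ, θ ^ 2 = w :=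
  IsAlgClosed.exists_pow_nat_eq w two_pos

theorem det_exp_of_trace_zero {a : CMat2} (ha : a.trace = 0) : (NormedSpace.exp a).det = 1 := by
  obtain ⟨θ, hθ⟩ := exists_sq_eq (-a.det)
  have hsq := mul_self_of_trace_zero ha
  rw [← hθ] at hsq
  rw [Matrix.trace_fin_two] at ha
  have h11 : a 1 1 = -a 0 0 := by linear_combination ha
  by_cases h0 : θ = 0
  · rw [h0, zero_pow two_ne_zero, zero_smul] at hsq
    rw [exp_eq_one_add_of_mul_self_eq_zero hsq]
    rw [h0, Matrix.det_fin_two] at hθ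
    simp only [Matrix.det_fin_two, Matrix.add_apply, Matrix.one_apply_eq, h11] at hθ ⊢
    simp
    linear_combination hθ
  · have h := exp_smul_of_mul_self h0 hsq 1
    rw [one_smul, one_mul] at h
    rw [h]
    rw [Matrix.det_fin_two] at hθ
    have hc := Complex.cosh_sq θ
    simp only [Matrix.det_fin_two, Matrix.add_apply, Matrix.smul_apply, Matrix.one_apply_eq, h11,
      smul_eq_mul] at hθ ⊢
    simp
    field_simp
    linear_combination θ ^ 2 * hc + Complex.sinh θ ^ 2 * hθ

/-- The even part of `artanh`: `lam (θ ^ 2) = artanh θ / θ`. -/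
noncomputable def lam (w : ℂ) : ℂ := ∑' k : ℕ, w ^ k / (2 * k + 1)

theorem norm_lam_term_le {w : ℂ} (k : ℕ) : ‖w ^ k / (2 * k + 1 : ℂ)‖ ≤ ‖w‖ ^ k := by
  rw [norm_div, norm_pow]
  refine div_le_self (by positivity) ?_
  have : (2 * k + 1 : ℂ) = ((2 * k + 1 : ℕ) : ℂ) := by push_cast; ring
  rw [this, Complex.norm_natCast]
  exact_mod_cast Nat.le_add_left 1 (2 * k)

theorem differentiableOn_lam : DifferentiableOn ℂ lam (ball 0 (1 / 2)) := by
  refine differentiableOn_tsum_of_bounded isOpen_ball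
    (summable_geometric_of_lt_one (r := 1 / 2) (by norm_num) (by norm_num))
    (fun n => by fun_prop) fun n x hx => (norm_lam_term_le n).trans ?_
  rw [mem_ball_zero_iff] at hx
  gcongr

theorem norm_lam_le {w : ℂ} (hw : ‖w‖ ≤ 1 / 2) : ‖lam w‖ ≤ 2 := by
  have h := tsum_of_norm_bounded (f := fun k : ℕ => w ^ k / (2 * k + 1 : ℂ))
    (hasSum_geometric_of_lt_one (r := 1 / 2) (by norm_num) (by norm_num))
    (fun k => (norm_lam_term_le k).trans (by gcongr))
  refine h.trans (by norm_num)

/-- In `log (1 + θ) - log (1 - θ)` the even terms of the two Taylor series cancel and the odd ones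
double, leaving `2 artanh θ`. -/
theorem exp_two_lam {θ : ℂ} (hθ : ‖θ‖ < 1) :
    Complex.exp (2 * lam (θ ^ 2) * θ) = (1 + θ) / (1 - θ) := by
  have h1 := Complex.hasSum_taylorSeries_log hθ
  have h2 := (Complex.hasSum_taylorSeries_log (z := -θ) (by rwa [norm_neg]))
  have h3 := h1.sub h2
  have hodd : ∀ k : ℕ, (-1 : ℂ) ^ (2 * k + 1 + 1) * θ ^ (2 * k + 1) / ((2 * k + 1 : ℕ) : ℂ)
      - (-1) ^ (2 * k + 1 + 1) * (-θ) ^ (2 * k + 1) / ((2 * k + 1 : ℕ) : ℂ)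
      = 2 * θ * ((θ ^ 2) ^ k / (2 * k + 1)) := fun k => by
    have e1 : (-1 : ℂ) ^ (2 * k + 1 + 1) = 1 := Even.neg_one_pow ⟨k + 1, by ring⟩
    have e2 : (-θ) ^ (2 * k + 1) = -θ ^ (2 * k + 1) := Odd.neg_pow ⟨k, rfl⟩ θ
    rw [e1, e2, pow_succ, pow_mul]
    push_cast
    ring
  have hev : ∀ k : ℕ, (-1 : ℂ) ^ (2 * k + 1) * θ ^ (2 * k) / ((2 * k : ℕ) : ℂ)
      - (-1) ^ (2 * k + 1) * (-θ) ^ (2 * k) / ((2 * k : ℕ) : ℂ) = 0 := fun k => by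
    rw [Even.neg_pow ⟨k, by ring⟩ θ, sub_self]
  have hw : ‖θ ^ 2‖ < 1 := by rw [norm_pow]; exact pow_lt_one₀ (norm_nonneg _) hθ two_ne_zero
  have hs : Summable fun k : ℕ => (θ ^ 2) ^ k / (2 * k + 1 : ℂ) :=
    Summable.of_norm_bounded (summable_geometric_of_lt_one (norm_nonneg _) hw) norm_lam_term_le
  have h4 := HasSum.even_add_odd (f := fun n : ℕ => (-1 : ℂ) ^ (n + 1) * θ ^ n / (n : ℂ)
      - (-1) ^ (n + 1) * (-θ) ^ n / (n : ℂ)) (m := 0) (m' := 2 * θ * lam (θ ^ 2))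
    (by simpa only [hev] using hasSum_zero) (by simp only [hodd]; exact hs.hasSum.mul_left (2 * θ))
  have h5 : 2 * lam (θ ^ 2) * θ = Complex.log (1 + θ) - Complex.log (1 + -θ) := by
    linear_combination -(h3.unique h4)
  have n1 : 1 + θ ≠ 0 := fun h => by
    have : θ = -1 := by linear_combination h
    rw [this] at hθ; simp at hθ
  have n2 : 1 + -θ ≠ 0 := fun h => by
    have : θ = 1 := by linear_combination -h
    rw [this] at hθ; simp at hθ
  rw [h5, Complex.exp_sub, Complex.exp_log n1, Complex.exp_log n2, sub_eq_add_neg 1 θ]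

theorem lam_zero : lam 0 = 1 := by
  rw [lam, tsum_eq_single 0]
  · simp
  · intro k hk
    simp [hk]

/-- With `θ ^ 2 = -det a`, the matrix `a` behaves like the scalar `θ`, and `exp (2 artanh θ) = (1 +
θ) / (1 - θ)`. Only `θ ^ 2` enters `lam`, so no branch of the square root has to be chosen; the
nilpotent case `θ = 0` is separate. -/
theorem exp_lam_smul {a : CMat2} (ha : a.trace = 0) (hd : ‖a.det‖ < 1) :
    NormedSpace.exp ((2 * lam (-a.det)) • a) = cay a := by
  obtain ⟨θ, hθ⟩ := exists_sq_eq (-a.det)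
  have hsq := mul_self_of_trace_zero ha
  have hdet : a.det = -θ ^ 2 := by rw [hθ, neg_neg]
  have hcay : cay a = (1 - θ ^ 2)⁻¹ • ((1 + θ ^ 2) • (1 : CMat2) + (2 : ℂ) • a) := by
    rw [cay, inv1, mul_smul_comm, hdet, ← sub_eq_add_neg]
    congr 1
    rw [hdet, neg_neg] at hsq
    rw [mul_add, mul_one, add_mul, hsq, one_mul, add_smul, one_smul, two_smul]
    abel
  rw [← hθ] at hsq ⊢
  have hn : ‖θ‖ < 1 := by
    rw [hdet, norm_neg, norm_pow] at hd
    exact (pow_lt_one_iff_of_nonneg (norm_nonneg _) two_ne_zero).1 hd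
  by_cases h0 : θ = 0
  · have hsq' : ((2 : ℂ) • a) * ((2 : ℂ) • a) = 0 := by
      rw [smul_mul_smul_comm, hsq, h0]; simp
    rw [hcay, h0, zero_pow two_ne_zero, lam_zero, mul_one,
      exp_eq_one_add_of_mul_self_eq_zero hsq']
    simp
  · rw [exp_smul_of_mul_self h0 hsq, hcay, Complex.cosh, Complex.sinh, Complex.exp_neg,
      exp_two_lam hn]
    have n1 : 1 + θ ≠ 0 := fun h => by
      have : θ = -1 := by linear_combination h
      rw [this] at hn; simp at hn
    have n2 : 1 - θ ≠ 0 := fun h => by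
      have : θ = 1 := by linear_combination -h
      rw [this] at hn; simp at hn
    have n3 : 1 - θ ^ 2 ≠ 0 := by
      have : 1 - θ ^ 2 = (1 + θ) * (1 - θ) := by ring
      rw [this]; exact mul_ne_zero n1 n2
    rw [smul_add, smul_smul, smul_smul]
    congr 2
    · field_simp; ring
    · field_simp; ring

/-- `(exp a - 1) / a`. -/
noncomputable def expQuot (a : CMat2) : CMat2 := ∑' k : ℕ, (((k + 1).factorial : ℂ)⁻¹) • a ^ k

theorem norm_expQuot_term_le {a : CMat2} (k : ℕ) :
    ‖(((k + 1).factorial : ℂ)⁻¹) • a ^ k‖ ≤ ‖a‖ ^ k := by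
  rw [norm_smul, norm_inv, Complex.norm_natCast]
  have h1 : (1 : ℝ) ≤ (k + 1).factorial := by exact_mod_cast Nat.succ_le_of_lt (Nat.factorial_pos _)
  calc _ ≤ 1 * ‖a ^ k‖ := by gcongr; exact inv_le_one_of_one_le₀ h1
    _ ≤ _ := by rw [one_mul]; exact norm_pow_le _ _

theorem differentiableOn_expQuot : DifferentiableOn ℂ expQuot (ball 0 (1 / 2)) := by
  refine differentiableOn_tsum_of_bounded isOpen_ball
    (summable_geometric_of_lt_one (r := 1 / 2) (by norm_num) (by norm_num))
    (fun n => by fun_prop) fun n x hx => (norm_expQuot_term_le n).trans ?_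
  rw [mem_ball_zero_iff] at hx
  gcongr

theorem norm_expQuot_le {a : CMat2} (ha : ‖a‖ ≤ 1 / 2) : ‖expQuot a‖ ≤ 2 := by
  have h := tsum_of_norm_bounded (f := fun k : ℕ => (((k + 1).factorial : ℂ)⁻¹) • a ^ k)
    (hasSum_geometric_of_lt_one (r := 1 / 2) (by norm_num) (by norm_num))
    (fun k => (norm_expQuot_term_le k).trans (by gcongr))
  refine h.trans (by norm_num)

theorem expQuot_zero : expQuot 0 = 1 := by
  rw [expQuot, tsum_eq_single 0]
  · simp
  · intro k hk
    simp [hk]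

theorem one_add_mul_expQuot {a : CMat2} (ha : ‖a‖ ≤ 1 / 2) :
    1 + a * expQuot a = NormedSpace.exp a := by
  have hs : Summable fun k : ℕ => (((k + 1).factorial : ℂ)⁻¹) • a ^ k :=
    Summable.of_norm_bounded (summable_geometric_of_lt_one (norm_nonneg a) (by linarith))
      norm_expQuot_term_le
  rw [NormedSpace.exp_eq_tsum ℂ]
  have hsum : Summable fun n : ℕ => ((n.factorial : ℂ)⁻¹) • a ^ n :=
    NormedSpace.expSeries_summable' a
  simp only
  rw [hsum.tsum_eq_zero_add, expQuot, ← hs.tsum_mul_left]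
  congr 1
  · simp
  · refine tsum_congr fun k => ?_
    rw [mul_smul_comm, pow_succ']

/-- The initial error `((exp (s f)) - 1) / s`. -/
noncomputable def initErr (s : ℂ) (f : CMat2) : CMat2 := f * expQuot (s • f)

theorem one_add_smul_initErr {s : ℂ} {f : CMat2} (h : ‖s • f‖ ≤ 1 / 2) :
    1 + s • initErr s f = NormedSpace.exp (s • f) := by
  rw [← one_add_mul_expQuot h, initErr, smul_mul_assoc]

theorem unimod_initErr {s : ℂ} {f : CMat2} (hf : f.trace = 0) (h : ‖s • f‖ ≤ 1 / 2) :
    Unimod s (initErr s f) := by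
  unfold Unimod
  -- For `s ≠ 0` the condition is `det exp = 1` divided by `s`; at `s = 0` it degenerates to the
  -- vanishing of the trace of `f`.
  by_cases hs : s = 0
  · rw [hs, zero_mul, add_zero, initErr, zero_smul, expQuot_zero, mul_one, hf]
  · have h1 := one_add_smul_initErr h
    have h2 := det_exp_of_trace_zero (a := s • f) (by rw [Matrix.trace_smul, hf, smul_zero])
    rw [← h1] at h2
    simp only [Matrix.det_fin_two, Matrix.trace_fin_two, Matrix.add_apply, Matrix.smul_apply,
      Matrix.one_apply_eq, smul_eq_mul] at h2 ⊢
    simp only [ne_eq, zero_ne_one, not_false_eq_true, Matrix.one_apply_ne, one_ne_zero] at h2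
    have h3 : s * (initErr s f 0 0 + initErr s f 1 1 +
      s * (initErr s f 0 0 * initErr s f 1 1 - initErr s f 0 1 * initErr s f 1 0)) = 0 := by
      linear_combination h2
    exact (mul_eq_zero.1 h3).resolve_left hs

theorem norm_initErr_le {s : ℂ} {f : CMat2} (h : ‖s • f‖ ≤ 1 / 2) : ‖initErr s f‖ ≤ 2 * ‖f‖ := by
  have := norm_mul_le f (expQuot (s • f))
  rw [initErr]
  nlinarith [norm_expQuot_le h, norm_nonneg f]

end CMat2

/-! ### Real matrices inside complex ones; every operation of the iteration preserves them. -/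

namespace CMat2

/-- The embedding of real into complex matrices. -/
noncomputable def ofRealM : Mat2 →ₐ[ℝ] CMat2 := Complex.ofRealAm.mapMatrix

theorem ofRealM_apply (R : Mat2) : ofRealM R = R.map Complex.ofReal := rfl

/-- The complex matrices with real entries. -/
noncomputable def realM : Subalgebra ℝ CMat2 := ofRealM.range

theorem mem_realM_iff {M : CMat2} : M ∈ realM ↔ ∀ i j, (M i j).im = 0 := by
  constructor
  · rintro ⟨R, rfl⟩ i j
    exact Complex.ofReal_im _
  · intro h
    refine ⟨M.map Complex.re, ?_⟩
    ext i j
    exact Complex.ext rfl (h i j).symm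

theorem ofRealM_mem (R : Mat2) : ofRealM R ∈ realM := ⟨R, rfl⟩

theorem ofRealM_re {M : CMat2} (h : M ∈ realM) : ofRealM (M.map Complex.re) = M := by
  rw [mem_realM_iff] at h
  ext i j
  exact Complex.ext rfl (h i j).symm

theorem isClosed_realM : IsClosed (realM : Set CMat2) := by
  have : (realM : Set CMat2) = ⋂ i, ⋂ j, {M : CMat2 | (M i j).im = 0} := by
    ext M
    simp [mem_realM_iff]
  rw [this]
  refine isClosed_iInter fun i => isClosed_iInter fun j => isClosed_eq ?_ continuous_const
  exact Complex.continuous_im.comp (continuous_id.matrix_elem i j)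

theorem smul_mem_realM {z : ℂ} (hz : z.im = 0) {M : CMat2} (hM : M ∈ realM) : z • M ∈ realM := by
  have : z • M = z.re • M := by
    ext i j
    have : z = (z.re : ℂ) := Complex.ext rfl (by simpa using hz)
    rw [this]
    simp [Matrix.smul_apply]
  rw [this]
  exact realM.smul_mem hM _

theorem det_im_eq_zero {M : CMat2} (hM : M ∈ realM) : M.det.im = 0 := by
  rw [mem_realM_iff] at hM
  simp [Matrix.det_fin_two, hM]

theorem trace_im_eq_zero {M : CMat2} (hM : M ∈ realM) : M.trace.im = 0 := by
  rw [mem_realM_iff] at hM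
  simp [Matrix.trace_fin_two, hM]

theorem im_inv_eq_zero {z : ℂ} (hz : z.im = 0) : (z⁻¹).im = 0 := by
  rw [Complex.inv_im, hz]; simp

theorem im_mul_eq_zero {z w : ℂ} (hz : z.im = 0) (hw : w.im = 0) : (z * w).im = 0 := by
  rw [Complex.mul_im, hz, hw]; simp

theorem im_div_two_eq_zero {z : ℂ} (hz : z.im = 0) : (z / 2).im = 0 := by
  rw [div_eq_mul_inv]
  exact im_mul_eq_zero hz (im_inv_eq_zero (by simp))

theorem inv1_mem {a : CMat2} (ha : a ∈ realM) : inv1 a ∈ realM :=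
  smul_mem_realM (im_inv_eq_zero (by rw [Complex.add_im, det_im_eq_zero ha]; simp))
    (realM.add_mem realM.one_mem ha)

theorem cay_mem {a : CMat2} (ha : a ∈ realM) : cay a ∈ realM :=
  realM.mul_mem (realM.add_mem realM.one_mem ha) (inv1_mem ha)

theorem adjugate_mem {Z : CMat2} (hZ : Z ∈ realM) : Z.adjugate ∈ realM := by
  rw [mem_realM_iff] at hZ ⊢
  intro i j
  fin_cases i <;> fin_cases j <;> simp [Matrix.adjugate_fin_two, hZ]

theorem counterStep_mem {s : ℂ} {κ η : CMat2} (hs : s.im = 0) (hκ : κ ∈ realM) (hη : η ∈ realM) :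
    counterStep s κ η ∈ realM :=
  realM.mul_mem (realM.mul_mem (inv1_mem (smul_mem_realM (im_div_two_eq_zero hs) hκ)) hη)
    (inv1_mem (realM.neg_mem (smul_mem_realM (im_div_two_eq_zero hs) (realM.add_mem hκ hη))))

theorem midStep_mem {s : ℂ} {Z κ h η : CMat2} (hs : s.im = 0) (hZ : Z ∈ realM) (hκ : κ ∈ realM)
    (hh : h ∈ realM) (hη : η ∈ realM) : midStep s Z κ h η ∈ realM := by
  have h1 := realM.mul_mem (realM.mul_mem (adjugate_mem hZ) (counterStep_mem hs hκ hη)) hZ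
  exact realM.sub_mem (realM.sub_mem hh h1) (smul_mem_realM hs (realM.mul_mem hh h1))

theorem errStep_mem {χ s : ℂ} {Z κ h η Y P : CMat2} (hχ : χ.im = 0) (hs : s.im = 0)
    (hZ : Z ∈ realM) (hκ : κ ∈ realM) (hh : h ∈ realM) (hη : η ∈ realM) (hY : Y ∈ realM)
    (hP : P ∈ realM) : errStep χ s Z κ h η Y P ∈ realM := by
  have ha := smul_mem_realM (im_div_two_eq_zero hχ) hY
  have ha' := realM.neg_mem (realM.add_mem ha (smul_mem_realM (im_div_two_eq_zero hs) hP))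
  exact realM.sub_mem (realM.mul_mem (realM.mul_mem (cay_mem ha') (midStep_mem hs hZ hκ hh hη))
    (cay_mem ha)) (realM.mul_mem (realM.mul_mem (inv1_mem ha') hP) (inv1_mem ha))

theorem expQuot_mem {a : CMat2} (ha : a ∈ realM) : expQuot a ∈ realM := by
  by_cases hs : Summable fun k : ℕ => (((k + 1).factorial : ℂ)⁻¹) • a ^ k
  · refine isClosed_realM.mem_of_tendsto hs.hasSum.tendsto_sum_nat (.of_forall fun n => ?_)
    exact realM.sum_mem fun k _ => smul_mem_realM (im_inv_eq_zero (by simp)) (realM.pow_mem ha k)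
  · rw [expQuot, tsum_eq_zero_of_not_summable hs]
    exact realM.zero_mem

theorem initErr_mem {s : ℂ} {f : CMat2} (hs : s.im = 0) (hf : f ∈ realM) : initErr s f ∈ realM :=
  realM.mul_mem hf (expQuot_mem (smul_mem_realM hs hf))

theorem lam_im_eq_zero {w : ℂ} (hw : w.im = 0) : (lam w).im = 0 := by
  have h : w = (w.re : ℂ) := Complex.ext rfl (by simpa using hw)
  have h2 : lam w = ((∑' k : ℕ, w.re ^ k / (2 * k + 1) : ℝ) : ℂ) := by
    rw [lam, h, Complex.ofReal_tsum]
    push_cast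
    rfl
  rw [h2, Complex.ofReal_im]

theorem continuous_ofRealM : Continuous ofRealM :=
  LinearMap.continuous_of_finiteDimensional ofRealM.toLinearMap

theorem ofRealM_exp (R : Mat2) : ofRealM (NormedSpace.exp R) = NormedSpace.exp (ofRealM R) := by
  let : NormedAlgebra ℚ Mat2 := NormedAlgebra.restrictScalars ℚ ℝ Mat2
  exact NormedSpace.map_exp ofRealM continuous_ofRealM R

theorem ofRealM_injective : Function.Injective ofRealM := fun R R' h => by
  ext i j
  have := congrFun (congrFun h i) j
  exact Complex.ofReal_injective this

theorem ofRealM_smul (r : ℝ) (R : Mat2) : ofRealM (r • R) = (r : ℂ) • ofRealM R := by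
  rw [map_smul]
  ext i j
  simp [Matrix.smul_apply]

end CMat2

/-! ### Complex strips and the identity theorem on them. -/

section Strip

variable {d : ℕ} {ρ σ : ℝ}

theorem isOpen_strip (d : ℕ) (ρ : ℝ) : IsOpen (strip d ρ) := by
  have : strip d ρ = ⋂ i, {z : Fin d → ℂ | |(z i).im| < ρ} := by
    ext z; simp [strip]
  rw [this]
  exact isOpen_iInter_of_finite fun i => isOpen_lt (by fun_prop) continuous_const

theorem convex_strip (d : ℕ) (ρ : ℝ) : Convex ℝ (strip d ρ) := by
  intro z hz w hw a b ha hb hab i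
  have h1 := hz i
  have h2 := hw i
  have h3 : ((a • z + b • w) i).im = a * (z i).im + b * (w i).im := by simp
  rw [h3]
  rw [abs_lt] at *
  exact (convex_Ioo (-ρ) ρ) h1 h2 ha hb hab

theorem strip_mono (h : σ ≤ ρ) : strip d σ ⊆ strip d ρ := fun _ hz i => (hz i).trans_le h

theorem toC_mem_strip (hρ : 0 < ρ) (x : Fin d → ℝ) : toC x ∈ strip d ρ := fun i => by
  simpa [toC] using hρ

theorem toC_add (x y : Fin d → ℝ) : toC (x + y) = toC x + toC y := by
  ext i; simp [toC]

theorem add_toC_mem_strip {z : Fin d → ℂ} (hz : z ∈ strip d ρ) (x : Fin d → ℝ) :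
    z + toC x ∈ strip d ρ := fun i => by
  simpa [toC] using hz i

theorem star_mem_strip {z : Fin d → ℂ} (hz : z ∈ strip d ρ) : star z ∈ strip d ρ := fun i => by
  simpa using hz i

theorem toC_re_add (z : Fin d → ℂ) :
    toC (fun i => (z i).re) + Complex.I • toC (fun i => (z i).im) = z := by
  ext i
  simp only [toC, Pi.add_apply, Pi.smul_apply, smul_eq_mul]
  rw [mul_comm]
  exact Complex.re_add_im (z i)

/-- Each `z` equals `Re z + I • Im z`, the point with parameter `I` on a complex line whose real
parameters give real points. -/
theorem eqOn_strip_of_eq_real {F : Type*} [NormedAddCommGroup F] [NormedSpace ℂ F]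
    [CompleteSpace F] (hρ : 0 < ρ) {f g : (Fin d → ℂ) → F} (hf : DifferentiableOn ℂ f (strip d ρ))
    (hg : DifferentiableOn ℂ g (strip d ρ)) (h : ∀ x, f (toC x) = g (toC x)) :
    EqOn f g (strip d ρ) := by
  intro z hz
  rw [← sub_eq_zero, ← toC_re_add z]
  refine eq_zero_of_eq_zero_on_real_line (isOpen_strip d ρ) (convex_strip d ρ) (hf.sub hg)
    (toC_mem_strip hρ _) (by rwa [toC_re_add]) fun s _ => ?_
  have : toC (fun i => (z i).re) + (s : ℂ) • toC (fun i => (z i).im)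
      = toC (fun i => (z i).re + s * (z i).im) := by
    ext i; simp [toC]
  rw [this]
  exact sub_eq_zero.2 (h _)

end Strip

/-! ### Differentiability entry by entry. -/

section Entries

variable {E : Type*} [NormedAddCommGroup E] [NormedSpace ℂ E]

/-- The entry of a matrix as a continuous linear functional. -/
noncomputable def CMat2.entryCLM (i j : Fin 2) : CMat2 →L[ℂ] ℂ :=
  LinearMap.toContinuousLinearMap (Matrix.entryLinearMap ℂ ℂ i j)

theorem DifferentiableOn.entry {F : E → CMat2} {s : Set E} (h : DifferentiableOn ℂ F s)
    (i j : Fin 2) : DifferentiableOn ℂ (fun x => F x i j) s :=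
  (CMat2.entryCLM i j).differentiable.comp_differentiableOn h

theorem differentiableOn_of_entries {F : E → CMat2} {s : Set E}
    (h : ∀ i j, DifferentiableOn ℂ (fun x => F x i j) s) : DifferentiableOn ℂ F s := by
  have : F = fun x => ∑ i, ∑ j, F x i j • (Matrix.single i j (1 : ℂ) : CMat2) := by
    funext x
    conv_lhs => rw [Matrix.matrix_eq_sum_single (F x)]
    simp [Matrix.smul_single]
  rw [this]
  exact DifferentiableOn.fun_sum fun i _ => DifferentiableOn.fun_sum fun j _ =>
    (h i j).smul_const _

end Entries

/-! ### Holomorphic families of functions on strips and bounded operators acting on them. -/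

section Families

variable {d : ℕ}

/-- Bounded holomorphic `ℤ^d`-periodic functions on a strip. -/
structure BH (ρ M : ℝ) (g : (Fin d → ℂ) → CMat2) : Prop where
  diff : DifferentiableOn ℂ g (strip d ρ)
  bound : ∀ z ∈ strip d ρ, ‖g z‖ ≤ M
  per : ∀ z ∈ strip d ρ, ∀ k : Fin d → ℤ, g (z + fun i => (k i : ℂ)) = g z

/-- Bounded jointly holomorphic families of periodic functions on a strip. -/
structure FH (U : Set (Fin 2 → ℂ)) (ρ M : ℝ) (g : (Fin 2 → ℂ) → (Fin d → ℂ) → CMat2) :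
    Prop where
  diff : DifferentiableOn ℂ (fun p : (Fin 2 → ℂ) × (Fin d → ℂ) => g p.1 p.2) (U ×ˢ strip d ρ)
  bound : ∀ ζ ∈ U, ∀ z ∈ strip d ρ, ‖g ζ z‖ ≤ M
  per : ∀ ζ ∈ U, ∀ z ∈ strip d ρ, ∀ k : Fin d → ℤ, g ζ (z + fun i => (k i : ℂ)) = g ζ z

/-- Bounded linear operators between spaces of bounded holomorphic functions. -/
structure BddOp (ρ σ K : ℝ) (Λ : ((Fin d → ℂ) → CMat2) → (Fin d → ℂ) → CMat2) : Prop where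
  add : ∀ {M M' g g'}, BH ρ M g → BH ρ M' g' → ∀ z ∈ strip d σ,
    Λ (fun z => g z + g' z) z = Λ g z + Λ g' z
  smul : ∀ {M g}, BH ρ M g → ∀ (a : ℂ), ∀ z ∈ strip d σ, Λ (fun z => a • g z) z = a • Λ g z
  bh : ∀ {M g}, BH ρ M g → BH σ (K * M) (Λ g)

variable {U : Set (Fin 2 → ℂ)} {ρ σ M M' K : ℝ}

theorem FH.single {g : (Fin 2 → ℂ) → (Fin d → ℂ) → CMat2} (hg : FH U ρ M g) {ζ : Fin 2 → ℂ}
    (hζ : ζ ∈ U) : BH ρ M (g ζ) where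
  diff := hg.diff.comp (f := fun z => (ζ, z)) (by fun_prop) fun _ hz => ⟨hζ, hz⟩
  bound := hg.bound ζ hζ
  per := hg.per ζ hζ

theorem BH.family {g : (Fin d → ℂ) → CMat2} (hg : BH ρ M g) : FH U ρ M (fun _ => g) where
  diff := hg.diff.comp (f := Prod.snd) (by fun_prop) fun _ hp => hp.2
  bound := fun _ _ => hg.bound
  per := fun _ _ => hg.per

theorem BH.add {g g' : (Fin d → ℂ) → CMat2} (hg : BH ρ M g) (hg' : BH ρ M' g') :
    BH ρ (M + M') (fun z => g z + g' z) where
  diff := hg.diff.add hg'.diff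
  bound := fun z hz => (norm_add_le _ _).trans (add_le_add (hg.bound z hz) (hg'.bound z hz))
  per := fun z hz k => by simp only [hg.per z hz k, hg'.per z hz k]

theorem BH.smul {g : (Fin d → ℂ) → CMat2} (hg : BH ρ M g) (a : ℂ) :
    BH ρ (‖a‖ * M) (fun z => a • g z) where
  diff := hg.diff.const_smul a
  bound := fun z hz => by rw [norm_smul]; gcongr; exact hg.bound z hz
  per := fun z hz k => by simp only [hg.per z hz k]

theorem FH.mono {g : (Fin 2 → ℂ) → (Fin d → ℂ) → CMat2} (hg : FH U ρ M g) (hσ : σ ≤ ρ)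
    (hM : M ≤ M') : FH U σ M' g where
  diff := hg.diff.mono (prod_mono_right (strip_mono hσ))
  bound := fun ζ hζ z hz => (hg.bound ζ hζ z (strip_mono hσ hz)).trans hM
  per := fun ζ hζ z hz => hg.per ζ hζ z (strip_mono hσ hz)

/-- By the second-order Taylor bound the difference quotients in the parameter converge uniformly in
`z`, so the parameter derivative inherits holomorphy, boundedness and periodicity. -/
theorem BH.deriv {g : (Fin 2 → ℂ) → (Fin d → ℂ) → CMat2} {ζ₀ : Fin 2 → ℂ} {R : ℝ} (hR : 0 < R)
    (hg : FH (ball ζ₀ R) ρ M g) (i : Fin 2) :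
    BH ρ (2 * M / R) (fun z => fderiv ℂ (fun ζ => g ζ z) ζ₀ (Pi.single i 1)) := by
  have hsec : ∀ z ∈ strip d ρ, DifferentiableOn ℂ (fun ζ => g ζ z) (ball ζ₀ R) := fun z hz =>
    hg.diff.comp (f := fun ζ => (ζ, z)) (by fun_prop) fun _ hζ => ⟨hζ, hz⟩
  have hone : ‖(Pi.single i 1 : Fin 2 → ℂ)‖ = 1 := by rw [Pi.norm_single, norm_one]
  refine ⟨?_, fun z hz => ?_, fun z hz k => ?_⟩
  · set τ : ℕ → ℝ := fun n => (R / 2) * (1 / ((n : ℝ) + 1)) with hτ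
    have hτ0 : ∀ n, 0 < τ n := fun n => by positivity
    have hτR : ∀ n, τ n < R := fun n => by
      have : 1 / ((n : ℝ) + 1) ≤ 1 := by
        rw [div_le_one (by positivity)]; linarith [(Nat.cast_nonneg n : (0 : ℝ) ≤ n)]
      calc τ n ≤ R / 2 * 1 := by simp only [hτ]; gcongr
        _ < R := by linarith
    have hτl : Tendsto τ atTop (𝓝 0) := by
      simpa [hτ] using (tendsto_one_div_add_atTop_nhds_zero_nat (𝕜 := ℝ)).const_mul (R / 2)
    have hnorm : ∀ n, ‖(τ n : ℂ) • (Pi.single i 1 : Fin 2 → ℂ)‖ = τ n := fun n => by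
      rw [norm_smul, hone, mul_one, Complex.norm_real, Real.norm_of_nonneg (hτ0 n).le]
    have hmem : ∀ n, ζ₀ + (τ n : ℂ) • (Pi.single i 1 : Fin 2 → ℂ) ∈ ball ζ₀ R := fun n => by
      rw [mem_ball, dist_eq_norm, add_sub_cancel_left, hnorm]
      exact hτR n
    refine differentiableOn_of_uniform_limit (isOpen_strip d ρ)
      (f := fun n z => ((τ n : ℂ)⁻¹) • (g (ζ₀ + (τ n : ℂ) • (Pi.single i 1 : Fin 2 → ℂ)) z - g ζ₀ z))
      (b := fun n => 4 * M * τ n / R ^ 2) (fun n => ?_) ?_ fun n z hz => ?_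
    · exact ((hg.single (hmem n)).diff.sub (hg.single (mem_ball_self hR)).diff).const_smul ((τ n : ℂ)⁻¹)
    · simpa using (hτl.const_mul (4 * M)).div_const (R ^ 2)
    · have h1 := norm_taylor_one_le hR (hsec z hz) (fun ζ hζ => hg.bound ζ hζ z hz) (hmem n)
      have hne : (τ n : ℂ) ≠ 0 := by exact_mod_cast (hτ0 n).ne'
      rw [add_sub_cancel_left, hnorm, map_smul] at h1
      have h2 : ∀ a b : CMat2, ((τ n : ℂ)⁻¹) • a - b = ((τ n : ℂ)⁻¹) • (a - (τ n : ℂ) • b) :=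
        fun a b => by rw [smul_sub, inv_smul_smul₀ hne]
      rw [h2, norm_smul, norm_inv, Complex.norm_real, Real.norm_of_nonneg (hτ0 n).le]
      calc (τ n)⁻¹ * _ ≤ (τ n)⁻¹ * (4 * M * (τ n / R) ^ 2) := by
            gcongr
        _ = 4 * M * τ n / R ^ 2 := by have := (hτ0 n).ne'; field_simp
  · have h1 := norm_fderiv_le_of_bounded hR (hsec z hz) (fun ζ hζ => hg.bound ζ hζ z hz)
    have h2 := (fderiv ℂ (fun ζ => g ζ z) ζ₀).le_opNorm (Pi.single i 1)
    rw [hone, mul_one] at h2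
    exact h2.trans h1
  · have : (fun ζ => g ζ (z + fun i => (k i : ℂ))) =ᶠ[𝓝 ζ₀] fun ζ => g ζ z := by
      filter_upwards [ball_mem_nhds ζ₀ hR] with ζ hζ
      exact hg.per ζ hζ z hz k
    simp only [this.fderiv_eq]

/-- The first-order Taylor expansion of `g` in the parameter has coefficients in the domain of `Λ`.
By linearity `Λ (g ζ)` is an affine function of `ζ` with holomorphic coefficients plus `Λ` of the
remainder, which is quadratic in `ζ - ζ₀` uniformly in `z`. Both parts are jointly differentiable at
the base point. -/
theorem BddOp.family {Λ : ((Fin d → ℂ) → CMat2) → (Fin d → ℂ) → CMat2} (hΛ : BddOp ρ σ K Λ)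
    (hU : IsOpen U) {g : (Fin 2 → ℂ) → (Fin d → ℂ) → CMat2} (hg : FH U ρ M g) :
    FH U σ (K * M) (fun ζ => Λ (g ζ)) where
  bound := fun ζ hζ => (hΛ.bh (hg.single hζ)).bound
  per := fun ζ hζ => (hΛ.bh (hg.single hζ)).per
  diff := by
    rintro ⟨ζ₀, z₀⟩ ⟨hζ₀, hz₀⟩
    simp only at hζ₀ hz₀
    obtain ⟨R, hR, hRU⟩ := Metric.isOpen_iff.1 hU ζ₀ hζ₀
    have hgR : FH (ball ζ₀ R) ρ M g :=
      ⟨hg.diff.mono (prod_mono_left hRU), fun ζ hζ => hg.bound ζ (hRU hζ),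
        fun ζ hζ => hg.per ζ (hRU hζ)⟩
    set v : Fin 2 → (Fin d → ℂ) → CMat2 :=
      fun i z => fderiv ℂ (fun ζ => g ζ z) ζ₀ (Pi.single i 1) with hv
    have hvB : ∀ i, BH ρ (2 * M / R) (v i) := fun i => BH.deriv hR hgR i
    set Φ : (Fin 2 → ℂ) × (Fin d → ℂ) → CMat2 := fun p =>
      Λ (g ζ₀) p.2 + ((p.1 0 - ζ₀ 0) • Λ (v 0) p.2 + (p.1 1 - ζ₀ 1) • Λ (v 1) p.2) with hΦ
    have hdiff2 : ∀ {M : ℝ} {w : (Fin d → ℂ) → CMat2}, BH ρ M w →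
        DifferentiableAt ℂ (fun p : (Fin 2 → ℂ) × (Fin d → ℂ) => Λ w p.2) (ζ₀, z₀) := by
      intro M w hw
      have := ((hΛ.bh hw).diff.differentiableAt ((isOpen_strip d σ).mem_nhds hz₀))
      exact DifferentiableAt.comp (f := Prod.snd) (ζ₀, z₀) this differentiableAt_snd
    have hΦd : DifferentiableAt ℂ Φ (ζ₀, z₀) := by
      have h0 := hdiff2 (hg.single hζ₀)
      have h1 := hdiff2 (hvB 0)
      have h2 := hdiff2 (hvB 1)
      have e0 : DifferentiableAt ℂ (fun p : (Fin 2 → ℂ) × (Fin d → ℂ) => p.1 0 - ζ₀ 0)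
        (ζ₀, z₀) := by fun_prop
      have e1 : DifferentiableAt ℂ (fun p : (Fin 2 → ℂ) × (Fin d → ℂ) => p.1 1 - ζ₀ 1)
        (ζ₀, z₀) := by fun_prop
      exact h0.add ((e0.smul h1).add (e1.smul h2))
    have hrem : ∀ ζ ∈ ball ζ₀ R, ∀ z ∈ strip d σ,
        ‖Λ (g ζ) z - Φ (ζ, z)‖ ≤ K * (4 * M * (‖ζ - ζ₀‖ / R) ^ 2) := by
      intro ζ hζ z hz
      set w : (Fin d → ℂ) → CMat2 := fun z => g ζ z + (-1 : ℂ) •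
        (g ζ₀ z + ((ζ 0 - ζ₀ 0) • v 0 z + (ζ 1 - ζ₀ 1) • v 1 z)) with hw
      have b1 := (hvB 0).smul (ζ 0 - ζ₀ 0)
      have b2 := (hvB 1).smul (ζ 1 - ζ₀ 1)
      have b3 := (hg.single hζ₀).add (b1.add b2)
      have b4 := (hg.single (hRU hζ)).add (b3.smul (-1))
      have hwB : BH ρ (4 * M * (‖ζ - ζ₀‖ / R) ^ 2) w := by
        refine ⟨b4.diff, fun z hz => ?_, b4.per⟩
        have hsec : DifferentiableOn ℂ (fun ζ => g ζ z) (ball ζ₀ R) :=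
          hgR.diff.comp (f := fun ζ => (ζ, z)) (by fun_prop) fun _ hζ => ⟨hζ, hz⟩
        have := norm_taylor_one_le hR hsec (fun ζ hζ => hgR.bound ζ hζ z hz) hζ
        have e : ζ - ζ₀ = (ζ 0 - ζ₀ 0) • (Pi.single 0 1 : Fin 2 → ℂ)
            + (ζ 1 - ζ₀ 1) • (Pi.single 1 1 : Fin 2 → ℂ) := by
          ext i; fin_cases i <;> simp
        have e2 : w z = g ζ z - g ζ₀ z - fderiv ℂ (fun ζ => g ζ z) ζ₀ (ζ - ζ₀) := by
          rw [e, map_add, map_smul, map_smul]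
          simp only [hw, hv]
          rw [neg_one_smul]; abel
        rw [e2]
        exact this
      have hval : Λ w z = Λ (g ζ) z - Φ (ζ, z) := by
        rw [hw, hΛ.add (hg.single (hRU hζ)) (b3.smul (-1)) z hz, hΛ.smul b3 (-1) z hz,
          hΛ.add (hg.single hζ₀) (b1.add b2) z hz, hΛ.add b1 b2 z hz, hΛ.smul (hvB 0) _ z hz,
          hΛ.smul (hvB 1) _ z hz, neg_one_smul, sub_eq_add_neg (Λ (g ζ) z)]
      rw [← hval]
      exact (hΛ.bh hwB).bound z hz
    have hrd : DifferentiableAt ℂ (fun p : (Fin 2 → ℂ) × (Fin d → ℂ) => Λ (g p.1) p.2 - Φ p)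
        (ζ₀, z₀) := by
      have hO : (fun p : (Fin 2 → ℂ) × (Fin d → ℂ) => Λ (g p.1) p.2 - Φ p)
          =O[𝓝 (ζ₀, z₀)] fun p => ‖p - (ζ₀, z₀)‖ ^ 2 := by
        refine Asymptotics.IsBigO.of_bound (|K * (4 * M / R ^ 2)|) ?_
        filter_upwards [prod_mem_nhds (ball_mem_nhds ζ₀ hR) ((isOpen_strip d σ).mem_nhds hz₀)]
          with p hp
        have h1 := hrem p.1 hp.1 p.2 hp.2
        have h2 : ‖p.1 - ζ₀‖ ≤ ‖p - (ζ₀, z₀)‖ := norm_fst_le (p - (ζ₀, z₀))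
        rw [norm_pow, norm_norm]
        calc _ ≤ K * (4 * M * (‖p.1 - ζ₀‖ / R) ^ 2) := h1
          _ = K * (4 * M / R ^ 2) * ‖p.1 - ζ₀‖ ^ 2 := by rw [div_pow]; ring
          _ ≤ |K * (4 * M / R ^ 2)| * ‖p.1 - ζ₀‖ ^ 2 := by gcongr; exact le_abs_self _
          _ ≤ _ := by gcongr
      exact (hO.hasFDerivAt (by norm_num)).differentiableAt
    have : DifferentiableAt ℂ (fun p : (Fin 2 → ℂ) × (Fin d → ℂ) => Λ (g p.1) p.2 - Φ p + Φ p)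
      (ζ₀, z₀) := hrd.add hΦd
    simp only [sub_add_cancel] at this
    exact this.differentiableWithinAt

end Families

/-! ### Scalar real functions with a bounded holomorphic extension. -/

section RealAnalytic

variable {d : ℕ}

/-- Real functions with a bounded holomorphic extension to some strip. -/
def HasStripExtension (u : (Fin d → ℝ) → ℝ) : Prop :=
  ∃ (ρ M : ℝ) (F : (Fin d → ℂ) → ℂ), 0 < ρ ∧ DifferentiableOn ℂ F (strip d ρ) ∧
    (∀ x, F (toC x) = u x) ∧ ∀ z ∈ strip d ρ, ‖F z‖ ≤ M

namespace HasStripExtension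

variable {u v : (Fin d → ℝ) → ℝ}

theorem const (k : ℝ) : HasStripExtension (fun _ : Fin d → ℝ => k) :=
  ⟨1, ‖(k : ℂ)‖, fun _ => k, one_pos, by fun_prop, fun _ => rfl, fun _ _ => le_rfl⟩

theorem add (hu : HasStripExtension u) (hv : HasStripExtension v) :
    HasStripExtension (fun x => u x + v x) := by
  obtain ⟨ρ, M, F, hρ, hF, hFu, hFM⟩ := hu
  obtain ⟨ρ', M', F', hρ', hF', hFu', hFM'⟩ := hv
  refine ⟨min ρ ρ', M + M', fun z => F z + F' z, lt_min hρ hρ',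
    (hF.mono (strip_mono (min_le_left _ _))).add (hF'.mono (strip_mono (min_le_right _ _))),
    fun x => by simp [hFu, hFu'], fun z hz => (norm_add_le _ _).trans
      (add_le_add (hFM z (strip_mono (min_le_left _ _) hz))
        (hFM' z (strip_mono (min_le_right _ _) hz)))⟩

theorem const_mul (hu : HasStripExtension u) (k : ℝ) : HasStripExtension (fun x => k * u x) := by
  obtain ⟨ρ, M, F, hρ, hF, hFu, hFM⟩ := hu
  refine ⟨ρ, ‖(k : ℂ)‖ * M, fun z => k * F z, hρ, hF.const_mul _,
    fun x => by simp [hFu], fun z hz => ?_⟩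
  rw [norm_mul]
  gcongr
  exact hFM z hz

theorem sub (hu : HasStripExtension u) (hv : HasStripExtension v) :
    HasStripExtension (fun x => u x - v x) := by
  convert hu.add (hv.const_mul (-1)) using 2
  ring

theorem shift (hu : HasStripExtension u) (w : Fin d → ℝ) :
    HasStripExtension (fun x => u (x + w)) := by
  obtain ⟨ρ, M, F, hρ, hF, hFu, hFM⟩ := hu
  refine ⟨ρ, M, fun z => F (z + toC w), hρ, hF.comp (by fun_prop)
    fun z hz => add_toC_mem_strip hz w, fun x => ?_, fun z hz => hFM _ (add_toC_mem_strip hz w)⟩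
  simp only [← toC_add, hFu]

theorem continuous (hu : HasStripExtension u) : Continuous u := by
  obtain ⟨ρ, M, F, hρ, hF, hFu, hFM⟩ := hu
  have h : u = fun x => (F (toC x)).re := by
    funext x; rw [hFu, Complex.ofReal_re]
  rw [h]
  refine Complex.continuous_re.comp (hF.continuousOn.comp_continuous ?_ (toC_mem_strip hρ))
  unfold toC
  fun_prop

theorem bounded (hu : HasStripExtension u) : ∃ M, ∀ x, |u x| ≤ M := by
  obtain ⟨ρ, M, F, hρ, hF, hFu, hFM⟩ := hu
  refine ⟨M, fun x => ?_⟩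
  have := hFM _ (toC_mem_strip hρ x)
  rwa [hFu, Complex.norm_real, Real.norm_eq_abs] at this

end HasStripExtension

theorem StripNormLE.entry {ρ M : ℝ} (hρ : 0 < ρ) {f : (Fin d → ℝ) → Mat2} (h : StripNormLE ρ f M)
    (i j : Fin 2) : HasStripExtension (fun x => f x i j) := by
  obtain ⟨F, hF, hFf, hFM⟩ := h
  refine ⟨ρ, M, fun z => F z i j, hρ, hF.entry i j, fun x => ?_,
    fun z hz => (CMat2.norm_entry_le _ i j).trans (hFM z hz)⟩
  simp [hFf]

theorem isAnalyticTorus_iff {N : ℕ} {f : (Fin d → ℝ) → Mat2} :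
    IsAnalyticTorus N f ↔ TorusPeriodic N f ∧ ∀ i j, HasStripExtension (fun x => f x i j) := by
  constructor
  · rintro ⟨ρ, hρ, hper, M, h⟩
    exact ⟨hper, fun i j => h.entry hρ i j⟩
  · rintro ⟨hper, h⟩
    choose ρ M F hρ hF hFu hFM using h
    set σ := min (min (ρ 0 0) (ρ 0 1)) (min (ρ 1 0) (ρ 1 1)) with hσ
    have hσle : ∀ i j, σ ≤ ρ i j := by
      intro i j
      fin_cases i <;> fin_cases j
      · exact (min_le_left _ _).trans (min_le_left _ _)
      · exact (min_le_left _ _).trans (min_le_right _ _)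
      · exact (min_le_right _ _).trans (min_le_left _ _)
      · exact (min_le_right _ _).trans (min_le_right _ _)
    refine ⟨σ, lt_min (lt_min (hρ 0 0) (hρ 0 1)) (lt_min (hρ 1 0) (hρ 1 1)), hper,
      4 * (max (max (M 0 0) (M 0 1)) (max (M 1 0) (M 1 1))),
      fun z => Matrix.of fun i j => F i j z, ?_, ?_, ?_⟩
    · exact differentiableOn_of_entries fun i j => (hF i j).mono (strip_mono (hσle i j))
    · intro x
      ext i j
      simp [hFu]
    · intro z hz
      refine CMat2.norm_le_of_entry_le fun i j => (hFM i j z (strip_mono (hσle i j) hz)).trans ?_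
      fin_cases i <;> fin_cases j
      · exact (le_max_left _ _).trans (le_max_left _ _)
      · exact (le_max_right _ _).trans (le_max_left _ _)
      · exact (le_max_left _ _).trans (le_max_right _ _)
      · exact (le_max_right _ _).trans (le_max_right _ _)

end RealAnalytic

/-! ### Mean values over the torus. -/

section Mean

open MeasureTheory

variable {d : ℕ}

/-- The mean of a scalar function. -/
noncomputable def scalarMean (N : ℕ) (u : (Fin d → ℝ) → ℝ) : ℝ :=
  ⨍ x in Set.Icc (0 : Fin d → ℝ) (fun _ => (N : ℝ)), u x

theorem torusMean_entry (N : ℕ) (f : (Fin d → ℝ) → SL2Alg) (i j : Fin 2) :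
    (torusMean N f : Mat2) i j = scalarMean N (fun x => (f x : Mat2) i j) := rfl

theorem scalarMean_add (N : ℕ) {u v : (Fin d → ℝ) → ℝ} (hu : Continuous u) (hv : Continuous v) :
    scalarMean N (fun x => u x + v x) = scalarMean N u + scalarMean N v := by
  simp only [scalarMean, setAverage_eq]
  rw [integral_add (hu.continuousOn.integrableOn_compact isCompact_Icc)
    (hv.continuousOn.integrableOn_compact isCompact_Icc), smul_add]

theorem scalarMean_const_mul (N : ℕ) (k : ℝ) (u : (Fin d → ℝ) → ℝ) :
    scalarMean N (fun x => k * u x) = k * scalarMean N u := by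
  simp only [scalarMean, setAverage_eq]
  rw [integral_const_mul, smul_eq_mul, smul_eq_mul]
  ring

theorem volume_cube_ne_zero {N : ℕ} (hN : 0 < N) :
    volume (Set.Icc (0 : Fin d → ℝ) (fun _ => (N : ℝ))) ≠ 0 := by
  rw [Real.volume_Icc_pi]
  refine Finset.prod_ne_zero_iff.2 fun i _ => ?_
  simp [hN.ne']

theorem volume_cube_ne_top (N : ℕ) :
    volume (Set.Icc (0 : Fin d → ℝ) (fun _ => (N : ℝ))) ≠ ⊤ :=
  isCompact_Icc.measure_lt_top.ne

theorem scalarMean_const {N : ℕ} (hN : 0 < N) (k : ℝ) :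
    scalarMean N (fun _ : Fin d → ℝ => k) = k :=
  setAverage_const (volume_cube_ne_zero hN) (volume_cube_ne_top N) k

theorem abs_scalarMean_le {N : ℕ} (hN : 0 < N) {u : (Fin d → ℝ) → ℝ} {M : ℝ}
    (h : ∀ x, |u x| ≤ M) : |scalarMean N u| ≤ M := by
  have hv : 0 < volume.real (Set.Icc (0 : Fin d → ℝ) (fun _ => (N : ℝ))) :=
    ENNReal.toReal_pos (volume_cube_ne_zero hN) (volume_cube_ne_top N)
  rw [scalarMean, setAverage_eq, smul_eq_mul, abs_mul, abs_inv, abs_of_pos hv, inv_mul_le_iff₀ hv]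
  have := norm_setIntegral_le_of_norm_le_const (f := u) (C := M)
    (volume_cube_ne_top (d := d) N).lt_top (fun x _ => h x)
  rw [mul_comm]
  exact this

end Mean

/-! ### Coordinates on `sl(2,ℝ)` and conjugation by the unipotent matrix. -/

section SL2

theorem SL2Alg.entry11 (X : SL2Alg) : (X : Mat2) 1 1 = -(X : Mat2) 0 0 := by
  have h : Matrix.trace (X : Mat2) = 0 := X.2
  rw [Matrix.trace_fin_two] at h
  linarith

theorem SL2Alg.ext_entries {X Y : SL2Alg} (h00 : (X : Mat2) 0 0 = (Y : Mat2) 0 0)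
    (h01 : (X : Mat2) 0 1 = (Y : Mat2) 0 1) (h10 : (X : Mat2) 1 0 = (Y : Mat2) 1 0) : X = Y := by
  apply Subtype.ext
  ext i j
  fin_cases i <;> fin_cases j
  · exact h00
  · exact h01
  · exact h10
  · change (X : Mat2) 1 1 = (Y : Mat2) 1 1
    rw [X.entry11, Y.entry11, h00]

/-- The projection of a real matrix to its trace-zero part. -/
noncomputable def toSL : Mat2 →ₗ[ℝ] SL2Alg where
  toFun M := ⟨!![(M 0 0 - M 1 1) / 2, M 0 1; M 1 0, (M 1 1 - M 0 0) / 2], by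
    change Matrix.trace (_ : Mat2) = 0
    rw [Matrix.trace_fin_two]
    simp
    ring⟩
  map_add' M N := by
    apply SL2Alg.ext_entries <;> simp
    ring
  map_smul' k M := by
    apply SL2Alg.ext_entries <;> simp
    ring

theorem toSL_00 (M : Mat2) : (toSL M : Mat2) 0 0 = (M 0 0 - M 1 1) / 2 := rfl
theorem toSL_01 (M : Mat2) : (toSL M : Mat2) 0 1 = M 0 1 := rfl
theorem toSL_10 (M : Mat2) : (toSL M : Mat2) 1 0 = M 1 0 := rfl

theorem toSL_coe (X : SL2Alg) : toSL (X : Mat2) = X := by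
  apply SL2Alg.ext_entries
  · rw [toSL_00, X.entry11]; ring
  · rfl
  · rfl

theorem nilpotentA_mul_self (c : ℝ) : (nilpotentA c : Mat2) * (nilpotentA c : Mat2) = 0 := by
  change !![0, c; 0, 0] * !![0, c; 0, 0] = (0 : Mat2)
  ext i j
  fin_cases i <;> fin_cases j <;> simp [Matrix.mul_apply, Fin.sum_univ_two]

theorem exp_smul_nilpotentA (c t : ℝ) :
    NormedSpace.exp (t • (nilpotentA c : Mat2)) = 1 + t • (nilpotentA c : Mat2) :=
  exp_eq_one_add_of_mul_self_eq_zero (by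
    rw [smul_mul_smul_comm, nilpotentA_mul_self, smul_zero])

theorem exp_conj_nilpotentA (c : ℝ) (X : Mat2) :
    NormedSpace.exp (-(nilpotentA c : Mat2)) * X * NormedSpace.exp (nilpotentA c : Mat2)
      = !![X 0 0 - c * X 1 0, X 0 1 + c * (X 0 0 - X 1 1) - c ^ 2 * X 1 0;
          X 1 0, X 1 1 + c * X 1 0] := by
  have h1 := exp_smul_nilpotentA c 1
  have h2 := exp_smul_nilpotentA c (-1)
  rw [one_smul] at h1
  rw [neg_one_smul] at h2
  rw [h1, h2]
  change (1 + -!![0, c; 0, 0]) * X * (1 + !![0, c; 0, 0]) = _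
  ext i j
  fin_cases i <;> fin_cases j <;>
    simp [Matrix.mul_apply, Fin.sum_univ_two, Matrix.one_apply] <;> ring

end SL2

/-! ### The homological equation: consequences of admissibility. -/

section Homological

variable {d : ℕ} {ω : Fin d → ℝ} {c c' ν ρ₀ : ℝ} {C S : SL2Alg →ₗ[ℝ] SL2Alg}

/-- The element `(a b; g -a)` of `sl(2,ℝ)`. -/
noncomputable def slMk (a b g : ℝ) : SL2Alg := toSL !![a, b; g, -a]

theorem slMk_00 (a b g : ℝ) : (slMk a b g : Mat2) 0 0 = a := by
  rw [slMk, toSL_00]; simp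

theorem slMk_01 (a b g : ℝ) : (slMk a b g : Mat2) 0 1 = b := rfl

theorem slMk_10 (a b g : ℝ) : (slMk a b g : Mat2) 1 0 = g := rfl

theorem SL2Alg.add_entry (X Y : SL2Alg) (i j : Fin 2) :
    ((X + Y : SL2Alg) : Mat2) i j = (X : Mat2) i j + (Y : Mat2) i j := rfl

theorem SL2Alg.sub_entry (X Y : SL2Alg) (i j : Fin 2) :
    ((X - Y : SL2Alg) : Mat2) i j = (X : Mat2) i j - (Y : Mat2) i j := rfl

theorem SL2Alg.smul_entry (k : ℝ) (X : SL2Alg) (i j : Fin 2) :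
    ((k • X : SL2Alg) : Mat2) i j = k * (X : Mat2) i j := rfl

theorem SL2Alg.zero_entry (i j : Fin 2) : ((0 : SL2Alg) : Mat2) i j = 0 := rfl

/-- The homological equation, entry by entry. -/
def EntryEq (ω : Fin d → ℝ) (c : ℝ) (X R : (Fin d → ℝ) → SL2Alg) : Prop :=
  ∀ x, (X x : Mat2) 1 0 - (X (x + ω) : Mat2) 1 0 = -(R x : Mat2) 1 0 ∧
    (X x : Mat2) 0 0 - (X (x + ω) : Mat2) 0 0 + c * (X (x + ω) : Mat2) 1 0 = -(R x : Mat2) 0 0 ∧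
    (X x : Mat2) 0 1 - (X (x + ω) : Mat2) 0 1 - 2 * c * (X (x + ω) : Mat2) 0 0
      + c ^ 2 * (X (x + ω) : Mat2) 1 0 = -(R x : Mat2) 0 1

theorem entryEq_iff (X R : (Fin d → ℝ) → SL2Alg) :
    EntryEq ω c X R ↔ ∀ x : Fin d → ℝ,
      -(NormedSpace.exp (-(nilpotentA c : Mat2)) * (X (x + ω) : Mat2)
        * NormedSpace.exp (nilpotentA c : Mat2)) + (X x : Mat2) = -(R x : Mat2) := by
  refine forall_congr' fun x => ?_
  rw [exp_conj_nilpotentA, (X (x + ω)).entry11]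
  constructor
  · rintro ⟨h1, h2, h3⟩
    ext i j
    fin_cases i <;> fin_cases j <;> simp [(X x).entry11, (R x).entry11, (X (x + ω)).entry11] <;>
      linarith
  · intro h
    have h00 := congrFun (congrFun h 0) 0
    have h01 := congrFun (congrFun h 0) 1
    have h10 := congrFun (congrFun h 1) 0
    simp at h00 h01 h10
    refine ⟨?_, ?_, ?_⟩ <;> linarith

/-- Trace-zero matrix functions on the torus `2𝕋^d` with a holomorphic extension. -/
def AnalyticSL (X : (Fin d → ℝ) → SL2Alg) : Prop := IsAnalyticTorus 2 (fun x => (X x : Mat2))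

theorem isHomologicalSolution_iff {P X : (Fin d → ℝ) → SL2Alg} :
    IsHomologicalSolution ω (nilpotentA c) C S P X ↔
      AnalyticSL X ∧ EntryEq ω c X (fun x => P x - C (torusMean 1 P)) ∧
        torusMean 2 X = S (torusMean 1 P) := by
  rw [entryEq_iff]
  rfl

theorem analyticSL_iff {X : (Fin d → ℝ) → SL2Alg} : AnalyticSL X ↔
    TorusPeriodic 2 X ∧ HasStripExtension (fun x => (X x : Mat2) 0 0) ∧
      HasStripExtension (fun x => (X x : Mat2) 0 1) ∧
        HasStripExtension (fun x => (X x : Mat2) 1 0) := by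
  rw [AnalyticSL, isAnalyticTorus_iff]
  constructor
  · rintro ⟨h1, h2⟩
    exact ⟨fun x k => Subtype.ext (h1 x k), h2 0 0, h2 0 1, h2 1 0⟩
  · rintro ⟨h1, h2, h3, h4⟩
    refine ⟨fun x k => congrArg Subtype.val (h1 x k), fun i j => ?_⟩
    fin_cases i <;> fin_cases j
    · exact h2
    · exact h3
    · exact h4
    · convert h2.const_mul (-1) using 2 with x
      rw [neg_one_mul, ← (X x).entry11]
      rfl

theorem torusMean_zero (N : ℕ) : torusMean N (fun _ : Fin d → ℝ => (0 : SL2Alg)) = 0 := by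
  have h : scalarMean N (fun _ : Fin d → ℝ => (0 : ℝ)) = 0 := by
    simpa using scalarMean_const_mul (d := d) N 0 (fun _ => 0)
  apply SL2Alg.ext_entries <;> rw [torusMean_entry] <;> exact h

theorem torusMean_const {N : ℕ} (hN : 0 < N) (y : SL2Alg) :
    torusMean N (fun _ : Fin d → ℝ => y) = y := by
  apply SL2Alg.ext_entries <;> rw [torusMean_entry, scalarMean_const hN]

theorem torusMean_add (N : ℕ) {P Q : (Fin d → ℝ) → SL2Alg}
    (hP : ∀ i j, Continuous fun x => (P x : Mat2) i j)
    (hQ : ∀ i j, Continuous fun x => (Q x : Mat2) i j) :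
    torusMean N (fun x => P x + Q x) = torusMean N P + torusMean N Q := by
  apply SL2Alg.ext_entries <;> rw [torusMean_entry] <;>
    exact scalarMean_add N (hP _ _) (hQ _ _)

theorem torusMean_smul (N : ℕ) (k : ℝ) (P : (Fin d → ℝ) → SL2Alg) :
    torusMean N (fun x => k • P x) = k • torusMean N P := by
  apply SL2Alg.ext_entries <;> rw [torusMean_entry] <;>
    exact scalarMean_const_mul N k _

theorem AnalyticSL.continuous {X : (Fin d → ℝ) → SL2Alg} (hX : AnalyticSL X) (i j : Fin 2) :
    Continuous fun x => (X x : Mat2) i j :=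
  ((isAnalyticTorus_iff.1 hX).2 i j).continuous

theorem isHomologicalSolution_zero :
    IsHomologicalSolution ω (nilpotentA c) C S (fun _ => 0) (fun _ => 0) := by
  rw [isHomologicalSolution_iff, analyticSL_iff]
  refine ⟨⟨fun _ _ => rfl, ?_, ?_, ?_⟩, fun x => ?_, ?_⟩
  · exact HasStripExtension.const 0
  · exact HasStripExtension.const 0
  · exact HasStripExtension.const 0
  · simp [torusMean_zero]
  · rw [torusMean_zero, torusMean_zero, map_zero]

theorem isAnalyticWidth_const {ρ : ℝ} (y : SL2Alg) :
    IsAnalyticWidth 1 ρ (fun _ : Fin d → ℝ => (y : Mat2)) :=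
  ⟨fun _ _ => rfl, ‖CMat2.ofRealM (y : Mat2)‖, fun _ => CMat2.ofRealM (y : Mat2), by fun_prop,
    fun _ => rfl, fun _ _ => le_rfl⟩

section

variable (hρ₀ : 0 < ρ₀) (hA : IsAdmissible ω (nilpotentA c) C S c' ν ρ₀)
include hρ₀ hA

/-- The matrix with the single entry `u - [u]` in the upper right corner is unchanged by conjugation
with the unipotent matrix, so it solves the homogeneous equation with mean zero. Uniqueness forces
it to vanish; no condition on `ω` beyond admissibility is needed. -/
theorem const_of_invariant {u : (Fin d → ℝ) → ℝ} (hu : HasStripExtension u)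
    (hper : TorusPeriodic 2 u) (hinv : ∀ x, u (x + ω) = u x) : ∀ x, u x = u 0 := by
  obtain ⟨X, hX, huniq, -⟩ := hA.2 ρ₀ hρ₀ le_rfl (fun _ => 0) (isAnalyticWidth_const 0)
  set k := scalarMean 2 u with hk
  have hmean : scalarMean 2 (fun x => u x - k) = 0 := by
    have h := scalarMean_add 2 hu.continuous (continuous_const (y := -k))
    rw [scalarMean_const two_pos] at h
    simp only [sub_eq_add_neg]
    rw [h, ← hk, add_neg_cancel]
  have h0 : scalarMean 2 (fun _ : Fin d → ℝ => (0 : ℝ)) = 0 := scalarMean_const two_pos 0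
  have hsol : IsHomologicalSolution ω (nilpotentA c) C S (fun _ => 0)
      (fun x => slMk 0 (u x - k) 0) := by
    rw [isHomologicalSolution_iff, analyticSL_iff]
    refine ⟨⟨fun x m => by simp only [hper x m], ?_, ?_, ?_⟩, fun x => ?_, ?_⟩
    · simp only [slMk_00]; exact HasStripExtension.const 0
    · simp only [slMk_01]; exact hu.sub (HasStripExtension.const k)
    · simp only [slMk_10]; exact HasStripExtension.const 0
    · simp [torusMean_zero, slMk_00, slMk_01, slMk_10, hinv x]
    · rw [torusMean_zero, map_zero]
      apply SL2Alg.ext_entries <;> rw [torusMean_entry] <;>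
        simp only [slMk_00, slMk_01, slMk_10]
      · exact h0
      · exact hmean
      · exact h0
  have heq := (huniq _ hsol).trans (huniq _ isHomologicalSolution_zero).symm
  have h1 : ∀ x, u x = k := fun x => by
    have := congrFun heq x
    have h2 := congrArg (fun Y : SL2Alg => (Y : Mat2) 0 1) this
    simp only [slMk_01] at h2
    exact sub_eq_zero.1 h2
  intro x
  rw [h1 x, h1 0]

/-- Along the orbit of `0` one gets `u 0 - u (n ω) = n k`, while `u` is bounded; hence `k = 0` and
`u` is invariant. -/
theorem const_of_affine {u : (Fin d → ℝ) → ℝ} (hu : HasStripExtension u)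
    (hper : TorusPeriodic 2 u) {k : ℝ} (hinv : ∀ x, u x - u (x + ω) = k) :
    k = 0 ∧ ∀ x, u x = u 0 := by
  obtain ⟨M, hM⟩ := hu.bounded
  have hit : ∀ n : ℕ, u 0 - u ((n : ℝ) • ω) = n * k := by
    intro n
    induction n with
    | zero => simp
    | succ n ih =>
      have := hinv ((n : ℝ) • ω)
      push_cast
      rw [add_smul, one_smul]
      linarith
  have hk : k = 0 := by
    by_contra hne
    obtain ⟨n, hn⟩ := exists_nat_gt (2 * M / |k|)
    rw [div_lt_iff₀ (abs_pos.2 hne)] at hn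
    have h1 := hit n
    have h2 : |(n : ℝ) * k| ≤ 2 * M := by
      rw [← h1]
      have := abs_sub (u 0) (u ((n : ℝ) • ω))
      linarith [hM 0, hM ((n : ℝ) • ω)]
    rw [abs_mul, Nat.abs_cast] at h2
    linarith
  refine ⟨hk, const_of_invariant hρ₀ hA hu hper fun x => ?_⟩
  have := hinv x
  rw [hk] at this
  linarith

/-- The entries form a triangular system. Once the lower left entry is constant the diagonal one
satisfies a scalar equation with constant right-hand side, and then so does the upper right one. -/
theorem const_of_entryEq_const {X : (Fin d → ℝ) → SL2Alg} (hX : AnalyticSL X) {R : SL2Alg}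
    (hE : EntryEq ω c X (fun _ => R)) : ∀ x, X x = X 0 := by
  rw [analyticSL_iff] at hX
  obtain ⟨hper, h00, h01, h10⟩ := hX
  have p : ∀ i j, TorusPeriodic 2 (fun x => (X x : Mat2) i j) := fun i j x k => by
    simp only [hper x k]
  obtain ⟨-, c10⟩ := const_of_affine hρ₀ hA h10 (p 1 0) (fun x => (hE x).1)
  obtain ⟨-, c00⟩ := const_of_affine hρ₀ hA h00 (p 0 0)
    (k := -(R : Mat2) 0 0 - c * (X 0 : Mat2) 1 0) (fun x => by
      have := (hE x).2.1
      rw [c10 (x + ω)] at this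
      linarith)
  obtain ⟨-, c01⟩ := const_of_affine hρ₀ hA h01 (p 0 1)
    (k := -(R : Mat2) 0 1 + 2 * c * (X 0 : Mat2) 0 0 - c ^ 2 * (X 0 : Mat2) 1 0) (fun x => by
      have := (hE x).2.2
      rw [c10 (x + ω), c00 (x + ω)] at this
      linarith)
  exact fun x => SL2Alg.ext_entries (c00 x) (c01 x) (c10 x)

end

open Classical in
/-- The solution of the homological equation. -/
noncomputable def homSol (ω : Fin d → ℝ) (c : ℝ) (C S : SL2Alg →ₗ[ℝ] SL2Alg)
    (P : (Fin d → ℝ) → SL2Alg) : (Fin d → ℝ) → SL2Alg :=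
  if h : ∃ X, IsHomologicalSolution ω (nilpotentA c) C S P X then h.choose else 0

variable {ρ : ℝ}

section

variable (hA : IsAdmissible ω (nilpotentA c) C S c' ν ρ₀) (hρ : 0 < ρ) (hρρ : ρ ≤ ρ₀)
include hA hρ hρρ

theorem homSol_spec {P : (Fin d → ℝ) → SL2Alg} (hP : IsAnalyticWidth 1 ρ (fun x => (P x : Mat2))) :
    IsHomologicalSolution ω (nilpotentA c) C S P (homSol ω c C S P) := by
  obtain ⟨X, hX, -⟩ := hA.2 ρ hρ hρρ P hP
  have h : ∃ X, IsHomologicalSolution ω (nilpotentA c) C S P X := ⟨X, hX⟩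
  rw [homSol, dif_pos h]
  exact h.choose_spec

theorem homSol_unique {P : (Fin d → ℝ) → SL2Alg}
    (hP : IsAnalyticWidth 1 ρ (fun x => (P x : Mat2))) {Y : (Fin d → ℝ) → SL2Alg}
    (hY : IsHomologicalSolution ω (nilpotentA c) C S P Y) : homSol ω c C S P = Y := by
  obtain ⟨X, hX, huniq, -⟩ := hA.2 ρ hρ hρρ P hP
  rw [huniq _ (homSol_spec hA hρ hρρ hP), huniq _ hY]

theorem homSol_bound {P : (Fin d → ℝ) → SL2Alg} {M r : ℝ}
    (hper : TorusPeriodic 1 P) (hP : StripNormLE ρ (fun x => (P x : Mat2)) M)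
    (hr : 0 < r) (hrρ : r < ρ) :
    StripNormLE (ρ - r) (fun x => (homSol ω c C S P x : Mat2)) (c' * M / r ^ ν) := by
  have hP' : IsAnalyticWidth 1 ρ (fun x => (P x : Mat2)) :=
    ⟨fun x k => congrArg Subtype.val (hper x k), M, hP⟩
  obtain ⟨X, hX, huniq, hb⟩ := hA.2 ρ hρ hρρ P hP'
  rw [huniq _ (homSol_spec hA hρ hρρ hP')]
  exact hb M hP r hr hrρ

theorem homSol_add {P Q : (Fin d → ℝ) → SL2Alg}
    (hP : IsAnalyticWidth 1 ρ (fun x => (P x : Mat2)))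
    (hQ : IsAnalyticWidth 1 ρ (fun x => (Q x : Mat2)))
    (hPQ : IsAnalyticWidth 1 ρ (fun x => ((P x + Q x : SL2Alg) : Mat2))) :
    homSol ω c C S (fun x => P x + Q x)
      = fun x => homSol ω c C S P x + homSol ω c C S Q x := by
  refine homSol_unique hA hρ hρρ hPQ ?_
  have hX := homSol_spec hA hρ hρρ hP
  have hY := homSol_spec hA hρ hρρ hQ
  obtain ⟨-, MP, hMP⟩ := hP
  obtain ⟨-, MQ, hMQ⟩ := hQ
  have hm := torusMean_add 1 (fun i j => (hMP.entry hρ i j).continuous)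
    (fun i j => (hMQ.entry hρ i j).continuous)
  rw [isHomologicalSolution_iff] at hX hY ⊢
  obtain ⟨aX, eX, mX⟩ := hX
  obtain ⟨aY, eY, mY⟩ := hY
  refine ⟨?_, ?_, ?_⟩
  · rw [analyticSL_iff] at aX aY ⊢
    exact ⟨fun x k => by simp only [aX.1 x k, aY.1 x k], aX.2.1.add aY.2.1,
      aX.2.2.1.add aY.2.2.1, aX.2.2.2.add aY.2.2.2⟩
  · intro x
    have h1 := eX x
    have h2 := eY x
    rw [hm]
    simp only [map_add, SL2Alg.add_entry, SL2Alg.sub_entry] at h1 h2 ⊢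
    refine ⟨?_, ?_, ?_⟩ <;> linarith [h1.1, h1.2.1, h1.2.2, h2.1, h2.2.1, h2.2.2]
  · rw [torusMean_add 2 aX.continuous aY.continuous, mX, mY, hm, map_add]

theorem homSol_smul {P : (Fin d → ℝ) → SL2Alg} (k : ℝ)
    (hP : IsAnalyticWidth 1 ρ (fun x => (P x : Mat2)))
    (hkP : IsAnalyticWidth 1 ρ (fun x => ((k • P x : SL2Alg) : Mat2))) :
    homSol ω c C S (fun x => k • P x) = fun x => k • homSol ω c C S P x := by
  refine homSol_unique hA hρ hρρ hkP ?_
  have hX := homSol_spec hA hρ hρρ hP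
  rw [isHomologicalSolution_iff] at hX ⊢
  obtain ⟨aX, eX, mX⟩ := hX
  refine ⟨?_, ?_, ?_⟩
  · rw [analyticSL_iff] at aX ⊢
    exact ⟨fun x m => by simp only [aX.1 x m], aX.2.1.const_mul k,
      aX.2.2.1.const_mul k, aX.2.2.2.const_mul k⟩
  · intro x
    obtain ⟨h1, h2, h3⟩ := eX x
    rw [torusMean_smul]
    simp only [map_smul, SL2Alg.smul_entry, SL2Alg.sub_entry] at h1 h2 h3 ⊢
    refine ⟨?_, ?_, ?_⟩
    · linear_combination k * h1
    · linear_combination k * h2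
    · linear_combination k * h3
  · rw [torusMean_smul, mX, torusMean_smul, map_smul]

/-- Admissibility only provides a solution on the double torus. The difference of `X` and its
integer translate solves the homogeneous equation, hence is a constant; translating twice is a
period of `X`, so twice that constant is zero. -/
theorem homSol_periodic {P : (Fin d → ℝ) → SL2Alg}
    (hP : IsAnalyticWidth 1 ρ (fun x => (P x : Mat2))) : TorusPeriodic 1 (homSol ω c C S P) := by
  have hper : TorusPeriodic 1 P := fun x k => Subtype.ext (hP.1 x k)
  have hX := homSol_spec hA hρ hρρ hP
  rw [isHomologicalSolution_iff] at hX
  obtain ⟨aX, eX, -⟩ := hX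
  set X := homSol ω c C S P
  intro x k
  set w : Fin d → ℝ := fun i => ((1 : ℕ) : ℝ) * (k i : ℝ) with hw
  have haD : AnalyticSL (fun x => X (x + w) - X x) := by
    rw [analyticSL_iff] at aX ⊢
    refine ⟨fun x m => ?_, (aX.2.1.shift w).sub aX.2.1,
      (aX.2.2.1.shift w).sub aX.2.2.1, (aX.2.2.2.shift w).sub aX.2.2.2⟩
    simp only [add_right_comm x _ w, aX.1 _ m]
  have heD : EntryEq ω c (fun x => X (x + w) - X x) (fun _ => 0) := by
    intro x
    obtain ⟨h1, h2, h3⟩ := eX x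
    obtain ⟨g1, g2, g3⟩ := eX (x + w)
    have hPw : P (x + w) = P x := hper x k
    simp only [SL2Alg.sub_entry, SL2Alg.zero_entry, hPw, add_right_comm x w ω]
      at h1 h2 h3 g1 g2 g3 ⊢
    refine ⟨?_, ?_, ?_⟩ <;> linarith
  have hc := const_of_entryEq_const (hρ.trans_le hρρ) hA haD heD
  have h2 := aX
  rw [analyticSL_iff] at h2
  have h3 := h2.1 x k
  have e : (x + fun i => ((2 : ℕ) : ℝ) * (k i : ℝ)) = x + w + w := by
    ext i; simp [hw]; ring
  rw [e] at h3
  have h4 : X (x + w) - X x = X (0 + w) - X 0 := hc x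
  have h5 : X (x + w + w) - X (x + w) = X (0 + w) - X 0 := hc (x + w)
  rw [h3] at h5
  have h6 : X (x + w) - X x = X x - X (x + w) := h4.trans h5.symm
  have h7 : (2 : ℝ) • (X (x + w) - X x) = 0 := by
    rw [two_smul]
    nth_rw 1 [h6]
    abel
  exact sub_eq_zero.1 ((smul_eq_zero.1 h7).resolve_left two_ne_zero)

end

section

variable (hρ₀ : 0 < ρ₀) (hA : IsAdmissible ω (nilpotentA c) C S c' ν ρ₀)
include hρ₀ hA

theorem homSol_const (y : SL2Alg) : homSol ω c C S (fun _ => y) = fun _ => S y := by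
  have hX := homSol_spec hA hρ₀ le_rfl (isAnalyticWidth_const y)
  rw [isHomologicalSolution_iff, torusMean_const one_pos] at hX
  obtain ⟨aX, eX, mX⟩ := hX
  have hc := const_of_entryEq_const hρ₀ hA aX eX
  have h1 : homSol ω c C S (fun _ => y) = fun _ => homSol ω c C S (fun _ => y) 0 := funext hc
  rw [h1, torusMean_const two_pos] at mX
  rw [h1, mX]

theorem entryEq_const (y : SL2Alg) : EntryEq ω c (fun _ => S y) (fun _ => y - C y) := by
  have hX := homSol_spec hA hρ₀ le_rfl (isAnalyticWidth_const y)
  rw [isHomologicalSolution_iff, torusMean_const one_pos, homSol_const hρ₀ hA] at hX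
  exact hX.2.1

/-- For a constant right-hand side `y` the solution is the constant `S y`, so the admissibility
estimate with `r = ρ₀ / 2` bounds `S`. -/
theorem norm_S_le (y : SL2Alg) :
    ‖CMat2.ofRealM (S y : Mat2)‖ ≤ c' * ‖CMat2.ofRealM (y : Mat2)‖ / (ρ₀ / 2) ^ ν := by
  have h : StripNormLE ρ₀ (fun _ : Fin d → ℝ => (y : Mat2)) ‖CMat2.ofRealM (y : Mat2)‖ :=
    ⟨fun _ => CMat2.ofRealM (y : Mat2), by fun_prop, fun _ => rfl, fun _ _ => le_rfl⟩
  obtain ⟨F, -, hF, hFM⟩ := homSol_bound hA hρ₀ le_rfl (P := fun _ => y) (fun _ _ => rfl) h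
    (half_pos hρ₀) (half_lt_self hρ₀)
  have h1 := hFM _ (toC_mem_strip (by linarith) 0)
  rw [hF, homSol_const hρ₀ hA] at h1
  exact h1

/-- With a vanishing right-hand side in an entry, and nothing fed in from the entries below it in
the triangular system, that entry of the solution is invariant, hence constant, and its mean is
zero. -/
theorem homSol_triangular {P : (Fin d → ℝ) → SL2Alg} (hρ : 0 < ρ) (hρρ : ρ ≤ ρ₀)
    (hP : IsAnalyticWidth 1 ρ (fun x => (P x : Mat2))) (hmean : torusMean 1 P = 0)
    (h10 : ∀ x, (P x : Mat2) 1 0 = 0) :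
    (∀ x, (homSol ω c C S P x : Mat2) 1 0 = 0) ∧
      ((∀ x, (P x : Mat2) 0 0 = 0) → ∀ x, (homSol ω c C S P x : Mat2) 0 0 = 0) := by
  have hX := homSol_spec hA hρ hρρ hP
  rw [isHomologicalSolution_iff, hmean, map_zero, map_zero] at hX
  obtain ⟨aX, eX, mX⟩ := hX
  rw [analyticSL_iff] at aX
  set X := homSol ω c C S P
  have p : ∀ i j, TorusPeriodic 2 (fun x => (X x : Mat2) i j) := fun i j x k => by
    simp only [aX.1 x k]
  have key : ∀ i j, HasStripExtension (fun x => (X x : Mat2) i j) →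
      (∀ x, (X x : Mat2) i j - (X (x + ω) : Mat2) i j = 0) → ∀ x, (X x : Mat2) i j = 0 := by
    intro i j hs he
    obtain ⟨-, hc⟩ := const_of_affine hρ₀ hA hs (p i j) he
    have hm := congrArg (fun Y : SL2Alg => (Y : Mat2) i j) mX
    simp only [torusMean_entry] at hm
    rw [funext hc, scalarMean_const two_pos] at hm
    intro x
    rw [hc x]
    exact hm
  have g0 : ∀ x, (X x : Mat2) 1 0 = 0 := key 1 0 aX.2.2.2 fun x => by
    have := (eX x).1
    simpa [h10 x] using this
  refine ⟨g0, fun h00 => key 0 0 aX.2.1 fun x => ?_⟩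
  have := (eX x).2.1
  rw [g0 (x + ω)] at this
  simpa [h00 x] using this

end

end Homological

/-! ### Bounded linear operators on real analytic `sl(2,ℝ)`-valued functions. -/

section RealOperators

variable {d : ℕ} {ρ σ τ M M' K K' : ℝ}

/-- `P ∈ C^ω_ρ(𝕋^d, sl(2,ℝ))`. -/
def AnW (ρ : ℝ) (P : (Fin d → ℝ) → SL2Alg) : Prop := IsAnalyticWidth 1 ρ (fun x => (P x : Mat2))

theorem StripNormLE.add {f g : (Fin d → ℝ) → Mat2} (hf : StripNormLE ρ f M)
    (hg : StripNormLE ρ g M') : StripNormLE ρ (fun x => f x + g x) (M + M') := by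
  obtain ⟨F, hF, hFf, hFM⟩ := hf
  obtain ⟨G, hG, hGg, hGM⟩ := hg
  refine ⟨fun z => F z + G z, hF.add hG, fun x => ?_, fun z hz =>
    (norm_add_le _ _).trans (add_le_add (hFM z hz) (hGM z hz))⟩
  simp only [hFf, hGg]
  exact (map_add CMat2.ofRealM _ _).symm

theorem StripNormLE.smul {f : (Fin d → ℝ) → Mat2} (hf : StripNormLE ρ f M) (k : ℝ) :
    StripNormLE ρ (fun x => k • f x) (|k| * M) := by
  obtain ⟨F, hF, hFf, hFM⟩ := hf
  refine ⟨fun z => (k : ℂ) • F z, hF.const_smul (k : ℂ), fun x => ?_, fun z hz => ?_⟩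
  · simp only [hFf]
    exact (CMat2.ofRealM_smul k _).symm
  · rw [norm_smul, Complex.norm_real, Real.norm_eq_abs]
    gcongr
    exact hFM z hz

theorem AnW.add {P Q : (Fin d → ℝ) → SL2Alg} (hP : AnW ρ P) (hQ : AnW ρ Q) :
    AnW ρ (fun x => P x + Q x) := by
  obtain ⟨p1, M, p2⟩ := hP
  obtain ⟨q1, M', q2⟩ := hQ
  exact ⟨fun x k => congrArg₂ (· + ·) (p1 x k) (q1 x k), M + M', p2.add q2⟩

theorem AnW.smul {P : (Fin d → ℝ) → SL2Alg} (hP : AnW ρ P) (k : ℝ) :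
    AnW ρ (fun x => k • P x) := by
  obtain ⟨p1, M, p2⟩ := hP
  exact ⟨fun x m => congrArg (k • ·) (p1 x m), |k| * M, p2.smul k⟩

theorem AnW.per {P : (Fin d → ℝ) → SL2Alg} (hP : AnW ρ P) : TorusPeriodic 1 P :=
  fun x k => Subtype.ext (hP.1 x k)

theorem AnW.continuous (hρ : 0 < ρ) {P : (Fin d → ℝ) → SL2Alg} (hP : AnW ρ P) (i j : Fin 2) :
    Continuous fun x => (P x : Mat2) i j := by
  obtain ⟨-, M, p2⟩ := hP
  exact (p2.entry hρ i j).continuous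

/-- Bounded linear operators between the spaces `C^ω_ρ(𝕋^d, sl(2,ℝ))`. -/
structure RealOp (ρ σ K : ℝ) (T : ((Fin d → ℝ) → SL2Alg) → (Fin d → ℝ) → SL2Alg) : Prop where
  add : ∀ {P Q}, AnW ρ P → AnW ρ Q → T (fun x => P x + Q x) = fun x => T P x + T Q x
  smul : ∀ {P}, AnW ρ P → ∀ k : ℝ, T (fun x => k • P x) = fun x => k • T P x
  per : ∀ {P}, AnW ρ P → TorusPeriodic 1 (T P)
  bound : ∀ {P : (Fin d → ℝ) → SL2Alg} {M}, TorusPeriodic 1 P → StripNormLE ρ (fun x => (P x : Mat2)) M →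
    StripNormLE σ (fun x => (T P x : Mat2)) (K * M)

variable {T T' : ((Fin d → ℝ) → SL2Alg) → (Fin d → ℝ) → SL2Alg}

theorem RealOp.anW (hT : RealOp ρ σ K T) {P : (Fin d → ℝ) → SL2Alg} (hP : AnW ρ P) :
    AnW σ (T P) := by
  have h := hP
  obtain ⟨-, M, p2⟩ := h
  exact ⟨fun x k => congrArg Subtype.val (hT.per hP x k), K * M, hT.bound hP.per p2⟩

theorem RealOp.comp (hT : RealOp ρ σ K T) (hT' : RealOp σ τ K' T') :
    RealOp ρ τ (K' * K) (fun P => T' (T P)) where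
  add := fun hP hQ => by rw [hT.add hP hQ, hT'.add (hT.anW hP) (hT.anW hQ)]
  smul := fun hP k => by rw [hT.smul hP k, hT'.smul (hT.anW hP)]
  per := fun hP => hT'.per (hT.anW hP)
  bound := fun {P M} hP hM => by
    rw [mul_assoc]
    exact hT'.bound (hT.per ⟨fun x k => congrArg Subtype.val (hP x k), M, hM⟩) (hT.bound hP hM)

theorem RealOp.sum (hT : RealOp ρ σ K T) (hT' : RealOp ρ σ K' T') :
    RealOp ρ σ (K + K') (fun P x => T P x + T' P x) where
  add := fun hP hQ => by
    rw [hT.add hP hQ, hT'.add hP hQ]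
    funext x
    exact add_add_add_comm _ _ _ _
  smul := fun hP k => by rw [hT.smul hP k, hT'.smul hP k]; simp only [smul_add]
  per := fun hP x k => congrArg₂ (· + ·) (hT.per hP x k) (hT'.per hP x k)
  bound := fun hP hM => by
    rw [add_mul]
    exact (hT.bound hP hM).add (hT'.bound hP hM)

theorem SL2Alg.eq_combination (X : SL2Alg) : X = (X : Mat2) 0 0 • slMk 1 0 0
    + (X : Mat2) 0 1 • slMk 0 1 0 + (X : Mat2) 1 0 • slMk 0 0 1 := by
  apply SL2Alg.ext_entries <;>
    simp [SL2Alg.add_entry, SL2Alg.smul_entry, slMk_00, slMk_01, slMk_10]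

theorem norm_ofRealM_slMk_le {a b g B : ℝ} (ha : |a| ≤ B) (hb : |b| ≤ B) (hg : |g| ≤ B) :
    ‖CMat2.ofRealM (slMk a b g : Mat2)‖ ≤ 4 * B := by
  refine CMat2.norm_le_of_entry_le fun i j => ?_
  have h : ∀ x : ℝ, ‖(x : ℂ)‖ = |x| := fun x => by rw [Complex.norm_real, Real.norm_eq_abs]
  rw [CMat2.ofRealM_apply, Matrix.map_apply, h]
  fin_cases i <;> fin_cases j
  · exact (congrArg abs (slMk_00 a b g)).trans_le ha
  · exact hb
  · exact hg
  · refine (congrArg abs ((slMk a b g).entry11.trans (congrArg Neg.neg (slMk_00 a b g)))).trans_le ?_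
    rwa [abs_neg]

theorem abs_entry_le (X : SL2Alg) (i j : Fin 2) :
    |(X : Mat2) i j| ≤ ‖CMat2.ofRealM (X : Mat2)‖ := by
  have := CMat2.norm_entry_le (CMat2.ofRealM (X : Mat2)) i j
  rwa [CMat2.ofRealM_apply, Matrix.map_apply, Complex.norm_real, Real.norm_eq_abs] at this

theorem RealOp.pointwise (L : SL2Alg →ₗ[ℝ] SL2Alg) {B : ℝ} (hB0 : 0 ≤ B)
    (hB : ∀ y : SL2Alg, ‖CMat2.ofRealM (L y : Mat2)‖ ≤ B * ‖CMat2.ofRealM (y : Mat2)‖) :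
    RealOp (d := d) ρ ρ (12 * B) (fun P x => L (P x)) where
  add := fun _ _ => by simp only [map_add]
  smul := fun _ k => by simp only [map_smul]
  per := fun hP x k => congrArg L (hP.per x k)
  bound := by
    rintro P M - ⟨F, hF, hFf, hFM⟩
    set l : SL2Alg → CMat2 := fun y => CMat2.ofRealM (L y : Mat2) with hl
    have hl4 : ∀ y : SL2Alg, ‖CMat2.ofRealM (y : Mat2)‖ ≤ 4 * 1 → ‖l y‖ ≤ 4 * B := fun y hy =>
      (hB y).trans (by nlinarith)
    have h1 := hl4 _ (norm_ofRealM_slMk_le (a := 1) (b := 0) (g := 0) (by simp) (by simp) (by simp))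
    have h2 := hl4 _ (norm_ofRealM_slMk_le (a := 0) (b := 1) (g := 0) (by simp) (by simp) (by simp))
    have h3 := hl4 _ (norm_ofRealM_slMk_le (a := 0) (b := 0) (g := 1) (by simp) (by simp) (by simp))
    -- The factor 12 is three basis elements, each of norm at most 4 by the crude bound through
    -- entries.
    refine ⟨fun z => F z 0 0 • l (slMk 1 0 0) + F z 0 1 • l (slMk 0 1 0) + F z 1 0 • l (slMk 0 0 1),
      (((hF.entry 0 0).smul_const _).add ((hF.entry 0 1).smul_const _)).add
        ((hF.entry 1 0).smul_const _), fun x => ?_, fun z hz => ?_⟩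
    · have := congrArg l (SL2Alg.eq_combination (P x))
      have e : ∀ (k : ℝ) (y : SL2Alg), l (k • y) = (k : ℂ) • l y := fun k y => by
        simp only [hl, map_smul]
        exact CMat2.ofRealM_smul k _
      have e' : ∀ (y y' : SL2Alg), l (y + y') = l y + l y' := fun y y' => by
        simp only [hl, map_add]
        exact map_add CMat2.ofRealM _ _
      rw [e', e', e, e, e] at this
      simp only [hFf]
      exact this.symm
    · have n0 := hFM z hz
      have n1 : ∀ i j, ‖F z i j‖ ≤ M := fun i j => (CMat2.norm_entry_le _ i j).trans n0
      have hM : 0 ≤ M := (norm_nonneg _).trans n0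
      have key : ∀ i j y, ‖l y‖ ≤ 4 * B → ‖F z i j • l y‖ ≤ M * (4 * B) := fun i j y hy => by
        rw [norm_smul]
        exact mul_le_mul (n1 i j) hy (norm_nonneg _) hM
      refine (norm_add₃_le).trans ?_
      linarith [key 0 0 _ h1, key 0 1 _ h2, key 1 0 _ h3]

/-- `(x₀₀ x₀₁; x₁₀ -x₀₀) ↦ (α x₀₀ + δ x₁₀, β x₀₁; γ x₁₀, ·)`. -/
noncomputable def triLin (α β γ δ : ℝ) : SL2Alg →ₗ[ℝ] SL2Alg where
  toFun X := slMk (α * (X : Mat2) 0 0 + δ * (X : Mat2) 1 0) (β * (X : Mat2) 0 1)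
    (γ * (X : Mat2) 1 0)
  map_add' X Y := by
    apply SL2Alg.ext_entries <;>
      simp only [SL2Alg.add_entry, slMk_00, slMk_01, slMk_10] <;> ring
  map_smul' k X := by
    apply SL2Alg.ext_entries <;>
      simp only [SL2Alg.smul_entry, slMk_00, slMk_01, slMk_10, RingHom.id_apply] <;> ring

variable {α β γ δ : ℝ}

theorem triLin_00 (X : SL2Alg) : (triLin α β γ δ X : Mat2) 0 0
    = α * (X : Mat2) 0 0 + δ * (X : Mat2) 1 0 := slMk_00 _ _ _

theorem triLin_01 (X : SL2Alg) : (triLin α β γ δ X : Mat2) 0 1 = β * (X : Mat2) 0 1 := rfl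

theorem triLin_10 (X : SL2Alg) : (triLin α β γ δ X : Mat2) 1 0 = γ * (X : Mat2) 1 0 := rfl

theorem norm_triLin_le {m : ℝ} (hα : |α| ≤ m) (hβ : |β| ≤ m) (hγ : |γ| ≤ m) (hδ : |δ| ≤ m)
    (y : SL2Alg) : ‖CMat2.ofRealM (triLin α β γ δ y : Mat2)‖
      ≤ 8 * m * ‖CMat2.ofRealM (y : Mat2)‖ := by
  set N := ‖CMat2.ofRealM (y : Mat2)‖ with hN
  have hN0 : 0 ≤ N := norm_nonneg _
  have hm0 : 0 ≤ m := (abs_nonneg _).trans hα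
  have key : ∀ (k : ℝ) (i j : Fin 2), |k| ≤ m → |k * (y : Mat2) i j| ≤ m * N := fun k i j hk => by
    rw [abs_mul]
    exact mul_le_mul hk (abs_entry_le y i j) (abs_nonneg _) hm0
  have hmN : 0 ≤ m * N := mul_nonneg hm0 hN0
  have := norm_ofRealM_slMk_le (B := 2 * (m * N))
    (a := α * (y : Mat2) 0 0 + δ * (y : Mat2) 1 0) (b := β * (y : Mat2) 0 1)
    (g := γ * (y : Mat2) 1 0)
    ((abs_add_le _ _).trans (by linarith [key α 0 0 hα, key δ 1 0 hδ]))
    (by linarith [key β 0 1 hβ]) (by linarith [key γ 1 0 hγ])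
  refine this.trans (le_of_eq (by ring))

theorem realOp_mean (hρ : 0 < ρ) :
    RealOp (d := d) ρ σ 4 (fun P _ => torusMean 1 P) where
  add := fun hP hQ => by rw [torusMean_add 1 (hP.continuous hρ) (hQ.continuous hρ)]
  smul := fun _ k => by rw [torusMean_smul]
  per := fun _ _ _ => rfl
  bound := by
    rintro P M - ⟨F, hF, hFf, hFM⟩
    refine ⟨fun _ => CMat2.ofRealM (torusMean 1 P : Mat2), by fun_prop, fun _ => rfl, fun _ _ => ?_⟩
    refine CMat2.norm_le_of_entry_le fun i j => ?_
    change ‖(((torusMean 1 P : Mat2) i j : ℝ) : ℂ)‖ ≤ M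
    rw [Complex.norm_real, Real.norm_eq_abs, torusMean_entry]
    refine abs_scalarMean_le one_pos fun x => ?_
    refine (abs_entry_le (P x) i j).trans ?_
    have := hFM _ (toC_mem_strip hρ x)
    rwa [hFf] at this

end RealOperators

/-! ### Complexification of real operators. -/

section Complexification

variable {d : ℕ} {ρ σ K M : ℝ}

open Classical in
/-- The holomorphic extension of a real function to a strip, by zero outside the strip. -/
noncomputable def hext (σ : ℝ) (X : (Fin d → ℝ) → SL2Alg) (z : Fin d → ℂ) : CMat2 :=
  if h : z ∈ strip d σ ∧ ∃ F : (Fin d → ℂ) → CMat2, DifferentiableOn ℂ F (strip d σ) ∧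
    ∀ x, F (toC x) = CMat2.ofRealM (X x : Mat2) then h.2.choose z else 0

theorem hext_eq (hσ : 0 < σ) {X : (Fin d → ℝ) → SL2Alg} {F : (Fin d → ℂ) → CMat2}
    (hF : DifferentiableOn ℂ F (strip d σ)) (hX : ∀ x, F (toC x) = CMat2.ofRealM (X x : Mat2))
    {z : Fin d → ℂ} (hz : z ∈ strip d σ) : hext σ X z = F z := by
  have h : ∃ F : (Fin d → ℂ) → CMat2, DifferentiableOn ℂ F (strip d σ) ∧
    ∀ x, F (toC x) = CMat2.ofRealM (X x : Mat2) := ⟨F, hF, hX⟩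
  rw [hext, dif_pos ⟨hz, h⟩]
  exact eqOn_strip_of_eq_real hσ h.choose_spec.1 hF
    (fun x => (h.choose_spec.2 x).trans (hX x).symm) hz

theorem hext_of_notMem {X : (Fin d → ℝ) → SL2Alg} {z : Fin d → ℂ} (hz : z ∉ strip d σ) :
    hext σ X z = 0 := by
  rw [hext, dif_neg fun h => hz h.1]

theorem hext_spec (hσ : 0 < σ) {X : (Fin d → ℝ) → SL2Alg}
    (hX : StripNormLE σ (fun x => (X x : Mat2)) M) :
    DifferentiableOn ℂ (hext σ X) (strip d σ) ∧
      (∀ x, hext σ X (toC x) = CMat2.ofRealM (X x : Mat2)) ∧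
        ∀ z ∈ strip d σ, ‖hext σ X z‖ ≤ M := by
  obtain ⟨F, hF, hFX, hFM⟩ := hX
  have h : ∀ z ∈ strip d σ, hext σ X z = F z := fun z hz => hext_eq hσ hF hFX hz
  exact ⟨hF.congr h, fun x => (h _ (toC_mem_strip hσ x)).trans (hFX x),
    fun z hz => (h z hz).symm ▸ hFM z hz⟩

/-- The trace-zero real part of a function on the strip, restricted to real points. -/
noncomputable def reP (g : (Fin d → ℂ) → CMat2) (x : Fin d → ℝ) : SL2Alg :=
  toSL ((g (toC x)).map Complex.re)

/-- The trace-zero imaginary part of a function on the strip, restricted to real points. -/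
noncomputable def imP (g : (Fin d → ℂ) → CMat2) (x : Fin d → ℝ) : SL2Alg :=
  toSL ((g (toC x)).map Complex.im)

theorem imP_eq (g : (Fin d → ℂ) → CMat2) : imP g = reP (fun z => (-Complex.I) • g z) := by
  funext x
  simp only [imP, reP]
  congr 1
  ext i j
  simp

theorem toC_add_int (x : Fin d → ℝ) (k : Fin d → ℤ) :
    toC (x + fun i => ((1 : ℕ) : ℝ) * (k i : ℝ)) = toC x + fun i => (k i : ℂ) := by
  ext i; simp [toC]

/-- The reflected function, the conjugate of `g` at the conjugate point, is again holomorphic. The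
average of the two extends the real part from real points to the strip; the imaginary part is
treated as the real part of `-I • g`. -/
theorem BH.reP (hρ : 0 < ρ) {g : (Fin d → ℂ) → CMat2} (hg : BH ρ M g) :
    TorusPeriodic 1 (reP g) ∧ StripNormLE ρ (fun x => (reP g x : Mat2)) (4 * M) := by
  refine ⟨fun x k => ?_, ?_⟩
  · rw [_root_.reP, _root_.reP, toC_add_int, hg.per _ (toC_mem_strip hρ x)]
  · set G : Fin 2 → Fin 2 → (Fin d → ℂ) → ℂ := fun i j z =>
      (g z i j + star (g (star z) i j)) / 2 with hG
    have hGd : ∀ i j, DifferentiableOn ℂ (G i j) (strip d ρ) := by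
      intro i j z hz
      have h1 := (hg.diff.entry i j).differentiableAt ((isOpen_strip d ρ).mem_nhds hz)
      have h2 := (hg.diff.entry i j).differentiableAt
        ((isOpen_strip d ρ).mem_nhds (star_mem_strip hz))
      have h3 := h2.star_star
      rw [star_star] at h3
      have h4 : DifferentiableAt ℂ (fun z => g z i j + star (g (star z) i j)) z := h1.add h3
      simp only [hG, div_eq_mul_inv]
      exact (h4.mul_const _).differentiableWithinAt
    have hGM : ∀ i j, ∀ z ∈ strip d ρ, ‖G i j z‖ ≤ M := by
      intro i j z hz
      have h1 := (CMat2.norm_entry_le _ i j).trans (hg.bound z hz)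
      have h2 := (CMat2.norm_entry_le _ i j).trans (hg.bound _ (star_mem_strip hz))
      rw [← norm_star] at h2
      rw [hG]
      simp only
      rw [norm_div, Complex.norm_two]
      linarith [norm_add_le (g z i j) (star (g (star z) i j))]
    have hGr : ∀ i j x, G i j (toC x) = ((g (toC x) i j).re : ℂ) := by
      intro i j x
      have : star (toC x) = toC x := by ext k; simp [toC]
      simp only [hG, this]
      rw [← starRingEnd_apply, Complex.add_conj]
      simp
    have hGs : ∀ i j, DifferentiableOn ℂ (fun z => (G i i z - G j j z) / 2) (strip d ρ) :=
      fun i j => by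
        have h : DifferentiableOn ℂ (fun z => G i i z - G j j z) (strip d ρ) := (hGd i i).sub (hGd j j)
        simp only [div_eq_mul_inv]
        exact h.mul_const _
    refine ⟨fun z => !![(G 0 0 z - G 1 1 z) / 2, G 0 1 z; G 1 0 z, (G 1 1 z - G 0 0 z) / 2],
      differentiableOn_of_entries fun i j => ?_, fun x => ?_, fun z hz =>
        CMat2.norm_le_of_entry_le fun i j => ?_⟩
    · fin_cases i <;> fin_cases j
      · exact hGs 0 1
      · exact hGd 0 1
      · exact hGd 1 0
      · exact hGs 1 0
    · have e : ∀ a b : ℝ, ((a : ℂ) - (b : ℂ)) / 2 = (((a - b) / 2 : ℝ) : ℂ) := fun a b => by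
        push_cast; ring
      ext i j
      fin_cases i <;> fin_cases j
      · exact (congrArg₂ (fun a b : ℂ => (a - b) / 2) (hGr 0 0 x) (hGr 1 1 x)).trans (e _ _)
      · exact hGr 0 1 x
      · exact hGr 1 0 x
      · exact (congrArg₂ (fun a b : ℂ => (a - b) / 2) (hGr 1 1 x) (hGr 0 0 x)).trans (e _ _)
    · have key : ∀ a b : ℂ, ‖a‖ ≤ M → ‖b‖ ≤ M → ‖(a - b) / 2‖ ≤ M := fun a b ha hb => by
        rw [norm_div, Complex.norm_two]
        linarith [norm_sub_le a b]
      fin_cases i <;> fin_cases j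
      · exact key _ _ (hGM 0 0 z hz) (hGM 1 1 z hz)
      · exact hGM 0 1 z hz
      · exact hGM 1 0 z hz
      · exact key _ _ (hGM 1 1 z hz) (hGM 0 0 z hz)

theorem BH.imP (hρ : 0 < ρ) {g : (Fin d → ℂ) → CMat2} (hg : BH ρ M g) :
    TorusPeriodic 1 (imP g) ∧ StripNormLE ρ (fun x => (imP g x : Mat2)) (4 * M) := by
  rw [imP_eq]
  have h := BH.reP hρ (hg.smul (-Complex.I))
  rwa [norm_neg, Complex.norm_I, one_mul] at h

theorem BH.anW_reP (hρ : 0 < ρ) {g : (Fin d → ℂ) → CMat2} (hg : BH ρ M g) : AnW ρ (_root_.reP g) :=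
  ⟨fun x k => congrArg Subtype.val ((hg.reP hρ).1 x k), _, (hg.reP hρ).2⟩

theorem BH.anW_imP (hρ : 0 < ρ) {g : (Fin d → ℂ) → CMat2} (hg : BH ρ M g) : AnW ρ (_root_.imP g) :=
  ⟨fun x k => congrArg Subtype.val ((hg.imP hρ).1 x k), _, (hg.imP hρ).2⟩

theorem reP_add (g g' : (Fin d → ℂ) → CMat2) :
    reP (fun z => g z + g' z) = fun x => reP g x + reP g' x := by
  funext x
  simp only [reP, ← map_add]
  congr 1

theorem imP_add (g g' : (Fin d → ℂ) → CMat2) :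
    imP (fun z => g z + g' z) = fun x => imP g x + imP g' x := by
  funext x
  simp only [imP, ← map_add]
  congr 1

theorem reP_smul (a : ℂ) (g : (Fin d → ℂ) → CMat2) :
    reP (fun z => a • g z) = fun x => a.re • reP g x + (-a.im) • imP g x := by
  funext x
  simp only [reP, imP, ← map_smul, ← map_add]
  congr 1
  ext i j
  simp [sub_eq_add_neg]

theorem imP_smul (a : ℂ) (g : (Fin d → ℂ) → CMat2) :
    imP (fun z => a • g z) = fun x => a.im • reP g x + a.re • imP g x := by
  funext x
  simp only [reP, imP, ← map_smul, ← map_add]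
  congr 1
  ext i j
  simp [add_comm]

theorem imP_eq_zero_of_real {g : (Fin d → ℂ) → CMat2}
    (hreal : ∀ x, g (toC x) ∈ CMat2.realM) : imP g = fun _ => 0 := by
  funext x
  have h : (g (toC x)).map Complex.im = 0 := by
    ext i j
    exact CMat2.mem_realM_iff.1 (hreal x) i j
  rw [imP, h, map_zero]

/-- The complexification of an operator on real functions. -/
noncomputable def cx (σ : ℝ) (T : ((Fin d → ℝ) → SL2Alg) → (Fin d → ℝ) → SL2Alg)
    (g : (Fin d → ℂ) → CMat2) (z : Fin d → ℂ) : CMat2 :=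
  hext σ (T (reP g)) z + Complex.I • hext σ (T (imP g)) z

variable {T : ((Fin d → ℝ) → SL2Alg) → (Fin d → ℝ) → SL2Alg}

section

variable (hρ : 0 < ρ) (hσ : 0 < σ) (hT : RealOp ρ σ K T) {g : (Fin d → ℂ) → CMat2}
  (hg : BH ρ M g)
include hρ hσ hT hg

theorem cx_toC (x : Fin d → ℝ) : cx σ T g (toC x) = CMat2.ofRealM (T (reP g) x : Mat2)
    + Complex.I • CMat2.ofRealM (T (imP g) x : Mat2) := by
  have h1 := hext_spec hσ (hT.bound (hg.reP hρ).1 (hg.reP hρ).2)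
  have h2 := hext_spec hσ (hT.bound (hg.imP hρ).1 (hg.imP hρ).2)
  rw [cx, h1.2.1, h2.2.1]

theorem differentiableOn_cx : DifferentiableOn ℂ (cx σ T g) (strip d σ) := by
  have h1 := hext_spec hσ (hT.bound (hg.reP hρ).1 (hg.reP hρ).2)
  have h2 := hext_spec hσ (hT.bound (hg.imP hρ).1 (hg.imP hρ).2)
  exact h1.1.add (h2.1.const_smul Complex.I)

theorem cx_bh : BH σ (8 * K * M) (cx σ T g) where
  diff := differentiableOn_cx hρ hσ hT hg
  bound := fun z hz => by
    have h1 := hext_spec hσ (hT.bound (hg.reP hρ).1 (hg.reP hρ).2)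
    have h2 := hext_spec hσ (hT.bound (hg.imP hρ).1 (hg.imP hρ).2)
    refine (norm_add_le _ _).trans ?_
    rw [norm_smul, Complex.norm_I, one_mul]
    linarith [h1.2.2 z hz, h2.2.2 z hz]
  per := fun z hz k => by
    set w : Fin d → ℝ := fun i => (k i : ℝ) with hw
    have e : (fun i => (k i : ℂ)) = toC w := by ext i; simp [toC, hw]
    rw [e]
    refine eqOn_strip_of_eq_real hσ (f := fun z => cx σ T g (z + toC w))
      ((differentiableOn_cx hρ hσ hT hg).comp (by fun_prop)
        fun z hz => add_toC_mem_strip hz w) (differentiableOn_cx hρ hσ hT hg) (fun x => ?_) hz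
    have e1 : x + w = x + fun i => ((1 : ℕ) : ℝ) * (k i : ℝ) := by ext i; simp [hw]
    rw [← toC_add, cx_toC hρ hσ hT hg, cx_toC hρ hσ hT hg, e1, hT.per (hg.anW_reP hρ),
      hT.per (hg.anW_imP hρ)]

theorem trace_cx {z : Fin d → ℂ} (hz : z ∈ strip d σ) : (cx σ T g z).trace = 0 := by
  have h := differentiableOn_cx hρ hσ hT hg
  have htr : ∀ X : SL2Alg, (CMat2.ofRealM (X : Mat2)).trace = 0 := fun X => by
    rw [Matrix.trace_fin_two]
    change (((X : Mat2) 0 0 : ℝ) : ℂ) + (((X : Mat2) 1 1 : ℝ) : ℂ) = 0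
    rw [X.entry11]
    push_cast
    ring
  refine eqOn_strip_of_eq_real hσ (f := fun z => (cx σ T g z).trace) (g := fun _ => 0) ?_
    (by fun_prop) (fun x => ?_) hz
  · simp only [Matrix.trace_fin_two]
    exact (h.entry 0 0).add (h.entry 1 1)
  · rw [cx_toC hρ hσ hT hg, Matrix.trace_add, Matrix.trace_smul, htr, htr, smul_zero, add_zero]

theorem cx_toC_of_real (hreal : ∀ x, g (toC x) ∈ CMat2.realM) (x : Fin d → ℝ) :
    cx σ T g (toC x) = CMat2.ofRealM (T (reP g) x : Mat2) := by
  have h0 : T (fun _ => 0) = fun _ => 0 := by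
    have h := hT.smul (P := fun _ => 0) (isAnalyticWidth_const 0) 0
    simpa using h
  rw [cx_toC hρ hσ hT hg, imP_eq_zero_of_real hreal, h0]
  have : CMat2.ofRealM ((0 : SL2Alg) : Mat2) = 0 := map_zero _
  rw [this, smul_zero, add_zero]

end

/-- Complex linearity holds at real points by the splitting into real and imaginary parts and the
real linearity of `T`; the identity theorem extends it to the strip. -/
theorem RealOp.bddOp (hρ : 0 < ρ) (hσ : 0 < σ) (hT : RealOp ρ σ K T) :
    BddOp ρ σ (8 * K) (cx σ T) where
  bh := fun hg => cx_bh hρ hσ hT hg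
  add := fun {M M' g g'} hg hg' z hz => by
    refine eqOn_strip_of_eq_real hσ (differentiableOn_cx hρ hσ hT (hg.add hg'))
      ((differentiableOn_cx hρ hσ hT hg).add (differentiableOn_cx hρ hσ hT hg')) (fun x => ?_) hz
    rw [Pi.add_apply, cx_toC hρ hσ hT (hg.add hg'), cx_toC hρ hσ hT hg, cx_toC hρ hσ hT hg', reP_add, imP_add,
      hT.add (hg.anW_reP hρ) (hg'.anW_reP hρ), hT.add (hg.anW_imP hρ) (hg'.anW_imP hρ)]
    have e : ∀ X Y : SL2Alg, CMat2.ofRealM ((X + Y : SL2Alg) : Mat2)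
      = CMat2.ofRealM (X : Mat2) + CMat2.ofRealM (Y : Mat2) := fun X Y => map_add _ _ _
    rw [e, e, smul_add]
    abel
  smul := fun {M g} hg a z hz => by
    refine eqOn_strip_of_eq_real hσ (differentiableOn_cx hρ hσ hT (hg.smul a))
      ((differentiableOn_cx hρ hσ hT hg).const_smul a) (fun x => ?_) hz
    have r := hg.anW_reP hρ
    have i := hg.anW_imP hρ
    rw [Pi.smul_apply, cx_toC hρ hσ hT (hg.smul a), cx_toC hρ hσ hT hg, reP_smul, imP_smul,
      hT.add (r.smul _) (i.smul _), hT.add (r.smul _) (i.smul _), hT.smul r, hT.smul r, hT.smul i,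
      hT.smul i]
    have e : ∀ X Y : SL2Alg, CMat2.ofRealM ((X + Y : SL2Alg) : Mat2)
      = CMat2.ofRealM (X : Mat2) + CMat2.ofRealM (Y : Mat2) := fun X Y => map_add _ _ _
    have e' : ∀ (k : ℝ) (X : SL2Alg), CMat2.ofRealM ((k • X : SL2Alg) : Mat2)
      = (k : ℂ) • CMat2.ofRealM (X : Mat2) := fun k X => CMat2.ofRealM_smul _ _
    rw [e, e, e', e', e', e']
    set A := CMat2.ofRealM (T (reP g) x : Mat2)
    set B := CMat2.ofRealM (T (imP g) x : Mat2)
    have ha : a = (a.re : ℂ) + (a.im : ℂ) * Complex.I := (Complex.re_add_im a).symm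
    conv_rhs => rw [ha]
    push_cast
    ext i j
    simp only [Matrix.add_apply, Matrix.smul_apply, smul_eq_mul]
    linear_combination (-(a.im : ℂ)) * B i j * Complex.I_mul_I

end Complexification

/-! ### The homological equation for `t A₀`, with solution polynomial in `t`. -/

section ScaledEquation

variable {d : ℕ} {ω : Fin d → ℝ} {c c' ν ρ₀ ρ σ r M K K' : ℝ} {C S : SL2Alg →ₗ[ℝ] SL2Alg}
  {T : ((Fin d → ℝ) → SL2Alg) → (Fin d → ℝ) → SL2Alg}

theorem StripNormLE.nonneg (hρ : 0 < ρ) {f : (Fin d → ℝ) → Mat2} (h : StripNormLE ρ f M) :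
    0 ≤ M := by
  obtain ⟨F, -, -, hFM⟩ := h
  exact (norm_nonneg _).trans (hFM _ (toC_mem_strip hρ 0))

theorem StripNormLE.mono {f : (Fin d → ℝ) → Mat2} (h : StripNormLE ρ f M) {M' : ℝ}
    (hM : M ≤ M') : StripNormLE ρ f M' := by
  obtain ⟨F, h1, h2, h3⟩ := h
  exact ⟨F, h1, h2, fun z hz => (h3 z hz).trans hM⟩

theorem RealOp.mono (hρ : 0 < ρ) (hT : RealOp ρ σ K T) (hK : K ≤ K') : RealOp ρ σ K' T where
  add := hT.add
  smul := hT.smul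
  per := hT.per
  bound := fun hP hM => (hT.bound hP hM).mono (mul_le_mul_of_nonneg_right hK (hM.nonneg hρ))

theorem RealOp.lin (hT : RealOp ρ σ K T) (L : SL2Alg →ₗ[ℝ] SL2Alg) {B : ℝ} (hB0 : 0 ≤ B)
    (hB : ∀ y : SL2Alg, ‖CMat2.ofRealM (L y : Mat2)‖ ≤ B * ‖CMat2.ofRealM (y : Mat2)‖) :
    RealOp ρ σ (12 * B * K) (fun P x => L (T P x)) :=
  hT.comp (RealOp.pointwise L hB0 hB)

theorem realOp_id : RealOp (d := d) ρ ρ 1 (fun P => P) where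
  add := fun _ _ => rfl
  smul := fun _ _ => rfl
  per := fun hP => hP.per
  bound := fun _ hM => by rwa [one_mul]

/-- Subtraction of the mean value. -/
noncomputable def centered (P : (Fin d → ℝ) → SL2Alg) (x : Fin d → ℝ) : SL2Alg :=
  P x + (-LinearMap.id : SL2Alg →ₗ[ℝ] SL2Alg) (torusMean 1 P)

theorem realOp_centered (hρ : 0 < ρ) : RealOp (d := d) ρ ρ 49 centered := by
  have h := (realOp_id (d := d) (ρ := ρ)).sum
    ((realOp_mean (σ := ρ) hρ).lin (-LinearMap.id : SL2Alg →ₗ[ℝ] SL2Alg) zero_le_one (fun y => by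
      have e : CMat2.ofRealM (((-LinearMap.id : SL2Alg →ₗ[ℝ] SL2Alg) y : SL2Alg) : Mat2)
        = -CMat2.ofRealM (y : Mat2) := map_neg _ _
      rw [e, norm_neg, one_mul]))
  norm_num at h
  exact h

theorem torusMean_centered (hρ : 0 < ρ) {P : (Fin d → ℝ) → SL2Alg} (hP : AnW ρ P) :
    torusMean 1 (centered P) = 0 := by
  have h := torusMean_add 1 (Q := fun _ => (-LinearMap.id : SL2Alg →ₗ[ℝ] SL2Alg) (torusMean 1 P))
    (hP.continuous hρ) (fun _ _ => continuous_const)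
  rw [torusMean_const one_pos] at h
  change torusMean 1 (fun x => P x + (-LinearMap.id : SL2Alg →ₗ[ℝ] SL2Alg) (torusMean 1 P)) = 0
  rw [h]
  exact add_neg_cancel _

/-- The solution with right-hand side `L (P - [P])`. -/
noncomputable def partSol (ω : Fin d → ℝ) (c : ℝ) (C S L : SL2Alg →ₗ[ℝ] SL2Alg)
    (P : (Fin d → ℝ) → SL2Alg) : (Fin d → ℝ) → SL2Alg :=
  homSol ω c C S (fun x => L (centered P x))

section

variable (hρ₀ : 0 < ρ₀) (hA : IsAdmissible ω (nilpotentA c) C S c' ν ρ₀) (hρ : 0 < ρ)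
  (hρρ : ρ ≤ ρ₀)
include hA hρ hρρ

theorem realOp_homSol (hr : 0 < r) (hrρ : r < ρ) :
    RealOp ρ (ρ - r) (c' / r ^ ν) (homSol ω c C S) where
  add := fun hP hQ => homSol_add hA hρ hρρ hP hQ (hP.add hQ)
  smul := fun hP k => homSol_smul hA hρ hρρ k hP (hP.smul k)
  per := fun hP => homSol_periodic hA hρ hρρ hP
  bound := fun hP hM => by
    rw [div_mul_eq_mul_div]
    exact homSol_bound hA hρ hρρ hP hM hr hrρ

theorem realOp_partSol {α β γ : ℝ} (hα : |α| ≤ 1) (hβ : |β| ≤ 1) (hγ : |γ| ≤ 1) (hr : 0 < r)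
    (hrρ : r < ρ) :
    RealOp ρ (ρ - r) (4704 * (c' / r ^ ν)) (partSol ω c C S (triLin α β γ 0)) := by
  -- The constant 4704 is 49 for `centered` times `12 · 8` for the pointwise map `triLin`.
  have h : RealOp ρ (ρ - r) _ (partSol ω c C S (triLin α β γ 0)) :=
    ((realOp_centered hρ).lin (triLin α β γ 0) (by norm_num)
    (norm_triLin_le hα hβ hγ (by simp))).comp (realOp_homSol hA hρ hρρ hr hrρ)
  convert h using 1
  ring

include hρ₀

/-- The right-hand side has mean zero, so neither a counterterm nor a mean of the solution appears.
Each entry of `P` can therefore be solved for alone, and entries below the one that is present stay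
zero. -/
theorem partSol_spec (α β γ : ℝ) {P : (Fin d → ℝ) → SL2Alg} (hP : AnW ρ P) :
    EntryEq ω c (partSol ω c C S (triLin α β γ 0) P)
        (fun x => triLin α β γ 0 (P x - torusMean 1 P)) ∧
      (γ = 0 → (∀ x, (partSol ω c C S (triLin α β γ 0) P x : Mat2) 1 0 = 0) ∧
        (α = 0 → ∀ x, (partSol ω c C S (triLin α β γ 0) P x : Mat2) 0 0 = 0)) := by
  have hcen : ∀ x, centered P x = P x - torusMean 1 P := fun x => (sub_eq_add_neg _ _).symm
  have hQ : AnW ρ (fun x => triLin α β γ 0 (centered P x)) :=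
    ((realOp_centered hρ).lin (triLin α β γ 0) (B := 8 * max (max |α| |β|) |γ|) (by positivity)
      (norm_triLin_le (by simp) (by simp) (by simp) (by rw [abs_zero]; positivity))).anW hP
  have hmean : torusMean 1 (fun x => triLin α β γ 0 (centered P x)) = 0 := by
    have h0 := torusMean_centered hρ hP
    have e : ∀ i j, scalarMean 1 (fun x => (centered P x : Mat2) i j) = 0 := fun i j => by
      rw [← torusMean_entry, h0]; rfl
    have e' : ∀ (k : ℝ) i j, scalarMean 1 (fun x => k * (centered P x : Mat2) i j) = 0 :=
      fun k i j => by rw [scalarMean_const_mul, e, mul_zero]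
    apply SL2Alg.ext_entries <;> rw [torusMean_entry] <;>
      simp only [triLin_00, triLin_01, triLin_10, zero_mul, add_zero]
    · exact e' α 0 0
    · exact e' β 0 1
    · exact e' γ 1 0
  have h := homSol_spec hA hρ hρρ hQ
  rw [isHomologicalSolution_iff, hmean, map_zero, map_zero] at h
  refine ⟨?_, fun hγ => ?_⟩
  · have := h.2.1
    simp only [sub_zero, hcen] at this
    simp only [partSol, hcen]
    exact this
  · have h3 := homSol_triangular hρ₀ hA hρ hρρ hQ hmean (fun x => by
      rw [triLin_10, hγ, zero_mul])
    refine ⟨h3.1, fun hα => h3.2 fun x => ?_⟩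
    rw [triLin_00, hα, zero_mul, zero_mul, add_zero]

end

variable (ω c C S)

/-- The constant coefficient in `t` of the solution of the scaled equation. -/
noncomputable def coefZero (P : (Fin d → ℝ) → SL2Alg) (_ : Fin d → ℝ) : SL2Alg :=
  triLin 1 1 1 (-(c / 2)) (S (torusMean 1 P))

/-- The coefficient of `t` in the solution of the scaled equation. -/
noncomputable def coefOne (P : (Fin d → ℝ) → SL2Alg) (x : Fin d → ℝ) : SL2Alg :=
  triLin 0 0 1 0 (partSol ω c C S (triLin 0 0 1 0) P x)
    + triLin 1 0 0 0 (partSol ω c C S (triLin 1 0 0 0) P x)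
    + triLin 0 1 0 0 (partSol ω c C S (triLin 0 1 0 0) P x)
    + triLin 0 0 0 (c / 2) (S (torusMean 1 P))

/-- The coefficient of `t ^ 2` in the solution of the scaled equation. -/
noncomputable def coefTwo (P : (Fin d → ℝ) → SL2Alg) (x : Fin d → ℝ) : SL2Alg :=
  triLin 1 0 0 0 (partSol ω c C S (triLin 0 0 1 0) P x)
    + triLin 0 1 0 0 (partSol ω c C S (triLin 1 0 0 0) P x)

/-- The coefficient of `t ^ 3` in the solution of the scaled equation. -/
noncomputable def coefThree (P : (Fin d → ℝ) → SL2Alg) (x : Fin d → ℝ) : SL2Alg :=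
  triLin 0 1 0 0 (partSol ω c C S (triLin 0 0 1 0) P x)

/-- The constant counterterm. -/
noncomputable def counterOp (P : (Fin d → ℝ) → SL2Alg) (_ : Fin d → ℝ) : SL2Alg :=
  C (torusMean 1 P)

variable {ω c C S}

/-- The constant in the estimate of the solutions of the scaled equation. -/
noncomputable def coefBound (c c' : ℝ) : ℝ := 2000000 * (1 + |c|) * c'

section

variable (hρ₀ : 0 < ρ₀) (hA : IsAdmissible ω (nilpotentA c) C S c' ν ρ₀) (hρ : 0 < ρ)
  (hρρ : ρ ≤ ρ₀) (hc' : 0 < c') (hν : 0 < ν) (hr : 0 < r) (hrρ : r < ρ) (hrρ₀ : r ≤ ρ₀ / 2)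
include hρ₀ hA hρ hρρ hc' hν hr hrρ hrρ₀

/-- The restriction `r ≤ ρ₀ / 2` lets the bound of `S` be absorbed into `c' / r ^ ν`. Hence
`coefBound` depends on `c` and `c'` only, which is what makes the final constant independent of
`ρ₀`. -/
theorem realOp_coef :
    RealOp ρ (ρ - r) (coefBound c c' / r ^ ν) (coefZero (d := d) c S) ∧
    RealOp ρ (ρ - r) (coefBound c c' / r ^ ν) (coefOne ω c C S) ∧
    RealOp ρ (ρ - r) (coefBound c c' / r ^ ν) (coefTwo ω c C S) ∧
    RealOp ρ (ρ - r) (coefBound c c' / r ^ ν) (coefThree ω c C S) := by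
  set q := c' / r ^ ν with hq
  have hrν : 0 < r ^ ν := Real.rpow_pos_of_pos hr ν
  have hq0 : 0 < q := div_pos hc' hrν
  have hS : ∀ y : SL2Alg, ‖CMat2.ofRealM (S y : Mat2)‖ ≤ q * ‖CMat2.ofRealM (y : Mat2)‖ := by
    intro y
    refine (norm_S_le hρ₀ hA y).trans ?_
    rw [hq, div_mul_eq_mul_div]
    have : r ^ ν ≤ (ρ₀ / 2) ^ ν := Real.rpow_le_rpow hr.le hrρ₀ hν.le
    gcongr
  have hc1 : |c / 2| ≤ 1 + |c| := by
    rw [abs_div, abs_two]; linarith [abs_nonneg c]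
  have hm : ∀ {α β γ δ : ℝ}, |α| ≤ 1 → |β| ≤ 1 → |γ| ≤ 1 → |δ| ≤ 1 + |c| →
      RealOp (d := d) ρ (ρ - r) (4608 * (1 + |c|) * q)
        (fun P _ => triLin α β γ δ (S (torusMean 1 P))) := by
    intro α β γ δ hα hβ hγ hδ
    have h1 : (1 : ℝ) ≤ 1 + |c| := by linarith [abs_nonneg c]
    have := ((realOp_mean (d := d) (σ := ρ - r) hρ).lin S hq0.le hS).lin (triLin α β γ δ)
      (B := 8 * (1 + |c|)) (by positivity)
      (norm_triLin_le (hα.trans h1) (hβ.trans h1) (hγ.trans h1) hδ)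
    convert this using 1
    ring
  have hp : ∀ {α β γ α' β' γ' : ℝ}, |α| ≤ 1 → |β| ≤ 1 → |γ| ≤ 1 → |α'| ≤ 1 → |β'| ≤ 1 →
      |γ'| ≤ 1 → RealOp ρ (ρ - r) (451584 * q)
        (fun P x => triLin α' β' γ' 0 (partSol ω c C S (triLin α β γ 0) P x)) := by
    intro α β γ α' β' γ' hα hβ hγ hα' hβ' hγ'
    have := (realOp_partSol hA hρ hρρ hα hβ hγ hr hrρ).lin (triLin α' β' γ' 0)
      (B := 8 * 1) (by norm_num) (norm_triLin_le hα' hβ' hγ' (by simp))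
    convert this using 1
    ring
  have hD : coefBound c c' / r ^ ν = 2000000 * (1 + |c|) * q := by
    rw [coefBound, hq]; ring
  have hcq : 0 ≤ |c| * q := mul_nonneg (abs_nonneg c) hq0.le
  rw [hD]
  have z0 : |(0 : ℝ)| ≤ 1 := by simp
  have z1 : |(1 : ℝ)| ≤ 1 := by simp
  have zc : |(0 : ℝ)| ≤ 1 + |c| := by rw [abs_zero]; positivity
  refine ⟨(hm z1 z1 z1 (by rwa [abs_neg])).mono hρ (by nlinarith),
    ((((hp z0 z0 z1 z0 z0 z1).sum (hp z1 z0 z0 z1 z0 z0)).sum (hp z0 z1 z0 z0 z1 z0)).sum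
      (hm z0 z0 z0 hc1)).mono hρ (by nlinarith),
    ((hp z0 z0 z1 z1 z0 z0).sum (hp z1 z0 z0 z0 z1 z0)).mono hρ (by nlinarith),
    (hp z0 z0 z1 z0 z1 z0).mono hρ (by nlinarith)⟩

end

theorem ofRealM_sl (X : SL2Alg) : CMat2.ofRealM (X : Mat2)
    = !![(((X : Mat2) 0 0 : ℝ) : ℂ), (((X : Mat2) 0 1 : ℝ) : ℂ); (((X : Mat2) 1 0 : ℝ) : ℂ),
      -(((X : Mat2) 0 0 : ℝ) : ℂ)] := by
  ext i j
  fin_cases i <;> fin_cases j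
  · rfl
  · rfl
  · rfl
  · exact (congrArg Complex.ofReal X.entry11).trans (Complex.ofReal_neg _)

/-- The scaled solution for a real right-hand side and a complex scaling parameter. -/
noncomputable def scaledReal (ω : Fin d → ℝ) (c : ℝ) (C S : SL2Alg →ₗ[ℝ] SL2Alg) (t : ℂ)
    (P : (Fin d → ℝ) → SL2Alg) (x : Fin d → ℝ) : CMat2 :=
  CMat2.ofRealM (coefZero c S P x : Mat2) + t • CMat2.ofRealM (coefOne ω c C S P x : Mat2)
    + t ^ 2 • CMat2.ofRealM (coefTwo ω c C S P x : Mat2)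
    + t ^ 3 • CMat2.ofRealM (coefThree ω c C S P x : Mat2)

section

variable (hρ₀ : 0 < ρ₀) (hA : IsAdmissible ω (nilpotentA c) C S c' ν ρ₀) (hρ : 0 < ρ)
  (hρρ : ρ ≤ ρ₀)
include hρ₀ hA hρ hρρ

/-- Let `G`, `A`, `B` solve the equation for `A₀` with only the lower left, diagonal and upper right
entry of the centred `P`. The triangular structure with `c` replaced by `t c` then gives the entries
`t G₁₀`, `t A₀₀ + t² G₀₀` and `t B₀₁ + t² A₀₁ + t³ G₀₁`. The mean contributes `S [P]` with its
diagonal entry shifted by `(t - 1)(c / 2) (S [P])₁₀`, which corrects the quadratic term `c²` in the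
conjugation. The counterterm `C [P]` itself does not depend on `t`. -/
theorem scaledReal_eq (t : ℂ) {P : (Fin d → ℝ) → SL2Alg} (hP : AnW ρ P) (x : Fin d → ℝ) :
    (1 + t • CMat2.ofRealM (nilpotentA c : Mat2))
        * (scaledReal ω c C S t P x
          + t • (CMat2.ofRealM (P x : Mat2) - CMat2.ofRealM (C (torusMean 1 P) : Mat2)))
      = scaledReal ω c C S t P (x + ω) * (1 + t • CMat2.ofRealM (nilpotentA c : Mat2)) := by
  obtain ⟨eG, -⟩ := partSol_spec hρ₀ hA hρ hρρ 0 0 1 hP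
  obtain ⟨eA, tA⟩ := partSol_spec hρ₀ hA hρ hρρ 1 0 0 hP
  obtain ⟨eB, tB⟩ := partSol_spec hρ₀ hA hρ hρρ 0 1 0 hP
  obtain ⟨a10, -⟩ := tA rfl
  obtain ⟨b10, b00⟩ := tB rfl
  replace b00 := b00 rfl
  obtain ⟨g1, g2, g3⟩ := eG x
  obtain ⟨-, a2, a3⟩ := eA x
  obtain ⟨-, -, b3⟩ := eB x
  obtain ⟨m1, m2, m3⟩ := entryEq_const hρ₀ hA (torusMean 1 P) x
  -- The nine scalar relations are those of the three partial solutions and of the constant `S [P]`;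
  -- the four matrix entries are combinations of them with powers of `t`.
  simp only [triLin_00, triLin_01, triLin_10, SL2Alg.sub_entry, a10, b10, b00] at g1 g2 g3 a2 a3 b3 m1 m2 m3
  simp only [scaledReal, coefZero, coefOne, coefTwo, coefThree, ofRealM_sl, SL2Alg.add_entry,
    triLin_00, triLin_01, triLin_10]
  have hN0 : (nilpotentA c : Mat2) 0 0 = 0 := rfl
  have hN1 : (nilpotentA c : Mat2) 0 1 = c := rfl
  have hN2 : (nilpotentA c : Mat2) 1 0 = 0 := rfl
  rw [hN0, hN1, hN2]
  have k : ∀ {a b : ℝ}, a = b → (a : ℂ) = (b : ℂ) := fun h => congrArg Complex.ofReal h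
  replace g1 := k g1
  replace g2 := k g2
  replace g3 := k g3
  replace a2 := k a2
  replace a3 := k a3
  replace b3 := k b3
  replace m1 := k m1
  replace m2 := k m2
  replace m3 := k m3
  push_cast at g1 g2 g3 a2 a3 b3 m1 m2 m3
  ext i j
  fin_cases i <;> fin_cases j <;>
    simp [Matrix.mul_apply, Fin.sum_univ_two]
  · linear_combination t * a2 + t ^ 2 * g2 + t * m2 + t * c * (t * g1 + t * m1)
  · linear_combination t * b3 + t ^ 2 * a3 + t ^ 3 * g3 + t * m3
      - t * c * (t * a2 + t ^ 2 * g2 + t * m2)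
  · linear_combination t * g1 + t * m1
  · linear_combination -(t * a2 + t ^ 2 * g2 + t * m2)

end

end ScaledEquation

/-! ### The scaled equation for complex data and complex `t`. -/

section ComplexEquation

variable {d : ℕ} {ω : Fin d → ℝ} {c c' ν ρ₀ ρ r M : ℝ} {C S : SL2Alg →ₗ[ℝ] SL2Alg}

/-- A bound for the norm of the projection `C`. -/
noncomputable def projBound (c c' ν ρ₀ : ℝ) : ℝ :=
  1 + 4 * (2 * |c| + c ^ 2) * (c' / (ρ₀ / 2) ^ ν)

/-- Nothing is assumed on the size of `C`. The homological equation on constants expresses `C y - y`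
through `S y`, so the bound of `S` controls `C` by `c`, `c'`, `ν` and `ρ₀` alone. -/
theorem norm_C_le (hρ₀ : 0 < ρ₀) (hA : IsAdmissible ω (nilpotentA c) C S c' ν ρ₀) (y : SL2Alg) :
    ‖CMat2.ofRealM (C y : Mat2)‖ ≤ projBound c c' ν ρ₀ * ‖CMat2.ofRealM (y : Mat2)‖ := by
  obtain ⟨m1, m2, m3⟩ := entryEq_const hρ₀ hA y 0
  simp only [SL2Alg.sub_entry] at m1 m2 m3
  have e : C y = y + slMk (c * (S y : Mat2) 1 0)
      (-(2 * c * (S y : Mat2) 0 0) + c ^ 2 * (S y : Mat2) 1 0) 0 := by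
    apply SL2Alg.ext_entries <;> simp only [SL2Alg.add_entry, slMk_00, slMk_01, slMk_10] <;>
      linarith
  set N := ‖CMat2.ofRealM (y : Mat2)‖
  set q := c' / (ρ₀ / 2) ^ ν
  have hS : ∀ i j, |(S y : Mat2) i j| ≤ q * N := fun i j =>
    (abs_entry_le _ i j).trans ((norm_S_le hρ₀ hA y).trans (le_of_eq (by ring)))
  have hqN : 0 ≤ q * N := (abs_nonneg _).trans (hS 0 0)
  have h1 : |c * (S y : Mat2) 1 0| ≤ |c| * (q * N) := by
    rw [abs_mul]; exact mul_le_mul_of_nonneg_left (hS _ _) (abs_nonneg c)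
  have h2 : |2 * c * (S y : Mat2) 0 0| ≤ 2 * |c| * (q * N) := by
    rw [abs_mul, abs_mul, abs_two]; exact mul_le_mul_of_nonneg_left (hS _ _) (by positivity)
  have h3 : |c ^ 2 * (S y : Mat2) 1 0| ≤ c ^ 2 * (q * N) := by
    rw [abs_mul, abs_of_nonneg (sq_nonneg c)]
    exact mul_le_mul_of_nonneg_left (hS _ _) (sq_nonneg c)
  have h4 : 0 ≤ |c| * (q * N) := mul_nonneg (abs_nonneg c) hqN
  have h5 : 0 ≤ c ^ 2 * (q * N) := mul_nonneg (sq_nonneg c) hqN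
  have h := norm_ofRealM_slMk_le (B := (2 * |c| + c ^ 2) * (q * N))
    (a := c * (S y : Mat2) 1 0)
    (b := -(2 * c * (S y : Mat2) 0 0) + c ^ 2 * (S y : Mat2) 1 0) (g := 0)
    (by linarith) ((abs_add_le _ _).trans (by rw [abs_neg]; linarith)) (by rw [abs_zero]; linarith)
  rw [e]
  have e2 : ∀ X Y : SL2Alg, CMat2.ofRealM ((X + Y : SL2Alg) : Mat2)
    = CMat2.ofRealM (X : Mat2) + CMat2.ofRealM (Y : Mat2) := fun X Y => map_add _ _ _
  rw [e2]
  refine (norm_add_le _ _).trans ((add_le_add_right h N).trans (le_of_eq ?_))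
  rw [projBound]
  ring

theorem projBound_nonneg (hρ₀ : 0 < ρ₀) (hc' : 0 < c') : 0 ≤ projBound c c' ν ρ₀ := by
  have : 0 < (ρ₀ / 2) ^ ν := Real.rpow_pos_of_pos (half_pos hρ₀) ν
  unfold projBound
  positivity

/-- The solution of the scaled homological equation. -/
noncomputable def scaledSol (σ : ℝ) (ω : Fin d → ℝ) (c : ℝ) (C S : SL2Alg →ₗ[ℝ] SL2Alg) (t : ℂ)
    (g : (Fin d → ℂ) → CMat2) (z : Fin d → ℂ) : CMat2 :=
  cx σ (coefZero c S) g z + t • cx σ (coefOne ω c C S) g z + t ^ 2 • cx σ (coefTwo ω c C S) g z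
    + t ^ 3 • cx σ (coefThree ω c C S) g z

/-- The counterterm of a right-hand side. -/
noncomputable def counterTerm (σ : ℝ) (C : SL2Alg →ₗ[ℝ] SL2Alg) (g : (Fin d → ℂ) → CMat2) :
    CMat2 :=
  cx σ (counterOp C) g 0

theorem traceless_eq (g : (Fin d → ℂ) → CMat2) (x : Fin d → ℝ) :
    g (toC x) - ((g (toC x)).trace / 2) • (1 : CMat2)
      = CMat2.ofRealM (reP g x : Mat2) + Complex.I • CMat2.ofRealM (imP g x : Mat2) := by
  set N := g (toC x) with hN
  have h : ∀ w : ℂ, w = w.re + w.im * Complex.I := fun w => (Complex.re_add_im w).symm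
  rw [ofRealM_sl, ofRealM_sl]
  simp only [reP, imP, toSL_00, toSL_01, toSL_10, ← hN, Matrix.map_apply, Matrix.trace_fin_two]
  push_cast
  ext i j
  fin_cases i <;> fin_cases j <;> simp
  · linear_combination (1 / 2) * h (N 0 0) - (1 / 2) * h (N 1 1)
  · linear_combination h (N 0 1)
  · linear_combination h (N 1 0)
  · linear_combination (1 / 2) * h (N 1 1) - (1 / 2) * h (N 0 0)

theorem mem_strip_zero (hρ : 0 < ρ) : (0 : Fin d → ℂ) ∈ strip d ρ := fun i => by simpa using hρ

theorem toC_zero : toC (0 : Fin d → ℝ) = 0 := by ext i; simp [toC]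

section

variable (hρ₀ : 0 < ρ₀) (hA : IsAdmissible ω (nilpotentA c) C S c' ν ρ₀) (hc' : 0 < c')
  (hρ : 0 < ρ)

include hρ₀ hA hc' hρ in
theorem realOp_counter {σ : ℝ} :
    RealOp ρ σ (48 * projBound c c' ν ρ₀) (counterOp (d := d) C) := by
  have h := (realOp_mean (d := d) (σ := σ) hρ).lin C (projBound_nonneg hρ₀ hc') (norm_C_le hρ₀ hA)
  refine h.mono hρ (le_of_eq ?_)
  ring

include hρ₀ hA hc' hρ in
theorem counterTerm_family {σ : ℝ} (hσ : 0 < σ) {U : Set (Fin 2 → ℂ)} (hU : IsOpen U)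
    {g : (Fin 2 → ℂ) → (Fin d → ℂ) → CMat2} (hg : FH U ρ M g) :
    DifferentiableOn ℂ (fun ζ => counterTerm σ C (g ζ)) U ∧
      ∀ ζ ∈ U, ‖counterTerm σ C (g ζ)‖ ≤ 384 * projBound c c' ν ρ₀ * M ∧
        (counterTerm σ C (g ζ)).trace = 0 := by
  have hT := realOp_counter hρ₀ hA hc' hρ (σ := σ)
  have hF := (hT.bddOp hρ hσ).family hU hg
  refine ⟨hF.diff.comp (f := fun ζ => (ζ, (0 : Fin d → ℂ))) (by fun_prop)
    fun ζ hζ => ⟨hζ, mem_strip_zero hσ⟩, fun ζ hζ => ⟨?_, ?_⟩⟩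
  · refine (hF.bound ζ hζ 0 (mem_strip_zero hσ)).trans (le_of_eq ?_)
    ring
  · exact trace_cx hρ hσ hT (hg.single hζ) (mem_strip_zero hσ)

include hρ₀ hA hc' hρ in
theorem counterTerm_real {σ : ℝ} (hσ : 0 < σ) {g : (Fin d → ℂ) → CMat2} (hg : BH ρ M g)
    (hreal : ∀ x, g (toC x) ∈ CMat2.realM) :
    counterTerm σ C g = CMat2.ofRealM (C (torusMean 1 (reP g)) : Mat2) := by
  rw [counterTerm, ← toC_zero]
  exact cx_toC_of_real hρ hσ (realOp_counter hρ₀ hA hc' hρ (σ := σ)) hg hreal 0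

variable (hρρ : ρ ≤ ρ₀) (hν : 0 < ν) (hr : 0 < r) (hrρ : r < ρ) (hrρ₀ : r ≤ ρ₀ / 2)
include hρ₀ hA hρ hρρ hc' hν hr hrρ hrρ₀

theorem scaledSol_family {U : Set (Fin 2 → ℂ)} (hU : IsOpen U)
    {g : (Fin 2 → ℂ) → (Fin d → ℂ) → CMat2} (hg : FH U ρ M g) {t : (Fin 2 → ℂ) → ℂ}
    (ht : DifferentiableOn ℂ t U) (ht2 : ∀ ζ ∈ U, ‖t ζ‖ ≤ 2) :
    FH U (ρ - r) (120 * (coefBound c c' / r ^ ν) * M)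
        (fun ζ => scaledSol (ρ - r) ω c C S (t ζ) (g ζ)) ∧
      ∀ ζ ∈ U, ∀ z ∈ strip d (ρ - r), (scaledSol (ρ - r) ω c C S (t ζ) (g ζ) z).trace = 0 := by
  obtain ⟨h0, h1, h2, h3⟩ := realOp_coef hρ₀ hA hρ hρρ hc' hν hr hrρ hrρ₀
  have hσ : 0 < ρ - r := sub_pos.2 hrρ
  have f0 := (h0.bddOp hρ hσ).family hU hg
  have f1 := (h1.bddOp hρ hσ).family hU hg
  have f2 := (h2.bddOp hρ hσ).family hU hg
  have f3 := (h3.bddOp hρ hσ).family hU hg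
  set B := 8 * (coefBound c c' / r ^ ν) * M with hB
  have ht' : DifferentiableOn ℂ (fun p : (Fin 2 → ℂ) × (Fin d → ℂ) => t p.1)
    (U ×ˢ strip d (ρ - r)) := ht.comp (f := Prod.fst) (by fun_prop) fun p hp => hp.1
  refine ⟨⟨?_, ?_, ?_⟩, ?_⟩
  · exact ((f0.diff.add (ht'.smul f1.diff)).add ((ht'.pow 2).smul f2.diff)).add
      ((ht'.pow 3).smul f3.diff)
  · intro ζ hζ z hz
    have b0 := f0.bound ζ hζ z hz
    have b1 := f1.bound ζ hζ z hz
    have b2 := f2.bound ζ hζ z hz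
    have b3 := f3.bound ζ hζ z hz
    have hB0 : 0 ≤ B := (norm_nonneg _).trans b0
    have t1 := ht2 ζ hζ
    have t2 : ‖t ζ ^ 2‖ ≤ 4 := by rw [norm_pow]; nlinarith [norm_nonneg (t ζ)]
    have t3 : ‖t ζ ^ 3‖ ≤ 8 := by
      rw [norm_pow]
      calc ‖t ζ‖ ^ 3 ≤ 2 ^ 3 := by gcongr
        _ = 8 := by norm_num
    have key : ∀ (a : ℂ) (N : CMat2) (k : ℝ), ‖a‖ ≤ k → ‖N‖ ≤ B → ‖a • N‖ ≤ k * B :=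
      fun a N k ha hN => by
        rw [norm_smul]
        exact mul_le_mul ha hN (norm_nonneg _) ((norm_nonneg _).trans ha)
    refine (norm_add_le _ _).trans ?_
    have := norm_add₃_le (a := cx (ρ - r) (coefZero c S) (g ζ) z)
      (b := t ζ • cx (ρ - r) (coefOne ω c C S) (g ζ) z)
      (c := t ζ ^ 2 • cx (ρ - r) (coefTwo ω c C S) (g ζ) z)
    -- The factor is `8 · 15`: 8 from complexification and `1 + 2 + 4 + 8` from the powers of `t`
    -- with `‖t‖ ≤ 2`.
    have e : 120 * (coefBound c c' / r ^ ν) * M = 15 * B := by rw [hB]; ring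
    rw [e]
    linarith [key _ _ 2 t1 b1, key _ _ 4 t2 b2, key _ _ 8 t3 b3]
  · intro ζ hζ z hz k
    simp only [scaledSol, f0.per ζ hζ z hz k, f1.per ζ hζ z hz k, f2.per ζ hζ z hz k,
      f3.per ζ hζ z hz k]
  · intro ζ hζ z hz
    simp only [scaledSol, Matrix.trace_add, Matrix.trace_smul,
      trace_cx hρ hσ h0 (hg.single hζ) hz, trace_cx hρ hσ h1 (hg.single hζ) hz,
      trace_cx hρ hσ h2 (hg.single hζ) hz, trace_cx hρ hσ h3 (hg.single hζ) hz, smul_zero,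
      add_zero]

theorem differentiableOn_scaledSol {g : (Fin d → ℂ) → CMat2} (hg : BH ρ M g) (t : ℂ) :
    DifferentiableOn ℂ (scaledSol (ρ - r) ω c C S t g) (strip d (ρ - r)) := by
  obtain ⟨h0, h1, h2, h3⟩ := realOp_coef hρ₀ hA hρ hρρ hc' hν hr hrρ hrρ₀
  have hσ : 0 < ρ - r := sub_pos.2 hrρ
  exact (((differentiableOn_cx hρ hσ h0 hg).add
    ((differentiableOn_cx hρ hσ h1 hg).const_smul t)).add
    ((differentiableOn_cx hρ hσ h2 hg).const_smul (t ^ 2))).add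
    ((differentiableOn_cx hρ hσ h3 hg).const_smul (t ^ 3))

theorem scaledSol_real {g : (Fin d → ℂ) → CMat2} (hg : BH ρ M g) {t : ℂ} (ht : t.im = 0)
    (hreal : ∀ x, g (toC x) ∈ CMat2.realM) (x : Fin d → ℝ) :
    scaledSol (ρ - r) ω c C S t g (toC x) ∈ CMat2.realM := by
  obtain ⟨h0, h1, h2, h3⟩ := realOp_coef hρ₀ hA hρ hρρ hc' hν hr hrρ hrρ₀
  have hσ : 0 < ρ - r := sub_pos.2 hrρ
  have t2 : (t ^ 2).im = 0 := by rw [sq]; exact CMat2.im_mul_eq_zero ht ht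
  have t3 : (t ^ 3).im = 0 := by rw [pow_succ]; exact CMat2.im_mul_eq_zero t2 ht
  rw [scaledSol, cx_toC_of_real hρ hσ h0 hg hreal, cx_toC_of_real hρ hσ h1 hg hreal,
    cx_toC_of_real hρ hσ h2 hg hreal, cx_toC_of_real hρ hσ h3 hg hreal]
  exact CMat2.realM.add_mem (CMat2.realM.add_mem (CMat2.realM.add_mem (CMat2.ofRealM_mem _)
    (CMat2.smul_mem_realM ht (CMat2.ofRealM_mem _)))
    (CMat2.smul_mem_realM t2 (CMat2.ofRealM_mem _)))
    (CMat2.smul_mem_realM t3 (CMat2.ofRealM_mem _))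

/-- At real points the equation is the complex combination of `scaledReal_eq` for the real and
imaginary parts of the trace-zero part of `g`, the parameter `t` being complex already there; both
sides are holomorphic on the strip. -/
theorem scaledSol_eq {g : (Fin d → ℂ) → CMat2} (hg : BH ρ M g) (t : ℂ) {z : Fin d → ℂ}
    (hz : z ∈ strip d (ρ - r)) :
    (1 + t • CMat2.ofRealM (nilpotentA c : Mat2))
        * (scaledSol (ρ - r) ω c C S t g z
          + t • (g z - ((g z).trace / 2) • (1 : CMat2) - counterTerm (ρ - r) C g))
      = scaledSol (ρ - r) ω c C S t g (z + toC ω)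
        * (1 + t • CMat2.ofRealM (nilpotentA c : Mat2)) := by
  obtain ⟨h0, h1, h2, h3⟩ := realOp_coef hρ₀ hA hρ hρρ hc' hν hr hrρ hrρ₀
  have hσ : 0 < ρ - r := sub_pos.2 hrρ
  have hC := realOp_counter hρ₀ hA hc' hρ (σ := ρ - r)
  have hd := differentiableOn_scaledSol hρ₀ hA hc' hρ hρρ hν hr hrρ hrρ₀ hg t
  have hd' : DifferentiableOn ℂ (fun z => scaledSol (ρ - r) ω c C S t g (z + toC ω))
    (strip d (ρ - r)) := hd.comp (by fun_prop) fun z hz => add_toC_mem_strip hz ω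
  have hgd : DifferentiableOn ℂ g (strip d (ρ - r)) := hg.diff.mono (strip_mono (by linarith))
  have htr : DifferentiableOn ℂ (fun z => ((g z).trace / 2) • (1 : CMat2)) (strip d (ρ - r)) := by
    simp only [Matrix.trace_fin_two, div_eq_mul_inv]
    exact (((hgd.entry 0 0).add (hgd.entry 1 1)).mul_const (2 : ℂ)⁻¹).smul_const (1 : CMat2)
  refine eqOn_strip_of_eq_real hσ (f := fun z => (1 + t • CMat2.ofRealM (nilpotentA c : Mat2))
        * (scaledSol (ρ - r) ω c C S t g z
          + t • (g z - ((g z).trace / 2) • (1 : CMat2) - counterTerm (ρ - r) C g)))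
    (g := fun z => scaledSol (ρ - r) ω c C S t g (z + toC ω)
        * (1 + t • CMat2.ofRealM (nilpotentA c : Mat2))) ?_ ?_ (fun x => ?_) hz
  · exact (hd.add (((hgd.sub htr).sub_const _).const_smul t)).const_mul _
  · exact hd'.mul_const _
  · have hs : ∀ y, scaledSol (ρ - r) ω c C S t g (toC y)
        = scaledReal ω c C S t (reP g) y + Complex.I • scaledReal ω c C S t (imP g) y := by
      intro y
      rw [scaledSol, cx_toC hρ hσ h0 hg, cx_toC hρ hσ h1 hg, cx_toC hρ hσ h2 hg,
        cx_toC hρ hσ h3 hg, scaledReal, scaledReal]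
      simp only [smul_add, smul_comm _ Complex.I]
      abel
    have hc : counterTerm (ρ - r) C g = CMat2.ofRealM (C (torusMean 1 (reP g)) : Mat2)
        + Complex.I • CMat2.ofRealM (C (torusMean 1 (imP g)) : Mat2) := by
      rw [counterTerm, ← toC_zero]
      exact cx_toC hρ hσ hC hg 0
    have e1 := scaledReal_eq hρ₀ hA hρ hρρ t (hg.anW_reP hρ) x
    have e2 := scaledReal_eq hρ₀ hA hρ hρρ t (hg.anW_imP hρ) x
    rw [traceless_eq, hc, ← toC_add, hs, hs]
    have e3 := congrArg₂ (fun a b : CMat2 => a + Complex.I • b) e1 e2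
    rw [← mul_smul_comm, ← smul_mul_assoc, ← mul_add, ← add_mul] at e3
    rw [← e3]
    congr 1
    simp only [smul_add, smul_sub, smul_comm _ Complex.I]
    abel

end

end ComplexEquation

/-! ### Differentiability of the step and preservation of the conjugacy relation. -/

namespace CMat2

section Differentiability

variable {E : Type*} [NormedAddCommGroup E] [NormedSpace ℂ E] {V : Set E} {F G : E → CMat2}

theorem _root_.DifferentiableOn.mdet (hF : DifferentiableOn ℂ F V) :
    DifferentiableOn ℂ (fun x => (F x).det) V := by
  simp only [Matrix.det_fin_two]
  exact ((hF.entry 0 0).mul (hF.entry 1 1)).sub ((hF.entry 0 1).mul (hF.entry 1 0))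

theorem _root_.DifferentiableOn.mtrace (hF : DifferentiableOn ℂ F V) :
    DifferentiableOn ℂ (fun x => (F x).trace) V := by
  simp only [Matrix.trace_fin_two]
  exact (hF.entry 0 0).add (hF.entry 1 1)

theorem _root_.DifferentiableOn.madjugate (hF : DifferentiableOn ℂ F V) :
    DifferentiableOn ℂ (fun x => (F x).adjugate) V := by
  refine differentiableOn_of_entries fun i j => ?_
  simp only [Matrix.adjugate_fin_two]
  fin_cases i <;> fin_cases j
  · exact hF.entry 1 1
  · exact (hF.entry 0 1).neg
  · exact (hF.entry 1 0).neg
  · exact hF.entry 0 0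

theorem _root_.DifferentiableOn.inv1 (hF : DifferentiableOn ℂ F V)
    (h : ∀ x ∈ V, 1 + (F x).det ≠ 0) : DifferentiableOn ℂ (fun x => inv1 (F x)) V :=
  ((hF.mdet.const_add 1).inv h).smul (hF.const_add 1)

theorem _root_.DifferentiableOn.cay (hF : DifferentiableOn ℂ F V)
    (h : ∀ x ∈ V, 1 + (F x).det ≠ 0) : DifferentiableOn ℂ (fun x => cay (F x)) V :=
  (hF.const_add 1).mul (hF.inv1 h)

theorem _root_.DifferentiableOn.errStep {χ s : E → ℂ} {Z κ h η Y P : E → CMat2}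
    (hχ : DifferentiableOn ℂ χ V) (hs : DifferentiableOn ℂ s V) (hZ : DifferentiableOn ℂ Z V)
    (hκ : DifferentiableOn ℂ κ V) (hh : DifferentiableOn ℂ h V) (hη : DifferentiableOn ℂ η V)
    (hY : DifferentiableOn ℂ Y V) (hP : DifferentiableOn ℂ P V)
    (d1 : ∀ x ∈ V, 1 + ((s x / 2) • κ x).det ≠ 0)
    (d2 : ∀ x ∈ V, 1 + ((s x / 2) • (κ x + η x)).det ≠ 0)
    (d3 : ∀ x ∈ V, 1 + ((χ x / 2) • Y x).det ≠ 0)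
    (d4 : ∀ x ∈ V, 1 + ((χ x / 2) • Y x + (s x / 2) • P x).det ≠ 0) :
    DifferentiableOn ℂ
      (fun x => errStep (χ x) (s x) (Z x) (κ x) (h x) (η x) (Y x) (P x)) V := by
  have hs2 : DifferentiableOn ℂ (fun x => s x / 2) V := by
    simp only [div_eq_mul_inv]; exact hs.mul_const _
  have hχ2 : DifferentiableOn ℂ (fun x => χ x / 2) V := by
    simp only [div_eq_mul_inv]; exact hχ.mul_const _
  have ha := hχ2.smul hY
  have ha' := ha.add (hs2.smul hP)
  have i1 := (hs2.smul hκ).inv1 d1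
  have i2 := (hs2.smul (hκ.add hη)).neg.inv1 fun x hx => by
    have := d2 x hx
    rwa [← det_neg'] at this
  have i3 := ha.inv1 d3
  have c3 := ha.cay d3
  have d4' : ∀ x ∈ V, 1 + (-((χ x / 2) • Y x + (s x / 2) • P x)).det ≠ 0 := fun x hx => by
    have := d4 x hx
    rwa [← det_neg'] at this
  have i4 := ha'.neg.inv1 d4'
  have c4 := ha'.neg.cay d4'
  have hk := (i1.mul hη).mul i2
  have hzk := (hZ.madjugate.mul hk).mul hZ
  have hm := (hh.sub hzk).sub (hs.smul (hh.mul hzk))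
  exact ((c4.mul hm).mul c3).sub ((i4.mul hP).mul i3)

end Differentiability

section Algebra

variable {χ s : ℂ} {Z κ h η Y P T E : CMat2}

theorem mul_inv1_of_conj {a b : CMat2} (hT : T.det = 1) (hab : T * a = b * T) :
    T * inv1 a = inv1 b * T := by
  have hdet : a.det = b.det := by
    have := congrArg Matrix.det hab
    rwa [Matrix.det_mul, Matrix.det_mul, hT, one_mul, mul_one] at this
  rw [inv1, inv1, hdet, mul_smul_comm, smul_mul_assoc, mul_add, add_mul, hab, mul_one, one_mul]

theorem mul_cay_of_conj {a b : CMat2} (hT : T.det = 1) (hab : T * a = b * T) :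
    T * cay a = cay b * T := by
  rw [cay, cay, ← mul_assoc, mul_add, mul_one, hab, mul_assoc (1 + b),
    ← mul_inv1_of_conj hT hab, ← mul_assoc, add_mul 1 b T, one_mul]

theorem one_add_smul_mul_inv1 (hY : Y.trace = 0) (hd : 1 + ((χ / 2) • Y).det ≠ 0) :
    1 + χ • (Y * inv1 ((χ / 2) • Y)) = cay ((χ / 2) • Y) := by
  have h1 := one_sub_mul_inv1 (a := (χ / 2) • Y) (by rw [Matrix.trace_smul, hY, smul_zero]) hd
  set a := (χ / 2) • Y with ha
  have h2 : χ • (Y * inv1 a) = (2 : ℂ) • (a * inv1 a) := by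
    rw [ha, smul_mul_assoc, smul_smul]; congr 1; ring
  rw [h2, cay, two_smul, add_mul, one_mul]
  rw [sub_mul, one_mul] at h1
  nth_rw 1 [← h1]
  abel

/-- The analytic input is `hTa`, the scaled homological equation multiplied by `χ / 2`. As the
Cayley transform commutes with conjugation, it turns into the intertwining of the two Cayley factors
by `T`; the rest is exact regrouping. -/
theorem conjugacy_step {Zp Yp : CMat2} (hZ : Z.det = 1) (hT : T.det = 1) (hκ : κ.trace = 0)
    (hη : η.trace = 0) (hY : Y.trace = 0) (hP : P.trace = 0)
    (hdκ : 1 + ((s / 2) • κ).det ≠ 0) (hdκ' : 1 + ((s / 2) • (κ + η)).det ≠ 0)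
    (hd : 1 + ((χ / 2) • Y).det ≠ 0) (hd' : 1 + ((χ / 2) • Y + (s / 2) • P).det ≠ 0)
    (hTa : T * ((χ / 2) • Y + (s / 2) • P) = (χ / 2) • Yp * T)
    (hinv : T * (E * cay (-((s / 2) • κ)) * Z) = Zp * T * (1 + s • h)) :
    T * (E * cay (-((s / 2) • (κ + η))) * (Z * cay ((χ / 2) • Y)))
      = (Zp * cay ((χ / 2) • Yp)) * T * (1 + s • errStep χ s Z κ h η Y P) := by
  have h1 := cay_neg_mul_one_sub_counterStep (s := s) hκ hη hdκ hdκ'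
  have h2 := one_add_smul_midStep (s := s) (κ := κ) (h := h) (η := η) hZ
  have h3 := cay_mul_one_add_errStep (s := s) (χ := χ) (Z := Z) (κ := κ) (h := h) (η := η)
    hY hP hd hd'
  have h4 := mul_cay_of_conj hT hTa
  have z1 := adjugate_mul_self hZ
  have z2 := mul_adjugate_self hZ
  set k := cay (-((s / 2) • κ))
  set cs := counterStep s κ η
  have h5 : T * (E * k) = Zp * T * (1 + s • h) * Z.adjugate := by
    rw [← hinv]
    calc T * (E * k) = T * (E * k) * (Z * Z.adjugate) := by rw [z2, mul_one]
      _ = _ := by simp only [mul_assoc]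
  rw [← h1]
  calc T * (E * (k * (1 - s • cs)) * (Z * cay ((χ / 2) • Y)))
      = T * (E * k) * (1 - s • cs) * Z * cay ((χ / 2) • Y) := by simp only [mul_assoc]
    _ = Zp * T * (Z.adjugate * Z) * (1 + s • h) * Z.adjugate * (1 - s • cs) * Z
        * cay ((χ / 2) • Y) := by rw [h5, z1, mul_one]
    _ = Zp * T * Z.adjugate * (Z * (1 + s • h) * Z.adjugate * (1 - s • cs) * Z)
        * cay ((χ / 2) • Y) := by simp only [mul_assoc]
    _ = Zp * T * (Z.adjugate * Z) * ((1 + s • midStep s Z κ h η) * cay ((χ / 2) • Y)) := by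
        rw [← h2]; simp only [mul_assoc]
    _ = Zp * (T * cay ((χ / 2) • Y + (s / 2) • P)) * (1 + s • errStep χ s Z κ h η Y P) := by
        rw [h3, z1, mul_one]; simp only [mul_assoc]
    _ = _ := by rw [h4]; simp only [mul_assoc]

end Algebra

end CMat2

/-! ### Size bookkeeping for one step. -/

namespace CMat2

theorem det_one_add_smul {s : ℂ} {h : CMat2} (hh : Unimod s h) : (1 + s • h).det = 1 := by
  unfold Unimod at hh
  simp only [Matrix.det_fin_two, Matrix.trace_fin_two] at hh ⊢
  simp
  linear_combination s * hh

theorem unimod_mul_inv1 {χ : ℂ} {Y : CMat2} (hY : Y.trace = 0) :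
    Unimod χ (Y * inv1 ((χ / 2) • Y)) := by
  have h1 : Y * inv1 ((χ / 2) • Y)
      = (1 + ((χ / 2) • Y).det)⁻¹ • (Y - (χ / 2 * Y.det) • (1 : CMat2)) := by
    rw [inv1, mul_smul_comm, mul_add, mul_one, mul_smul_comm, mul_self_of_trace_zero hY, smul_smul,
      mul_neg, neg_smul, ← sub_eq_add_neg]
  rw [Matrix.trace_fin_two] at hY
  have h11 : Y 1 1 = -Y 0 0 := by linear_combination hY
  have hdet : ((χ / 2) • Y).det = (χ / 2) ^ 2 * Y.det := by
    rw [Matrix.det_smul, Fintype.card_fin]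
  rw [hdet] at h1
  rw [h1, Unimod, Matrix.trace_smul, Matrix.det_smul, Fintype.card_fin]
  simp only [Matrix.det_fin_two, Matrix.trace_fin_two, h11]
  simp [h11]
  field_simp
  ring

theorem trace_traceless_sub {h η : CMat2} (hη : η.trace = 0) :
    (h - (h.trace / 2) • (1 : CMat2) - η).trace = 0 := by
  rw [Matrix.trace_sub, Matrix.trace_sub, Matrix.trace_smul, hη, Matrix.trace_one]
  simp

theorem norm_smul_half_le {a : ℂ} {N : CMat2} {k B : ℝ} (ha : ‖a‖ ≤ 2 * k) (hN : ‖N‖ ≤ B) :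
    ‖(a / 2) • N‖ ≤ k * B := by
  rw [norm_smul, norm_div, Complex.norm_two]
  exact mul_le_mul (by linarith) hN (norm_nonneg _) (by linarith [norm_nonneg a])

/-- With `q = 2^{-n}`, the budgets `4 y (1 - q)` and `2 Q H₀ (1 - q)` leave room for the increments
`2 y q` and `Q H₀ q` up to the same expressions with `q / 2`. In `P`, the 2 contained in `Q` pays
for `h` and for its trace part, the remaining `Q - 2` for `η`. The number `τ` dominates every
argument of a Cayley transform and the distance of `Z` to the identity, for `‖χ‖` and `‖t‖` up to 2.
-/
theorem step_bounds {χ t : ℂ} {U κ h η Y P : CMat2} {H H₀ y Q q τ : ℝ} (hχ : ‖χ‖ ≤ 2)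
    (ht : ‖t‖ ≤ 2) (hq : 0 ≤ q) (hq1 : q ≤ 1) (hH₀ : 0 ≤ H₀) (hy : 0 ≤ y) (hQ : 2 ≤ Q)
    (hτ : τ = 16 * y + 4 * Q * H₀) (hτ1 : τ ≤ 1 / 4) (hU : ‖U‖ ≤ 4 * y * (1 - q))
    (hκ : ‖κ‖ ≤ 2 * Q * H₀ * (1 - q)) (hh : ‖h‖ ≤ H) (hH : H ≤ H₀ * q)
    (hη : ‖η‖ ≤ (Q - 2) * H) (hYt : Y.trace = 0) (hY : ‖Y‖ ≤ y * q)
    (hP : P = h - (h.trace / 2) • (1 : CMat2) - η) :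
    ‖P‖ ≤ Q * H ∧ ‖(1 + χ • U) - 1‖ ≤ τ ∧ ‖(χ / 2) • Y‖ ≤ τ ∧
      ‖(χ / 2) • Y + (χ * t / 2) • P‖ ≤ τ ∧ ‖(χ * t / 2) • κ‖ ≤ τ ∧
      ‖(χ * t / 2) • (κ + η)‖ ≤ τ ∧ ‖κ + η‖ ≤ 2 * Q * H₀ * (1 - q / 2) ∧
      ‖Y * inv1 ((χ / 2) • Y) + χ • (U * (Y * inv1 ((χ / 2) • Y)))‖ ≤ 2 * y * q := by
  have hs : ‖χ * t‖ ≤ 2 * 2 := by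
    rw [norm_mul]; exact mul_le_mul hχ ht (norm_nonneg _) (by norm_num)
  have hH0 : 0 ≤ H := (norm_nonneg _).trans hh
  have hyq : y * q ≤ y := mul_le_of_le_one_right hy hq1
  have hyq0 : 0 ≤ y * q := mul_nonneg hy hq
  have hHq : H₀ * q ≤ H₀ := mul_le_of_le_one_right hH₀ hq1
  have hQH₀ : 0 ≤ Q * H₀ := by positivity
  have hQH : Q * H ≤ Q * (H₀ * q) := by gcongr
  have hQq : Q * (H₀ * q) ≤ Q * H₀ := by gcongr
  have hQq0 : 0 ≤ Q * (H₀ * q) := by positivity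
  have hη' : ‖η‖ ≤ Q * (H₀ * q) := hη.trans (by nlinarith)
  have hP' : ‖P‖ ≤ Q * H := by
    have h1 : ‖(h.trace / 2) • (1 : CMat2)‖ ≤ H := by
      rw [norm_smul, norm_one, mul_one, norm_div, Complex.norm_two]
      linarith [norm_trace_le h]
    have h2 := norm_sub_le (h - (h.trace / 2) • (1 : CMat2)) η
    have h3 := norm_sub_le h ((h.trace / 2) • (1 : CMat2))
    rw [hP]
    linarith
  have ha : ‖(χ / 2) • Y‖ ≤ 1 * (y * q) := norm_smul_half_le (by linarith) hY
  have hsP : ‖(χ * t / 2) • P‖ ≤ 2 * (Q * H) := norm_smul_half_le hs hP'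
  have hκη : ‖κ + η‖ ≤ 2 * Q * H₀ * (1 - q / 2) := (norm_add_le _ _).trans (by nlinarith)
  have hsκ := norm_smul_half_le hs hκ
  have hsκη := norm_smul_half_le hs hκη
  have hχU : ‖χ • U‖ ≤ 2 * (4 * y * (1 - q)) := by
    rw [norm_smul]; exact mul_le_mul hχ hU (norm_nonneg _) (by norm_num)
  have haτ : ‖(χ / 2) • Y‖ ≤ τ := by linarith
  refine ⟨hP', ?_, haτ, ?_, ?_, ?_, hκη, ?_⟩
  · rw [add_sub_cancel_left]; nlinarith
  · have := norm_add_le ((χ / 2) • Y) ((χ * t / 2) • P)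
    linarith
  · nlinarith
  · nlinarith
  · have hi := norm_inv1_le (a := (χ / 2) • Y) (by rw [Matrix.trace_smul, hYt, smul_zero]) haτ hτ1
    set R := Y * inv1 ((χ / 2) • Y) with hRd
    have hR : ‖R‖ ≤ y * q * (4 / 3) :=
      (norm_mul_le _ _).trans (mul_le_mul hY hi (norm_nonneg _) hyq0)
    have h1 : ‖χ • (U * R)‖ ≤ 1 / 8 * ‖R‖ := by
      rw [← smul_mul_assoc]
      refine (norm_mul_le _ _).trans (mul_le_mul_of_nonneg_right ?_ (norm_nonneg _))
      nlinarith
    have h2 := norm_add_le R (χ • (U * R))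
    linarith

end CMat2

/-! ### The iteration, its constants and its invariants. -/

section Iteration

variable {d : ℕ}

/-- The state of the iteration: the conjugacy `1 + χ U`, the counterterm `κ` and the error `h`. -/
structure KamState (d : ℕ) where
  conj : (Fin d → ℂ) → CMat2
  counter : CMat2
  err : (Fin d → ℂ) → CMat2

/-- One step of the iteration. -/
noncomputable def kamStep (σ : ℝ) (ω : Fin d → ℝ) (c : ℝ) (C S : SL2Alg →ₗ[ℝ] SL2Alg) (χ t : ℂ)
    (st : KamState d) : KamState d where
  conj := fun z => st.conj z
    + (scaledSol σ ω c C S t st.err z * CMat2.inv1 ((χ / 2) • scaledSol σ ω c C S t st.err z)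
    + χ • (st.conj z
      * (scaledSol σ ω c C S t st.err z * CMat2.inv1 ((χ / 2) • scaledSol σ ω c C S t st.err z))))
  counter := st.counter + counterTerm σ C st.err
  err := fun z => CMat2.errStep χ (χ * t) (1 + χ • st.conj z) st.counter (st.err z)
    (counterTerm σ C st.err) (scaledSol σ ω c C S t st.err z)
    (st.err z - ((st.err z).trace / 2) • (1 : CMat2) - counterTerm σ C st.err)

/-- The width of the strip after `n` steps. -/
noncomputable def kamRadius (ρ₀ : ℝ) (n : ℕ) : ℝ := ρ₀ * (1 / 2 + (1 / 2) ^ n / 2)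

/-- The iteration. -/
noncomputable def kam (ρ₀ : ℝ) (ω : Fin d → ℝ) (c : ℝ) (C S : SL2Alg →ₗ[ℝ] SL2Alg) (χ t : ℂ)
    (f : (Fin d → ℂ) → CMat2) : ℕ → KamState d
  | 0 => ⟨fun _ => 0, 0, fun z => CMat2.initErr (χ * t) (f z)⟩
  | n + 1 => kamStep (kamRadius ρ₀ (n + 1)) ω c C S χ t (kam ρ₀ ω c C S χ t f n)

/-- The loss factor caused by the projection. -/
noncomputable def kamQ (c c' ν ρ₀ : ℝ) : ℝ := 384 * projBound c c' ν ρ₀ + 2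

/-- The size of the first solution of the homological equation. -/
noncomputable def kamY (c c' ν ρ₀ H₀ : ℝ) : ℝ := 120 * coefBound c c' * (4 / ρ₀) ^ ν * H₀

/-- The smallness parameter of the iteration. -/
noncomputable def kamTau (c c' ν ρ₀ H₀ : ℝ) : ℝ :=
  16 * kamY c c' ν ρ₀ H₀ + 4 * kamQ c c' ν ρ₀ * H₀

/-- The convergence rate of the errors. -/
noncomputable def kamRate (ν : ℝ) : ℝ := (1 / 2) ^ ν / 2

/-- The assumptions under which the iteration converges. -/
structure KamHyp (ω : Fin d → ℝ) (c c' ν ρ₀ H₀ : ℝ) (C S : SL2Alg →ₗ[ℝ] SL2Alg)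
    (U : Set (Fin 2 → ℂ)) (χ t : (Fin 2 → ℂ) → ℂ) (f : (Fin 2 → ℂ) → (Fin d → ℂ) → CMat2) :
    Prop where
  hρ₀ : 0 < ρ₀
  hc' : 0 < c'
  hν : 0 < ν
  adm : IsAdmissible ω (nilpotentA c) C S c' ν ρ₀
  hU : IsOpen U
  hf : FH U ρ₀ (H₀ / 2) f
  htr : ∀ ζ ∈ U, ∀ z ∈ strip d ρ₀, (f ζ z).trace = 0
  hχ : DifferentiableOn ℂ χ U
  hχ2 : ∀ ζ ∈ U, ‖χ ζ‖ ≤ 2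
  ht : DifferentiableOn ℂ t U
  ht2 : ∀ ζ ∈ U, ‖t ζ‖ ≤ 2
  hH₀ : 0 ≤ H₀
  hτ : kamTau c c' ν ρ₀ H₀ ≤ 1 / 4
  hτθ : 120 * kamTau c c' ν ρ₀ H₀ * kamQ c c' ν ρ₀ ≤ kamRate ν

/-- The properties preserved by the iteration. -/
structure KamInv (ω : Fin d → ℝ) (c c' ν ρ₀ H₀ : ℝ) (U : Set (Fin 2 → ℂ))
    (χ t : (Fin 2 → ℂ) → ℂ) (f : (Fin 2 → ℂ) → (Fin d → ℂ) → CMat2) (n : ℕ)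
    (g : (Fin 2 → ℂ) → KamState d) : Prop where
  err : FH U (kamRadius ρ₀ n) (H₀ * kamRate ν ^ n) (fun ζ => (g ζ).err)
  conj : FH U (kamRadius ρ₀ n) (4 * kamY c c' ν ρ₀ H₀ * (1 - (1 / 2) ^ n)) (fun ζ => (g ζ).conj)
  counter : DifferentiableOn ℂ (fun ζ => (g ζ).counter) U
  norm_counter : ∀ ζ ∈ U, ‖(g ζ).counter‖ ≤ 2 * kamQ c c' ν ρ₀ * H₀ * (1 - (1 / 2) ^ n)
  trace_counter : ∀ ζ ∈ U, (g ζ).counter.trace = 0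
  unimod_conj : ∀ ζ ∈ U, ∀ z ∈ strip d (kamRadius ρ₀ n), CMat2.Unimod (χ ζ) ((g ζ).conj z)
  unimod : ∀ ζ ∈ U, ∀ z ∈ strip d (kamRadius ρ₀ n), CMat2.Unimod (χ ζ * t ζ) ((g ζ).err z)
  conjugacy : ∀ ζ ∈ U, ∀ z ∈ strip d (kamRadius ρ₀ n),
    (1 + t ζ • CMat2.ofRealM (nilpotentA c : Mat2))
        * (NormedSpace.exp ((χ ζ * t ζ) • f ζ z) * CMat2.cay (-((χ ζ * t ζ / 2) • (g ζ).counter))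
          * (1 + χ ζ • (g ζ).conj z))
      = (1 + χ ζ • (g ζ).conj (z + toC ω)) * (1 + t ζ • CMat2.ofRealM (nilpotentA c : Mat2))
        * (1 + (χ ζ * t ζ) • (g ζ).err z)

theorem KamInv.det_conj {ω : Fin d → ℝ} {c c' ν ρ₀ H₀ : ℝ} {U : Set (Fin 2 → ℂ)}
    {χ t : (Fin 2 → ℂ) → ℂ} {f : (Fin 2 → ℂ) → (Fin d → ℂ) → CMat2} {n : ℕ}
    {g : (Fin 2 → ℂ) → KamState d} (hg : KamInv ω c c' ν ρ₀ H₀ U χ t f n g) {ζ : Fin 2 → ℂ}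
    (hζ : ζ ∈ U) {z : Fin d → ℂ} (hz : z ∈ strip d (kamRadius ρ₀ n)) :
    (1 + χ ζ • (g ζ).conj z).det = 1 :=
  CMat2.det_one_add_smul (hg.unimod_conj ζ hζ z hz)

/-- Narrowing the strip by `ρ₀ / 4 · 2^{-n}` costs a factor growing like `2^{n ν}`. The error decays
like `2^{-n ν} 2^{-n}`, and the surplus `2^{-n}` makes the corrections summable. -/
theorem kamRate_pow_div {ρ₀ ν : ℝ} (hρ₀ : 0 < ρ₀) (n : ℕ) :
    kamRate ν ^ n / (ρ₀ / 4 * (1 / 2) ^ n) ^ ν = (4 / ρ₀) ^ ν * (1 / 2) ^ n := by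
  have h1 : (4 / ρ₀) ^ ν = ((ρ₀ / 4) ^ ν)⁻¹ := by
    rw [← Real.inv_rpow (by positivity), inv_div]
  have h2 : (0 : ℝ) < (ρ₀ / 4) ^ ν := Real.rpow_pos_of_pos (by positivity) ν
  have h3 : (0 : ℝ) < (1 / 2) ^ ν := Real.rpow_pos_of_pos (by positivity) ν
  rw [kamRate, Real.mul_rpow (by positivity) (by positivity),
    ← Real.rpow_pow_comm (by norm_num : (0 : ℝ) ≤ 1 / 2), h1, div_pow]
  field_simp
  rw [← mul_pow]
  norm_num

theorem kamRate_le {ν : ℝ} (hν : 0 < ν) : 0 < kamRate ν ∧ kamRate ν ≤ 1 / 2 := by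
  have h3 : (0 : ℝ) < (1 / 2) ^ ν := Real.rpow_pos_of_pos (by positivity) ν
  have h4 : ((1 : ℝ) / 2) ^ ν ≤ 1 := Real.rpow_le_one (by norm_num) (by norm_num) hν.le
  constructor
  · rw [kamRate]; positivity
  · rw [kamRate]; linarith

end Iteration

/-! ### The induction step of the iteration. -/

section Iteration

variable {d : ℕ} {ω : Fin d → ℝ} {c c' ν ρ₀ H₀ : ℝ} {C S : SL2Alg →ₗ[ℝ] SL2Alg}
  {U : Set (Fin 2 → ℂ)} {χ t : (Fin 2 → ℂ) → ℂ} {f : (Fin 2 → ℂ) → (Fin d → ℂ) → CMat2}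

theorem kamRadius_zero : kamRadius ρ₀ 0 = ρ₀ := by rw [kamRadius]; norm_num

theorem kamRadius_sub (n : ℕ) :
    kamRadius ρ₀ n - ρ₀ / 4 * (1 / 2) ^ n = kamRadius ρ₀ (n + 1) := by
  rw [kamRadius, kamRadius, pow_succ]; ring

theorem half_lt_kamRadius (hρ₀ : 0 < ρ₀) (n : ℕ) : ρ₀ / 2 < kamRadius ρ₀ n := by
  have : (0 : ℝ) < ρ₀ * ((1 / 2) ^ n / 2) := by positivity
  rw [kamRadius]
  linarith

theorem half_pow_le_one (n : ℕ) : ((1 : ℝ) / 2) ^ n ≤ 1 := pow_le_one₀ (by norm_num) (by norm_num)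

theorem kamRadius_le (hρ₀ : 0 < ρ₀) (n : ℕ) : kamRadius ρ₀ n ≤ ρ₀ := by
  have := mul_le_mul_of_nonneg_left (half_pow_le_one n) hρ₀.le
  rw [kamRadius]
  linarith

theorem det_one_add_nilpotent (t : ℂ) :
    (1 + t • CMat2.ofRealM (nilpotentA c : Mat2)).det = 1 := by
  rw [ofRealM_sl]
  have hN0 : (nilpotentA c : Mat2) 0 0 = 0 := rfl
  have hN2 : (nilpotentA c : Mat2) 1 0 = 0 := rfl
  rw [hN0, hN2, Matrix.det_fin_two]
  simp

theorem differentiableOn_comp_fst {u : (Fin 2 → ℂ) → ℂ} (hu : DifferentiableOn ℂ u U) (σ : ℝ) :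
    DifferentiableOn ℂ (fun p : (Fin 2 → ℂ) × (Fin d → ℂ) => u p.1) (U ×ˢ strip d σ) :=
  hu.comp (f := Prod.fst) (by fun_prop) fun _ hp => hp.1

namespace KamHyp

variable (hyp : KamHyp ω c c' ν ρ₀ H₀ C S U χ t f)
include hyp

theorem two_le_kamQ : 2 ≤ kamQ c c' ν ρ₀ := by
  have := projBound_nonneg (c := c) (ν := ν) hyp.hρ₀ hyp.hc'
  rw [kamQ]
  linarith

theorem kamY_nonneg : 0 ≤ kamY c c' ν ρ₀ H₀ := by
  have h1 : (0 : ℝ) < (4 / ρ₀) ^ ν := Real.rpow_pos_of_pos (div_pos four_pos hyp.hρ₀) ν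
  have h2 := hyp.hc'
  have h3 := hyp.hH₀
  have h4 : 0 ≤ coefBound c c' := by unfold coefBound; positivity
  unfold kamY
  positivity

theorem H₀_le : H₀ ≤ 1 / 32 := by
  have h1 := hyp.two_le_kamQ
  have h2 := hyp.kamY_nonneg
  have h3 := hyp.hτ
  have h4 := hyp.hH₀
  unfold kamTau at h3
  nlinarith

theorem norm_smul_lt {ζ : Fin 2 → ℂ} (hζ : ζ ∈ U) {z : Fin d → ℂ} (hz : z ∈ strip d ρ₀) :
    ‖(χ ζ * t ζ) • f ζ z‖ < 1 / 2 := by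
  have h1 := hyp.hf.bound ζ hζ z hz
  have h2 := hyp.H₀_le
  have h3 : ‖χ ζ * t ζ‖ ≤ 2 * 2 := by
    rw [norm_mul]
    exact mul_le_mul (hyp.hχ2 ζ hζ) (hyp.ht2 ζ hζ) (norm_nonneg _) (by norm_num)
  rw [norm_smul]
  nlinarith [norm_nonneg (f ζ z)]

theorem kamInv_zero : KamInv ω c c' ν ρ₀ H₀ U χ t f 0
    (fun ζ => kam ρ₀ ω c C S (χ ζ) (t ζ) (f ζ) 0) := by
  have hz0 : ∀ M : ℝ, 0 ≤ M → FH (d := d) U (kamRadius ρ₀ 0) M (fun _ _ => 0) := fun M hM =>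
    ⟨by fun_prop, fun _ _ _ _ => by rwa [norm_zero], fun _ _ _ _ _ => rfl⟩
  have hn : ∀ ζ ∈ U, ∀ z ∈ strip d ρ₀, ‖(χ ζ * t ζ) • f ζ z‖ ≤ 1 / 2 :=
    fun ζ hζ z hz => (hyp.norm_smul_lt hζ hz).le
  constructor
  · rw [kamRadius_zero]
    refine ⟨?_, fun ζ hζ z hz => ?_, fun ζ hζ z hz k => ?_⟩
    · have hs := (differentiableOn_comp_fst (d := d) hyp.hχ ρ₀).mul (differentiableOn_comp_fst (d := d) hyp.ht ρ₀)
      refine hyp.hf.diff.mul (CMat2.differentiableOn_expQuot.comp (hs.smul hyp.hf.diff) ?_)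
      intro p hp
      rw [mem_ball_zero_iff]
      exact hyp.norm_smul_lt hp.1 hp.2
    · have h1 := CMat2.norm_initErr_le (hn ζ hζ z hz)
      have h2 := hyp.hf.bound ζ hζ z hz
      rw [pow_zero, mul_one]
      exact h1.trans (by linarith)
    · simp only [kam, hyp.hf.per ζ hζ z hz k]
  · exact hz0 _ (by simp)
  · exact differentiableOn_const 0
  · intro ζ _
    simp [kam]
  · intro ζ _
    exact Matrix.trace_zero _ _
  · intro ζ _ z _
    simp [kam, CMat2.Unimod]
  · rw [kamRadius_zero]
    exact fun ζ hζ z hz => CMat2.unimod_initErr (hyp.htr ζ hζ z hz) (hn ζ hζ z hz)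
  · rw [kamRadius_zero]
    intro ζ hζ z hz
    have h0 : CMat2.cay 0 = 1 := by simp [CMat2.cay, CMat2.inv1]
    have h1 := CMat2.one_add_smul_initErr (hn ζ hζ z hz)
    simp only [kam, smul_zero, neg_zero, h0, add_zero, mul_one, one_mul]
    rw [h1]

/-- The linear equation is solved with loss `ρ₀ / 4 · 2^{-n}`, so that its solution has size `y
2^{-n}`. All quantities then stay below `τ`, which keeps the Cayley transforms regular, and the
smallness condition `hτθ` makes the new error at most `kamRate ν` times the old one. The two
increment bounds give convergence of the conjugacies and counterterms. -/
theorem kamInv_succ {n : ℕ} {g : (Fin 2 → ℂ) → KamState d}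
    (hg : KamInv ω c c' ν ρ₀ H₀ U χ t f n g) :
    KamInv ω c c' ν ρ₀ H₀ U χ t f (n + 1)
        (fun ζ => kamStep (kamRadius ρ₀ (n + 1)) ω c C S (χ ζ) (t ζ) (g ζ)) ∧
      (∀ ζ ∈ U, ∀ z ∈ strip d (kamRadius ρ₀ (n + 1)),
        ‖(kamStep (kamRadius ρ₀ (n + 1)) ω c C S (χ ζ) (t ζ) (g ζ)).conj z - (g ζ).conj z‖
          ≤ 2 * kamY c c' ν ρ₀ H₀ * (1 / 2) ^ n) ∧
      ∀ ζ ∈ U, ‖(kamStep (kamRadius ρ₀ (n + 1)) ω c C S (χ ζ) (t ζ) (g ζ)).counter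
          - (g ζ).counter‖ ≤ kamQ c c' ν ρ₀ * H₀ * (1 / 2) ^ n := by
  set σ := kamRadius ρ₀ (n + 1) with hσ
  set q : ℝ := (1 / 2) ^ n with hq
  set H := H₀ * kamRate ν ^ n with hH
  set Q := kamQ c c' ν ρ₀ with hQ
  set y := kamY c c' ν ρ₀ H₀ with hy
  set τ := kamTau c c' ν ρ₀ H₀ with hτ
  have hρ₀ := hyp.hρ₀
  have hq0 : 0 < q := by positivity
  have hq1 : q ≤ 1 := half_pow_le_one n
  have hr : 0 < ρ₀ / 4 * q := by positivity
  have hr2 : ρ₀ / 4 * q ≤ ρ₀ / 2 := by nlinarith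
  have hρ : 0 < kamRadius ρ₀ n := by linarith [half_lt_kamRadius hρ₀ n]
  have hσ0 : 0 < σ := by linarith [half_lt_kamRadius hρ₀ (n + 1)]
  have hsub : kamRadius ρ₀ n - ρ₀ / 4 * q = σ := kamRadius_sub n
  have hrρ : ρ₀ / 4 * q < kamRadius ρ₀ n := by linarith
  have hσρ : σ ≤ kamRadius ρ₀ n := by linarith
  have hmono : strip d σ ⊆ strip d (kamRadius ρ₀ n) := strip_mono hσρ
  have hQ2 := hyp.two_le_kamQ
  have hy0 := hyp.kamY_nonneg
  have hH₀ := hyp.hH₀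
  obtain ⟨hθ0, hθ1⟩ := kamRate_le hyp.hν
  have hHq : H ≤ H₀ * q := by
    have : kamRate ν ^ n ≤ (1 / 2) ^ n := pow_le_pow_left₀ hθ0.le hθ1 n
    exact mul_le_mul_of_nonneg_left this hH₀
  have hH0 : 0 ≤ H := mul_nonneg hH₀ (pow_nonneg hθ0.le n)
  obtain ⟨Yf, Yt⟩ := scaledSol_family hρ₀ hyp.adm hyp.hc' hρ (kamRadius_le hρ₀ n) hyp.hν hr hrρ hr2
    hyp.hU hg.err hyp.ht hyp.ht2
  rw [hsub] at Yf Yt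
  obtain ⟨ηd, ηb⟩ := counterTerm_family hρ₀ hyp.adm hyp.hc' hρ hσ0 hyp.hU hg.err
  -- The error decay compensates the small divisor loss exactly up to `q`; `kamY` is defined as the
  -- resulting prefactor.
  have hYb : 120 * (coefBound c c' / (ρ₀ / 4 * q) ^ ν) * H = y * q := by
    have := kamRate_pow_div (ν := ν) hρ₀ n
    rw [hH, hy, kamY]
    calc _ = 120 * coefBound c c' * H₀ * (kamRate ν ^ n / (ρ₀ / 4 * q) ^ ν) := by ring
      _ = _ := by rw [hq, this]; ring
  rw [hYb] at Yf
  set Y : (Fin 2 → ℂ) → (Fin d → ℂ) → CMat2 :=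
    fun ζ => scaledSol σ ω c C S (t ζ) (g ζ).err with hYd
  set η : (Fin 2 → ℂ) → CMat2 := fun ζ => counterTerm σ C (g ζ).err with hηd
  have sb : ∀ ζ ∈ U, ∀ z ∈ strip d σ, _ := fun ζ hζ z hz =>
    CMat2.step_bounds (χ := χ ζ) (t := t ζ) (U := (g ζ).conj z) (κ := (g ζ).counter)
      (h := (g ζ).err z) (η := η ζ) (Y := Y ζ z) (H := H) (H₀ := H₀) (y := y) (Q := Q) (q := q)
      (τ := τ) (hyp.hχ2 ζ hζ) (hyp.ht2 ζ hζ) hq0.le hq1 hH₀ hy0 hQ2 rfl hyp.hτ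
      (hg.conj.bound ζ hζ z (hmono hz)) (hg.norm_counter ζ hζ) (hg.err.bound ζ hζ z (hmono hz)) hHq
      ((ηb ζ hζ).1.trans (le_of_eq (by rw [hQ, kamQ]; ring))) (Yt ζ hζ z hz)
      (Yf.bound ζ hζ z hz) rfl
  set P : (Fin 2 → ℂ) → (Fin d → ℂ) → CMat2 := fun ζ z =>
    (g ζ).err z - (((g ζ).err z).trace / 2) • (1 : CMat2) - η ζ with hPd
  have Pt : ∀ ζ ∈ U, ∀ z, (P ζ z).trace = 0 := fun ζ hζ z =>
    CMat2.trace_traceless_sub (ηb ζ hζ).2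
  have tr1 : ∀ (a : ℂ) (N : CMat2), N.trace = 0 → (a • N).trace = 0 := fun a N hN => by
    rw [Matrix.trace_smul, hN, smul_zero]
  have tr2 : ∀ (N N' : CMat2), N.trace = 0 → N'.trace = 0 → (N + N').trace = 0 :=
    fun N N' hN hN' => by rw [Matrix.trace_add, hN, hN', add_zero]
  have nz : ∀ {a : CMat2}, a.trace = 0 → ‖a‖ ≤ τ → 1 + a.det ≠ 0 := fun ha h =>
    CMat2.one_add_det_ne_zero ha h hyp.hτ
  have d1 : ∀ ζ ∈ U, ∀ z ∈ strip d σ, 1 + ((χ ζ * t ζ / 2) • (g ζ).counter).det ≠ 0 :=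
    fun ζ hζ z hz => nz (tr1 _ _ (hg.trace_counter ζ hζ)) (sb ζ hζ z hz).2.2.2.2.1
  have d2 : ∀ ζ ∈ U, ∀ z ∈ strip d σ, 1 + ((χ ζ * t ζ / 2) • ((g ζ).counter + η ζ)).det ≠ 0 :=
    fun ζ hζ z hz => nz (tr1 _ _ (tr2 _ _ (hg.trace_counter ζ hζ) (ηb ζ hζ).2))
      (sb ζ hζ z hz).2.2.2.2.2.1
  have d3 : ∀ ζ ∈ U, ∀ z ∈ strip d σ, 1 + ((χ ζ / 2) • Y ζ z).det ≠ 0 :=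
    fun ζ hζ z hz => nz (tr1 _ _ (Yt ζ hζ z hz)) (sb ζ hζ z hz).2.2.1
  have d4 : ∀ ζ ∈ U, ∀ z ∈ strip d σ,
      1 + ((χ ζ / 2) • Y ζ z + (χ ζ * t ζ / 2) • P ζ z).det ≠ 0 :=
    fun ζ hζ z hz => nz (tr2 _ _ (tr1 _ _ (Yt ζ hζ z hz)) (tr1 _ _ (Pt ζ hζ z)))
      (sb ζ hζ z hz).2.2.2.1
  have hχp := differentiableOn_comp_fst (d := d) hyp.hχ σ
  have htp := differentiableOn_comp_fst (d := d) hyp.ht σ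
  have hκp : DifferentiableOn ℂ (fun p : (Fin 2 → ℂ) × (Fin d → ℂ) => (g p.1).counter)
    (U ×ˢ strip d σ) := hg.counter.comp (f := Prod.fst) (by fun_prop) fun _ hp => hp.1
  have hηp : DifferentiableOn ℂ (fun p : (Fin 2 → ℂ) × (Fin d → ℂ) => η p.1)
    (U ×ˢ strip d σ) := ηd.comp (f := Prod.fst) (by fun_prop) fun _ hp => hp.1
  have hed := hg.err.diff.mono (prod_mono_right (s := U) hmono)
  have hUd := hg.conj.diff.mono (prod_mono_right (s := U) hmono)
  have hχ2p : DifferentiableOn ℂ (fun p : (Fin 2 → ℂ) × (Fin d → ℂ) => χ p.1 / 2)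
    (U ×ˢ strip d σ) := by simp only [div_eq_mul_inv]; exact hχp.mul_const _
  have hi := (hχ2p.smul Yf.diff).inv1 fun p hp => d3 p.1 hp.1 p.2 hp.2
  have hR := Yf.diff.mul hi
  have htrp : DifferentiableOn ℂ (fun p : (Fin 2 → ℂ) × (Fin d → ℂ) =>
      (((g p.1).err p.2).trace / 2) • (1 : CMat2)) (U ×ˢ strip d σ) := by
    simp only [div_eq_mul_inv]
    exact (hed.mtrace.mul_const (2 : ℂ)⁻¹).smul_const (1 : CMat2)
  have hPp : DifferentiableOn ℂ (fun p : (Fin 2 → ℂ) × (Fin d → ℂ) => P p.1 p.2)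
    (U ×ˢ strip d σ) := (hed.sub htrp).sub hηp
  have hZp : DifferentiableOn ℂ (fun p : (Fin 2 → ℂ) × (Fin d → ℂ) =>
    1 + χ p.1 • (g p.1).conj p.2) (U ×ˢ strip d σ) := (hχp.smul hUd).const_add 1
  have hconj : ∀ ζ ∈ U, ∀ z ∈ strip d σ,
      1 + χ ζ • (kamStep σ ω c C S (χ ζ) (t ζ) (g ζ)).conj z
        = (1 + χ ζ • (g ζ).conj z) * CMat2.cay ((χ ζ / 2) • Y ζ z) := by
    intro ζ hζ z hz
    rw [← CMat2.one_add_smul_mul_inv1 (Yt ζ hζ z hz) (d3 ζ hζ z hz)]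
    change 1 + χ ζ • ((g ζ).conj z + (Y ζ z * CMat2.inv1 ((χ ζ / 2) • Y ζ z)
      + χ ζ • ((g ζ).conj z * (Y ζ z * CMat2.inv1 ((χ ζ / 2) • Y ζ z))))) = _
    set R := Y ζ z * CMat2.inv1 ((χ ζ / 2) • Y ζ z)
    rw [add_mul, one_mul, mul_add, mul_one, smul_mul_smul_comm, smul_add, smul_add, smul_smul]
    abel
  have hpow : 1 - q / 2 = 1 - (1 / 2) ^ (n + 1) := by rw [hq, pow_succ]; ring
  have hincr : ∀ ζ ∈ U, ∀ z ∈ strip d σ,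
      ‖(kamStep σ ω c C S (χ ζ) (t ζ) (g ζ)).conj z - (g ζ).conj z‖ ≤ 2 * y * q := by
    intro ζ hζ z hz
    refine (le_of_eq ?_).trans (sb ζ hζ z hz).2.2.2.2.2.2.2
    congr 1
    exact add_sub_cancel_left _ _
  refine ⟨⟨⟨?_, fun ζ hζ z hz => ?_, fun ζ hζ z hz k => ?_⟩,
    ⟨?_, fun ζ hζ z hz => ?_, fun ζ hζ z hz k => ?_⟩, hg.counter.add ηd, fun ζ hζ => ?_,
    fun ζ hζ => tr2 _ _ (hg.trace_counter ζ hζ) (ηb ζ hζ).2, fun ζ hζ z hz => ?_,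
    fun ζ hζ z hz => ?_, fun ζ hζ z hz => ?_⟩, hincr, fun ζ hζ => ?_⟩
  · exact DifferentiableOn.errStep hχp (hχp.mul htp) hZp hκp hed hηp Yf.diff hPp
      (fun p hp => d1 p.1 hp.1 p.2 hp.2) (fun p hp => d2 p.1 hp.1 p.2 hp.2)
      (fun p hp => d3 p.1 hp.1 p.2 hp.2) (fun p hp => d4 p.1 hp.1 p.2 hp.2)
  · obtain ⟨s1, s2, s3, s4, s5, s6, -, -⟩ := sb ζ hζ z hz
    have hs : ‖χ ζ * t ζ‖ ≤ 4 := by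
      rw [norm_mul]
      nlinarith [hyp.hχ2 ζ hζ, hyp.ht2 ζ hζ, norm_nonneg (χ ζ), norm_nonneg (t ζ)]
    have hHτ : H ≤ τ := by
      rw [hτ, kamTau]
      nlinarith
    have := CMat2.norm_errStep_le (Yt ζ hζ z hz) (Pt ζ hζ z) hyp.hτ (by linarith) hs
      (hg.trace_counter ζ hζ) (ηb ζ hζ).2 (hg.unimod ζ hζ z (hmono hz))
      (hg.err.bound ζ hζ z (hmono hz)) hHτ
      ((ηb ζ hζ).1.trans (by rw [hQ, kamQ]; nlinarith)) rfl s1 s2 s3 s4 s5 s6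
    refine this.trans ?_
    have h3 := mul_le_mul_of_nonneg_right hyp.hτθ hH0
    rw [pow_succ]
    linarith
  · simp only [kamStep]
    rw [hg.conj.per ζ hζ z (hmono hz) k, hg.err.per ζ hζ z (hmono hz) k]
    have := Yf.per ζ hζ z hz k
    simp only [hYd] at this
    rw [this]
  · exact hUd.add (hR.add (hχp.smul (hUd.mul hR)))
  · have h1 := hincr ζ hζ z hz
    have h2 := hg.conj.bound ζ hζ z (hmono hz)
    have h3 := norm_add_le ((kamStep σ ω c C S (χ ζ) (t ζ) (g ζ)).conj z - (g ζ).conj z)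
      ((g ζ).conj z)
    rw [sub_add_cancel] at h3
    rw [← hpow]
    linarith
  · simp only [kamStep]
    rw [hg.conj.per ζ hζ z (hmono hz) k]
    have := Yf.per ζ hζ z hz k
    simp only [hYd] at this
    rw [this]
  · rw [← hpow]
    exact (sb ζ hζ 0 (mem_strip_zero hσ0)).2.2.2.2.2.2.1
  · have := (hg.unimod_conj ζ hζ z (hmono hz)).comp
      (CMat2.unimod_mul_inv1 (Yt ζ hζ z hz))
    rw [add_assoc] at this
    exact this
  · exact CMat2.unimod_errStep (Yt ζ hζ z hz) (Pt ζ hζ z) (d3 ζ hζ z hz) (d4 ζ hζ z hz)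
      (hg.det_conj hζ (hmono hz)) (hg.trace_counter ζ hζ) (ηb ζ hζ).2 (d1 ζ hζ z hz)
      (d2 ζ hζ z hz) (hg.unimod ζ hζ z (hmono hz))
  · have hz' := add_toC_mem_strip hz ω
    rw [hconj ζ hζ z hz, hconj ζ hζ _ hz']
    refine CMat2.conjugacy_step (hg.det_conj hζ (hmono hz)) (det_one_add_nilpotent (t ζ))
      (hg.trace_counter ζ hζ) (ηb ζ hζ).2 (Yt ζ hζ z hz) (Pt ζ hζ z) (d1 ζ hζ z hz)
      (d2 ζ hζ z hz) (d3 ζ hζ z hz) (d4 ζ hζ z hz) ?_ (hg.conjugacy ζ hζ z (hmono hz))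
    have hz2 : z ∈ strip d (kamRadius ρ₀ n - ρ₀ / 4 * q) := by rw [hsub]; exact hz
    have := scaledSol_eq hρ₀ hyp.adm hyp.hc' hρ (kamRadius_le hρ₀ n) hyp.hν hr hrρ hr2
      (hg.err.single hζ) (t ζ) hz2
    rw [hsub] at this
    -- Factoring out `χ / 2` exhibits the combination `Y + t P` that the scaled homological equation
    -- transports.
    have e : (χ ζ / 2) • Y ζ z + (χ ζ * t ζ / 2) • P ζ z
        = (χ ζ / 2) • (Y ζ z + t ζ • P ζ z) := by
      rw [smul_add, smul_smul]; congr 2; ring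
    rw [e, mul_smul_comm, smul_mul_assoc]
    exact congrArg _ this
  · have h1 : (kamStep σ ω c C S (χ ζ) (t ζ) (g ζ)).counter - (g ζ).counter = η ζ :=
      add_sub_cancel_left _ _
    rw [h1]
    refine (ηb ζ hζ).1.trans ?_
    have : 384 * projBound c c' ν ρ₀ ≤ Q := by rw [hQ, kamQ]; linarith
    rw [mul_assoc Q]
    exact mul_le_mul this hHq hH0 (by linarith)

end KamHyp

end Iteration

/-! ### Limits of matrix expressions and geometric sequences. -/

namespace CMat2

variable {α : Type*} {l : Filter α} {F : α → CMat2} {M : CMat2}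

theorem tendsto_entry (h : Tendsto F l (𝓝 M)) (i j : Fin 2) :
    Tendsto (fun x => F x i j) l (𝓝 (M i j)) :=
  ((entryCLM i j).continuous.tendsto M).comp h

theorem tendsto_det (h : Tendsto F l (𝓝 M)) : Tendsto (fun x => (F x).det) l (𝓝 M.det) := by
  simp only [Matrix.det_fin_two]
  exact ((tendsto_entry h 0 0).mul (tendsto_entry h 1 1)).sub
    ((tendsto_entry h 0 1).mul (tendsto_entry h 1 0))

theorem tendsto_trace (h : Tendsto F l (𝓝 M)) : Tendsto (fun x => (F x).trace) l (𝓝 M.trace) := by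
  simp only [Matrix.trace_fin_two]
  exact (tendsto_entry h 0 0).add (tendsto_entry h 1 1)

theorem tendsto_cay (h : Tendsto F l (𝓝 M)) (hM : 1 + M.det ≠ 0) :
    Tendsto (fun x => cay (F x)) l (𝓝 (cay M)) := by
  have h1 : Tendsto (fun x => 1 + F x) l (𝓝 (1 + M)) := h.const_add 1
  exact h1.mul ((((tendsto_det h).const_add 1).inv₀ hM).smul h1)

end CMat2

theorem tendsto_limUnder_of_geometric {E : Type*} [NormedAddCommGroup E] [CompleteSpace E]
    [Nonempty E] {u : ℕ → E} {B : ℝ} (h : ∀ n, ‖u (n + 1) - u n‖ ≤ B * (1 / 2) ^ n) :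
    Tendsto u atTop (𝓝 (limUnder atTop u)) ∧
      ∀ n, ‖u n - limUnder atTop u‖ ≤ 2 * B * (1 / 2) ^ n := by
  have h' : ∀ n, dist (u n) (u (n + 1)) ≤ B * (1 / 2) ^ n := fun n => by
    rw [dist_comm, dist_eq_norm]; exact h n
  have hl := (cauchySeq_of_le_geometric (1 / 2) B (by norm_num) h').tendsto_limUnder
  refine ⟨hl, fun n => ?_⟩
  have := dist_le_of_le_geometric_of_tendsto (1 / 2) B (by norm_num) h' hl n
  rw [dist_eq_norm] at this
  refine this.trans (le_of_eq ?_)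
  ring

theorem tendsto_const_mul_half_pow (B : ℝ) : Tendsto (fun n : ℕ => B * (1 / 2 : ℝ) ^ n) atTop (𝓝 0) := by
  simpa using (tendsto_pow_atTop_nhds_zero_of_lt_one (r := (1 / 2 : ℝ)) (by norm_num)
    (by norm_num)).const_mul B

/-! ### The limit conjugacy and counterterm; reality. -/

section Limit

variable {d : ℕ} {ω : Fin d → ℝ} {c c' ν ρ₀ H₀ : ℝ} {C S : SL2Alg →ₗ[ℝ] SL2Alg}
  {U : Set (Fin 2 → ℂ)} {χ t : (Fin 2 → ℂ) → ℂ} {f : (Fin 2 → ℂ) → (Fin d → ℂ) → CMat2}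

/-- The limit of the conjugacies. -/
noncomputable def kamConj (ρ₀ : ℝ) (ω : Fin d → ℝ) (c : ℝ) (C S : SL2Alg →ₗ[ℝ] SL2Alg) (χ t : ℂ)
    (f : (Fin d → ℂ) → CMat2) (z : Fin d → ℂ) : CMat2 :=
  limUnder atTop fun n => (kam ρ₀ ω c C S χ t f n).conj z

/-- The limit of the counterterms. -/
noncomputable def kamCounter (ρ₀ : ℝ) (ω : Fin d → ℝ) (c : ℝ) (C S : SL2Alg →ₗ[ℝ] SL2Alg)
    (χ t : ℂ) (f : (Fin d → ℂ) → CMat2) : CMat2 :=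
  limUnder atTop fun n => (kam ρ₀ ω c C S χ t f n).counter

namespace KamHyp

variable (hyp : KamHyp ω c c' ν ρ₀ H₀ C S U χ t f)
include hyp

theorem kamInv (n : ℕ) : KamInv ω c c' ν ρ₀ H₀ U χ t f n
    (fun ζ => kam ρ₀ ω c C S (χ ζ) (t ζ) (f ζ) n) := by
  induction n with
  | zero => exact hyp.kamInv_zero
  | succ n ih => exact (hyp.kamInv_succ ih).1

theorem strip_half_subset (n : ℕ) : strip d (ρ₀ / 2) ⊆ strip d (kamRadius ρ₀ n) :=
  strip_mono (half_lt_kamRadius hyp.hρ₀ n).le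

theorem tendsto_conj {ζ : Fin 2 → ℂ} (hζ : ζ ∈ U) {z : Fin d → ℂ} (hz : z ∈ strip d (ρ₀ / 2)) :
    Tendsto (fun n => (kam ρ₀ ω c C S (χ ζ) (t ζ) (f ζ) n).conj z) atTop
        (𝓝 (kamConj ρ₀ ω c C S (χ ζ) (t ζ) (f ζ) z)) ∧
      ∀ n, ‖(kam ρ₀ ω c C S (χ ζ) (t ζ) (f ζ) n).conj z
        - kamConj ρ₀ ω c C S (χ ζ) (t ζ) (f ζ) z‖
          ≤ 2 * (2 * kamY c c' ν ρ₀ H₀) * (1 / 2) ^ n :=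
  tendsto_limUnder_of_geometric fun n =>
    (hyp.kamInv_succ (hyp.kamInv n)).2.1 ζ hζ z (hyp.strip_half_subset (n + 1) hz)

theorem tendsto_counter {ζ : Fin 2 → ℂ} (hζ : ζ ∈ U) :
    Tendsto (fun n => (kam ρ₀ ω c C S (χ ζ) (t ζ) (f ζ) n).counter) atTop
        (𝓝 (kamCounter ρ₀ ω c C S (χ ζ) (t ζ) (f ζ))) ∧
      ∀ n, ‖(kam ρ₀ ω c C S (χ ζ) (t ζ) (f ζ) n).counter
        - kamCounter ρ₀ ω c C S (χ ζ) (t ζ) (f ζ)‖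
          ≤ 2 * (kamQ c c' ν ρ₀ * H₀) * (1 / 2) ^ n :=
  tendsto_limUnder_of_geometric fun n => (hyp.kamInv_succ (hyp.kamInv n)).2.2 ζ hζ

theorem tendsto_err {ζ : Fin 2 → ℂ} (hζ : ζ ∈ U) {z : Fin d → ℂ} (hz : z ∈ strip d (ρ₀ / 2)) :
    Tendsto (fun n => (kam ρ₀ ω c C S (χ ζ) (t ζ) (f ζ) n).err z) atTop (𝓝 0) := by
  refine squeeze_zero_norm (a := fun n => H₀ * kamRate ν ^ n)
    (fun n => (hyp.kamInv n).err.bound ζ hζ z (hyp.strip_half_subset n hz)) ?_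
  obtain ⟨h0, h1⟩ := kamRate_le hyp.hν
  simpa using (tendsto_pow_atTop_nhds_zero_of_lt_one h0.le (by linarith)).const_mul H₀

theorem conj_family : FH U (ρ₀ / 2) (4 * kamY c c' ν ρ₀ H₀)
    (fun ζ => kamConj ρ₀ ω c C S (χ ζ) (t ζ) (f ζ)) where
  diff := differentiableOn_of_uniform_limit (hyp.hU.prod (isOpen_strip d _))
    (fun n => (hyp.kamInv n).conj.diff.mono (prod_mono_right (hyp.strip_half_subset n)))
    (tendsto_const_mul_half_pow _) fun n p hp => (hyp.tendsto_conj hp.1 hp.2).2 n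
  bound := fun ζ hζ z hz => by
    refine le_of_tendsto (hyp.tendsto_conj hζ hz).1.norm (Eventually.of_forall fun n => ?_)
    refine ((hyp.kamInv n).conj.bound ζ hζ z (hyp.strip_half_subset n hz)).trans ?_
    have h1 : (0 : ℝ) < (1 / 2) ^ n := by positivity
    nlinarith [hyp.kamY_nonneg]
  per := fun ζ hζ z hz k => by
    simp only [kamConj]
    congr 1
    funext n
    exact (hyp.kamInv n).conj.per ζ hζ z (hyp.strip_half_subset n hz) k

theorem differentiableOn_counter :
    DifferentiableOn ℂ (fun ζ => kamCounter ρ₀ ω c C S (χ ζ) (t ζ) (f ζ)) U :=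
  differentiableOn_of_uniform_limit hyp.hU (fun n => (hyp.kamInv n).counter)
    (tendsto_const_mul_half_pow _) fun n _ hζ => (hyp.tendsto_counter hζ).2 n

theorem norm_counter_le {ζ : Fin 2 → ℂ} (hζ : ζ ∈ U) :
    ‖kamCounter ρ₀ ω c C S (χ ζ) (t ζ) (f ζ)‖ ≤ 2 * kamQ c c' ν ρ₀ * H₀ := by
  refine le_of_tendsto (hyp.tendsto_counter hζ).1.norm (Eventually.of_forall fun n => ?_)
  refine ((hyp.kamInv n).norm_counter ζ hζ).trans ?_
  have h1 : (0 : ℝ) < (1 / 2) ^ n := by positivity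
  have h2 : 0 ≤ kamQ c c' ν ρ₀ * H₀ := mul_nonneg (by linarith [hyp.two_le_kamQ]) hyp.hH₀
  nlinarith

theorem trace_counter {ζ : Fin 2 → ℂ} (hζ : ζ ∈ U) :
    (kamCounter ρ₀ ω c C S (χ ζ) (t ζ) (f ζ)).trace = 0 := by
  have h := CMat2.tendsto_trace (hyp.tendsto_counter hζ).1
  simp only [fun n => (hyp.kamInv n).trace_counter ζ hζ] at h
  exact tendsto_nhds_unique h tendsto_const_nhds

theorem norm_smul_counter_le {ζ : Fin 2 → ℂ} (hζ : ζ ∈ U) :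
    ‖(χ ζ * t ζ / 2) • kamCounter ρ₀ ω c C S (χ ζ) (t ζ) (f ζ)‖ ≤ kamTau c c' ν ρ₀ H₀ := by
  have hs : ‖χ ζ * t ζ‖ ≤ 2 * 2 := by
    rw [norm_mul]
    exact mul_le_mul (hyp.hχ2 ζ hζ) (hyp.ht2 ζ hζ) (norm_nonneg _) (by norm_num)
  have := CMat2.norm_smul_half_le hs (hyp.norm_counter_le hζ)
  have h2 := hyp.kamY_nonneg
  rw [kamTau]
  linarith

theorem unimod_conj {ζ : Fin 2 → ℂ} (hζ : ζ ∈ U) {z : Fin d → ℂ} (hz : z ∈ strip d (ρ₀ / 2)) :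
    CMat2.Unimod (χ ζ) (kamConj ρ₀ ω c C S (χ ζ) (t ζ) (f ζ) z) := by
  have h0 := (hyp.tendsto_conj hζ hz).1
  have h := (CMat2.tendsto_trace h0).add ((CMat2.tendsto_det h0).const_mul (χ ζ))
  have h1 : ∀ n, ((kam ρ₀ ω c C S (χ ζ) (t ζ) (f ζ) n).conj z).trace
      + χ ζ * ((kam ρ₀ ω c C S (χ ζ) (t ζ) (f ζ) n).conj z).det = 0 :=
    fun n => (hyp.kamInv n).unimod_conj ζ hζ z (hyp.strip_half_subset n hz)
  simp only [h1] at h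
  exact tendsto_nhds_unique h tendsto_const_nhds

theorem conjugacy {ζ : Fin 2 → ℂ} (hζ : ζ ∈ U) {z : Fin d → ℂ} (hz : z ∈ strip d (ρ₀ / 2)) :
    (1 + t ζ • CMat2.ofRealM (nilpotentA c : Mat2))
        * (NormedSpace.exp ((χ ζ * t ζ) • f ζ z)
          * CMat2.cay (-((χ ζ * t ζ / 2) • kamCounter ρ₀ ω c C S (χ ζ) (t ζ) (f ζ)))
          * (1 + χ ζ • kamConj ρ₀ ω c C S (χ ζ) (t ζ) (f ζ) z))
      = (1 + χ ζ • kamConj ρ₀ ω c C S (χ ζ) (t ζ) (f ζ) (z + toC ω))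
        * (1 + t ζ • CMat2.ofRealM (nilpotentA c : Mat2)) := by
  have hc := ((hyp.tendsto_counter hζ).1.const_smul (χ ζ * t ζ / 2)).neg
  -- The limit counterterm still obeys the bound by `kamTau`, so the Cayley transform is continuous
  -- there and the invariant passes to the limit with the error gone.
  have hd : 1 + (-((χ ζ * t ζ / 2) • kamCounter ρ₀ ω c C S (χ ζ) (t ζ) (f ζ))).det ≠ 0 := by
    refine CMat2.one_add_det_ne_zero ?_ (τ := kamTau c c' ν ρ₀ H₀) ?_ hyp.hτ
    · rw [Matrix.trace_neg, Matrix.trace_smul, hyp.trace_counter hζ, smul_zero, neg_zero]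
    · rw [norm_neg]
      exact hyp.norm_smul_counter_le hζ
  have hcay := CMat2.tendsto_cay hc hd
  have hz' := add_toC_mem_strip hz ω
  have hU := ((hyp.tendsto_conj hζ hz).1.const_smul (χ ζ)).const_add 1
  have hU' := ((hyp.tendsto_conj hζ hz').1.const_smul (χ ζ)).const_add 1
  have he := ((hyp.tendsto_err hζ hz).const_smul (χ ζ * t ζ)).const_add 1
  have hl := ((hcay.const_mul (NormedSpace.exp ((χ ζ * t ζ) • f ζ z))).mul hU).const_mul
    (1 + t ζ • CMat2.ofRealM (nilpotentA c : Mat2))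
  have hr := (hU'.mul_const (1 + t ζ • CMat2.ofRealM (nilpotentA c : Mat2))).mul he
  simp only [fun n => (hyp.kamInv n).conjugacy ζ hζ z (hyp.strip_half_subset n hz)] at hl
  rw [smul_zero, add_zero, mul_one] at hr
  exact tendsto_nhds_unique hl hr

/-- Besides reality, the induction keeps the counterterm in the fixed space of `C`: it starts at
zero and every increment is `C` of a mean value, which `C` fixes because `C² = C`. -/
theorem kam_real {ζ : Fin 2 → ℂ} (hζ : ζ ∈ U) (hχ : (χ ζ).im = 0) (ht : (t ζ).im = 0)
    (hf : ∀ x, f ζ (toC x) ∈ CMat2.realM) (n : ℕ) :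
    (∀ x, (kam ρ₀ ω c C S (χ ζ) (t ζ) (f ζ) n).conj (toC x) ∈ CMat2.realM) ∧
      (∀ x, (kam ρ₀ ω c C S (χ ζ) (t ζ) (f ζ) n).err (toC x) ∈ CMat2.realM) ∧
      ∃ y : SL2Alg, C y = y ∧
        CMat2.ofRealM (y : Mat2) = (kam ρ₀ ω c C S (χ ζ) (t ζ) (f ζ) n).counter := by
  have hρ₀ := hyp.hρ₀
  have hs : (χ ζ * t ζ).im = 0 := CMat2.im_mul_eq_zero hχ ht
  induction n with
  | zero =>
    refine ⟨fun x => CMat2.realM.zero_mem, fun x => CMat2.initErr_mem hs (hf x), 0, map_zero _, ?_⟩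
    exact map_zero _
  | succ n ih =>
    obtain ⟨i1, i2, y, hy, hyc⟩ := ih
    have inv := hyp.kamInv n
    have hρ : 0 < kamRadius ρ₀ n := by linarith [half_lt_kamRadius hρ₀ n]
    have hσ : 0 < kamRadius ρ₀ (n + 1) := by linarith [half_lt_kamRadius hρ₀ (n + 1)]
    have hq0 : (0 : ℝ) < (1 / 2) ^ n := by positivity
    have hq1 := half_pow_le_one n
    have hr : 0 < ρ₀ / 4 * (1 / 2) ^ n := by positivity
    have hsub := kamRadius_sub (ρ₀ := ρ₀) n
    have hY := fun x => scaledSol_real hρ₀ hyp.adm hyp.hc' hρ (kamRadius_le hρ₀ n) hyp.hν hr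
      (by linarith) (by nlinarith) (inv.err.single hζ) ht i2 x
    rw [hsub] at hY
    have hη := counterTerm_real hρ₀ hyp.adm hyp.hc' hρ hσ (inv.err.single hζ) i2
    have hη' : counterTerm (kamRadius ρ₀ (n + 1)) C (kam ρ₀ ω c C S (χ ζ) (t ζ) (f ζ) n).err
      ∈ CMat2.realM := by rw [hη]; exact CMat2.ofRealM_mem _
    have hκ : (kam ρ₀ ω c C S (χ ζ) (t ζ) (f ζ) n).counter ∈ CMat2.realM := by
      rw [← hyc]; exact CMat2.ofRealM_mem _
    have hZ : ∀ x, 1 + χ ζ • (kam ρ₀ ω c C S (χ ζ) (t ζ) (f ζ) n).conj (toC x) ∈ CMat2.realM :=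
      fun x => CMat2.realM.add_mem CMat2.realM.one_mem (CMat2.smul_mem_realM hχ (i1 x))
    have hR : ∀ x, _ := fun x => CMat2.realM.mul_mem (hY x)
      (CMat2.inv1_mem (CMat2.smul_mem_realM (CMat2.im_div_two_eq_zero hχ) (hY x)))
    refine ⟨fun x => ?_, fun x => ?_, y + C (torusMean 1
      (reP (kam ρ₀ ω c C S (χ ζ) (t ζ) (f ζ) n).err)), ?_, ?_⟩
    · exact CMat2.realM.add_mem (i1 x) (CMat2.realM.add_mem (hR x)
        (CMat2.smul_mem_realM hχ (CMat2.realM.mul_mem (i1 x) (hR x))))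
    · refine CMat2.errStep_mem hχ hs (hZ x) hκ (i2 x) hη' (hY x) ?_
      exact CMat2.realM.sub_mem (CMat2.realM.sub_mem (i2 x)
        (CMat2.smul_mem_realM (CMat2.im_div_two_eq_zero (CMat2.trace_im_eq_zero (i2 x)))
          CMat2.realM.one_mem)) hη'
    · rw [map_add, hy, hyp.adm.1]
    · change _ = (kam ρ₀ ω c C S (χ ζ) (t ζ) (f ζ) n).counter
        + counterTerm (kamRadius ρ₀ (n + 1)) C (kam ρ₀ ω c C S (χ ζ) (t ζ) (f ζ) n).err
      rw [hη, ← hyc]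
      exact map_add CMat2.ofRealM _ _

theorem conj_real {ζ : Fin 2 → ℂ} (hζ : ζ ∈ U) (hχ : (χ ζ).im = 0) (ht : (t ζ).im = 0)
    (hf : ∀ x, f ζ (toC x) ∈ CMat2.realM) (x : Fin d → ℝ) :
    kamConj ρ₀ ω c C S (χ ζ) (t ζ) (f ζ) (toC x) ∈ CMat2.realM :=
  CMat2.isClosed_realM.mem_of_tendsto
    (hyp.tendsto_conj hζ (toC_mem_strip (half_pos hyp.hρ₀) x)).1
    (Eventually.of_forall fun n => (hyp.kam_real hζ hχ ht hf n).1 x)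

/-- The image of the fixed space of `C` is a finite-dimensional real subspace, hence closed, so it
contains the limit of the counterterms. -/
theorem counter_real {ζ : Fin 2 → ℂ} (hζ : ζ ∈ U) (hχ : (χ ζ).im = 0) (ht : (t ζ).im = 0)
    (hf : ∀ x, f ζ (toC x) ∈ CMat2.realM) :
    ∃ y : SL2Alg, C y = y ∧
      CMat2.ofRealM (y : Mat2) = kamCounter ρ₀ ω c C S (χ ζ) (t ζ) (f ζ) := by
  let L : SL2Alg →ₗ[ℝ] CMat2 :=
    { toFun := fun y => CMat2.ofRealM (y : Mat2)
      map_add' := fun X Y => map_add CMat2.ofRealM (X : Mat2) (Y : Mat2)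
      map_smul' := fun k X => map_smul CMat2.ofRealM k (X : Mat2) }
  set V : Submodule ℝ CMat2 := (LinearMap.ker (C - LinearMap.id)).map L with hV
  have hmem : ∀ M : CMat2, M ∈ V ↔ ∃ y : SL2Alg, C y = y ∧ CMat2.ofRealM (y : Mat2) = M := by
    intro M
    rw [hV, Submodule.mem_map]
    refine exists_congr fun y => and_congr ?_ Iff.rfl
    rw [LinearMap.mem_ker, LinearMap.sub_apply, LinearMap.id_apply, sub_eq_zero]
  rw [← hmem]
  exact (Submodule.closed_of_finiteDimensional V).mem_of_tendsto (hyp.tendsto_counter hζ).1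
    (Eventually.of_forall fun n => (hmem _).2 (hyp.kam_real hζ hχ ht hf n).2.2)

end KamHyp

end Limit

/-! ### From `1 + χ U` to `e^{χ X}`. -/

namespace CMat2

/-- The trace-zero matrix `V` with `cay ((χ / 2) V) = 1 + χ U`. -/
noncomputable def cayInv (χ : ℂ) (U : CMat2) : CMat2 :=
  (1 + χ * U.trace / 4)⁻¹ • (U - (U.trace / 2) • (1 : CMat2))

/-- The matrix `X` with `exp (χ X) = cay ((χ / 2) V)`. -/
noncomputable def logCay (χ : ℂ) (V : CMat2) : CMat2 := lam (-((χ / 2) • V).det) • V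

variable {χ : ℂ} {U V : CMat2} {u : ℝ}

theorem trace_cayInv (χ : ℂ) (U : CMat2) : (cayInv χ U).trace = 0 := by
  have := trace_traceless_sub (h := U) (η := 0) (Matrix.trace_zero _ _)
  rw [sub_zero] at this
  rw [cayInv, Matrix.trace_smul, this, smul_zero]

theorem exp_logCay (hV : V.trace = 0) (hd : ‖((χ / 2) • V).det‖ < 1) :
    NormedSpace.exp (χ • logCay χ V) = cay ((χ / 2) • V) := by
  rw [← exp_lam_smul (by rw [Matrix.trace_smul, hV, smul_zero]) hd, logCay, smul_smul, smul_smul]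
  congr 2
  ring

theorem exp_neg_logCay (hV : V.trace = 0) (hd : ‖((χ / 2) • V).det‖ < 1) :
    NormedSpace.exp (-(χ • logCay χ V)) = cay (-((χ / 2) • V)) := by
  have ha : (-((χ / 2) • V)).trace = 0 := by
    rw [Matrix.trace_neg, Matrix.trace_smul, hV, smul_zero, neg_zero]
  rw [← exp_lam_smul ha (by rwa [det_neg']), logCay, smul_smul, det_neg', smul_neg, smul_smul]
  congr 3
  ring

section

variable (hχ : ‖χ‖ ≤ 2) (hU : ‖U‖ ≤ u) (hu : u ≤ 1 / 16)
include hχ hU hu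

theorem norm_one_add_trace : 15 / 16 ≤ ‖1 + χ * U.trace / 4‖ := by
  have h1 := norm_trace_le U
  have h2 : ‖χ * U.trace / 4‖ ≤ 1 / 16 := by
    rw [norm_div, norm_mul]
    have : ‖(4 : ℂ)‖ = 4 := by simp
    rw [this]
    nlinarith [norm_nonneg χ, norm_nonneg U.trace]
  have h3 := norm_sub_norm_le (1 : ℂ) (-(χ * U.trace / 4))
  rw [sub_neg_eq_add, norm_neg, norm_one] at h3
  linarith

theorem one_add_trace_ne_zero : 1 + χ * U.trace / 4 ≠ 0 := by
  have := norm_one_add_trace hχ hU hu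
  rw [← norm_pos_iff]
  linarith

theorem norm_cayInv_le : ‖cayInv χ U‖ ≤ 3 * u := by
  have h0 := norm_one_add_trace hχ hU hu
  have h1 : ‖(U.trace / 2) • (1 : CMat2)‖ ≤ u := by
    rw [norm_smul, norm_one, mul_one, norm_div, Complex.norm_two]
    linarith [norm_trace_le U]
  have h2 := norm_sub_le U ((U.trace / 2) • (1 : CMat2))
  have hu0 : 0 ≤ u := (norm_nonneg _).trans hU
  rw [cayInv, norm_smul, norm_inv]
  have h3 : ‖1 + χ * U.trace / 4‖⁻¹ ≤ 16 / 15 := by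
    rw [inv_le_comm₀ (by linarith) (by norm_num)]
    linarith
  have h4 := mul_le_mul h3 (h2.trans (add_le_add hU h1)) (norm_nonneg _) (by norm_num)
  linarith

theorem norm_half_cayInv_le : ‖(χ / 2) • cayInv χ U‖ ≤ 3 / 16 := by
  have := norm_smul_half_le (k := 1) (by linarith) (norm_cayInv_le hχ hU hu)
  linarith

theorem norm_det_half_cayInv_le : ‖((χ / 2) • cayInv χ U).det‖ ≤ 1 / 4 := by
  have h1 := norm_half_cayInv_le hχ hU hu
  have h2 := norm_det_le_of_trace_zero (a := (χ / 2) • cayInv χ U)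
    (by rw [Matrix.trace_smul, trace_cayInv, smul_zero])
  nlinarith [norm_nonneg ((χ / 2) • cayInv χ U)]

theorem norm_logCay_le : ‖logCay χ (cayInv χ U)‖ ≤ 6 * u := by
  have h1 := norm_lam_le (w := -((χ / 2) • cayInv χ U).det)
    (by rw [norm_neg]; linarith [norm_det_half_cayInv_le hχ hU hu])
  have h2 := norm_cayInv_le hχ hU hu
  rw [logCay, norm_smul]
  have := mul_le_mul h1 h2 (norm_nonneg _) (by norm_num)
  linarith

/-- For `Z = 1 + χ U` of determinant one, `Z + Z⁻¹` is the scalar `tr Z`, so `(Z - 1)(Z + 1)⁻¹ = (Z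
- Z⁻¹) / (2 + tr Z)`. This carries a factor `χ / 2` explicitly, and the quotient is `cayInv`,
regular at `χ = 0`. `Unimod` is the divided form of the determinant condition needed here. -/
theorem cay_cayInv (hun : Unimod χ U) : cay ((χ / 2) • cayInv χ U) = 1 + χ • U := by
  have hβ := one_add_trace_ne_zero hχ hU hu
  have ht : ((χ / 2) • cayInv χ U).trace = 0 := by
    rw [Matrix.trace_smul, trace_cayInv, smul_zero]
  have hd : 1 + ((χ / 2) • cayInv χ U).det ≠ 0 :=
    one_add_det_ne_zero ht (norm_half_cayInv_le hχ hU hu) (by norm_num)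
  have h1 := inv1_mul_one_sub ht hd
  have h2 : (1 - (χ / 2) • cayInv χ U) * (1 + χ • U) = 1 + (χ / 2) • cayInv χ U := by
    set β := 1 + χ * U.trace / 4 with hβd
    have h3 : (χ / 2) • cayInv χ U = β⁻¹ • ((χ / 2) • (U - (U.trace / 2) • (1 : CMat2))) := by
      rw [cayInv, smul_comm]
    have h4 : (β • (1 : CMat2) - (χ / 2) • (U - (U.trace / 2) • (1 : CMat2))) * (1 + χ • U)
        = β • (1 : CMat2) + (χ / 2) • (U - (U.trace / 2) • (1 : CMat2)) := by
      rw [hβd]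
      unfold Unimod at hun
      simp only [Matrix.trace_fin_two, Matrix.det_fin_two] at hun ⊢
      ext i j
      fin_cases i <;> fin_cases j <;> simp [Matrix.mul_apply, Fin.sum_univ_two]
      · linear_combination (χ / 2) * hun
      · ring
      · ring
      · linear_combination (χ / 2) * hun
    have h5 := congrArg (β⁻¹ • ·) h4
    simp only [smul_add, ← smul_mul_assoc, smul_sub, smul_smul, inv_mul_cancel₀ hβ, one_smul] at h5
    rw [h3]
    simp only [smul_sub, smul_smul]
    exact h5
  have hc : (1 + (χ / 2) • cayInv χ U) * inv1 ((χ / 2) • cayInv χ U)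
      = inv1 ((χ / 2) • cayInv χ U) * (1 + (χ / 2) • cayInv χ U) := by
    rw [inv1, mul_smul_comm, smul_mul_assoc]
  rw [cay, hc, ← h2, ← mul_assoc, h1, one_mul]

theorem exp_log_conj (hun : Unimod χ U) :
    NormedSpace.exp (χ • logCay χ (cayInv χ U)) = 1 + χ • U := by
  rw [exp_logCay (trace_cayInv χ U) (by linarith [norm_det_half_cayInv_le hχ hU hu]),
    cay_cayInv hχ hU hu hun]

end

theorem cayInv_mem (hχ : χ.im = 0) (hU : U ∈ realM) : cayInv χ U ∈ realM := by
  have ht := trace_im_eq_zero hU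
  refine smul_mem_realM (im_inv_eq_zero ?_) (realM.sub_mem hU
    (smul_mem_realM (im_div_two_eq_zero ht) realM.one_mem))
  have h4 : (χ * U.trace / 4).im = 0 := by
    rw [div_eq_mul_inv]
    exact im_mul_eq_zero (im_mul_eq_zero hχ ht) (im_inv_eq_zero (by simp))
  rw [Complex.add_im, h4]
  simp

theorem lam_det_im_eq_zero (hχ : χ.im = 0) (hV : V ∈ realM) :
    (lam (-((χ / 2) • V).det)).im = 0 :=
  lam_im_eq_zero (by
    rw [Complex.neg_im, det_im_eq_zero (smul_mem_realM (im_div_two_eq_zero hχ) hV), neg_zero])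

theorem logCay_mem (hχ : χ.im = 0) (hV : V ∈ realM) : logCay χ V ∈ realM :=
  smul_mem_realM (lam_det_im_eq_zero hχ hV) hV

section Differentiability

variable {E : Type*} [NormedAddCommGroup E] [NormedSpace ℂ E] {W : Set E} {F : E → CMat2}
  {χ : E → ℂ}

theorem _root_.DifferentiableOn.cayInv (hF : DifferentiableOn ℂ F W)
    (hχ : DifferentiableOn ℂ χ W) (h : ∀ x ∈ W, 1 + χ x * (F x).trace / 4 ≠ 0) :
    DifferentiableOn ℂ (fun x => cayInv (χ x) (F x)) W := by
  have ht := hF.mtrace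
  have h1 : DifferentiableOn ℂ (fun x => χ x * (F x).trace / 4) W := by
    simp only [div_eq_mul_inv]; exact (hχ.mul ht).mul_const _
  have h2 : DifferentiableOn ℂ (fun x => ((F x).trace / 2) • (1 : CMat2)) W := by
    simp only [div_eq_mul_inv]; exact (ht.mul_const (2 : ℂ)⁻¹).smul_const (1 : CMat2)
  exact ((h1.const_add 1).inv h).smul (hF.sub h2)

theorem _root_.DifferentiableOn.logCay (hF : DifferentiableOn ℂ F W)
    (hχ : DifferentiableOn ℂ χ W) (h : ∀ x ∈ W, ‖((χ x / 2) • F x).det‖ < 1 / 2) :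
    DifferentiableOn ℂ (fun x => logCay (χ x) (F x)) W := by
  have h1 : DifferentiableOn ℂ (fun x => χ x / 2) W := by
    simp only [div_eq_mul_inv]; exact hχ.mul_const _
  have h2 := (h1.smul hF).mdet.neg
  refine (differentiableOn_lam.comp h2 fun x hx => ?_).smul hF
  rw [mem_ball_zero_iff]
  change ‖-((χ x / 2) • F x).det‖ < 1 / 2
  rw [norm_neg]
  exact h x hx

end Differentiability

end CMat2

/-! ### Logarithms of the limit objects. -/

section Conclusion

variable {d : ℕ} {ω : Fin d → ℝ} {c c' ν ρ₀ H₀ : ℝ} {C S : SL2Alg →ₗ[ℝ] SL2Alg}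
  {U : Set (Fin 2 → ℂ)} {χ t : (Fin 2 → ℂ) → ℂ} {f : (Fin 2 → ℂ) → (Fin d → ℂ) → CMat2}

/-- The logarithm of the conjugacy. -/
noncomputable def kamLog (ρ₀ : ℝ) (ω : Fin d → ℝ) (c : ℝ) (C S : SL2Alg →ₗ[ℝ] SL2Alg) (χ t : ℂ)
    (f : (Fin d → ℂ) → CMat2) (z : Fin d → ℂ) : CMat2 :=
  CMat2.logCay χ (CMat2.cayInv χ (kamConj ρ₀ ω c C S χ t f z))

/-- The logarithm of the counterterm. -/
noncomputable def kamCounterLog (ρ₀ : ℝ) (ω : Fin d → ℝ) (c : ℝ) (C S : SL2Alg →ₗ[ℝ] SL2Alg)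
    (χ t : ℂ) (f : (Fin d → ℂ) → CMat2) : CMat2 :=
  CMat2.logCay (χ * t) (kamCounter ρ₀ ω c C S χ t f)

theorem ofRealM_toSL_re {M : CMat2} (hM : M ∈ CMat2.realM) (htr : M.trace = 0) :
    CMat2.ofRealM (toSL (M.map Complex.re) : Mat2) = M := by
  have hre := CMat2.ofRealM_re hM
  set R := M.map Complex.re with hR
  have hRt : R.trace = 0 := by
    have := congrArg Complex.re htr
    rw [Matrix.trace_fin_two, Complex.add_re] at this
    rw [Matrix.trace_fin_two]
    exact this
  have h2 : (toSL (((⟨R, hRt⟩ : SL2Alg)) : Mat2)) = ⟨R, hRt⟩ := toSL_coe _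
  have h3 : (toSL R : Mat2) = R := congrArg Subtype.val h2
  rw [h3, hre]

namespace KamHyp

variable (hyp : KamHyp ω c c' ν ρ₀ H₀ C S U χ t f)
include hyp

theorem four_kamY_le : 4 * kamY c c' ν ρ₀ H₀ ≤ 1 / 16 := by
  have h1 := hyp.hτ
  have h2 : 0 ≤ kamQ c c' ν ρ₀ * H₀ := mul_nonneg (by linarith [hyp.two_le_kamQ]) hyp.hH₀
  rw [kamTau] at h1
  linarith

theorem log_family : FH U (ρ₀ / 2) (24 * kamY c c' ν ρ₀ H₀)
    (fun ζ => kamLog ρ₀ ω c C S (χ ζ) (t ζ) (f ζ)) where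
  diff := by
    have hb := fun (p : (Fin 2 → ℂ) × (Fin d → ℂ)) (hp : p ∈ U ×ˢ strip d (ρ₀ / 2)) =>
      hyp.conj_family.bound p.1 hp.1 p.2 hp.2
    have hχ := differentiableOn_comp_fst (d := d) hyp.hχ (ρ₀ / 2)
    refine (hyp.conj_family.diff.cayInv hχ fun p hp => ?_).logCay hχ fun p hp => ?_
    · exact CMat2.one_add_trace_ne_zero (hyp.hχ2 _ hp.1) (hb p hp) hyp.four_kamY_le
    · linarith [CMat2.norm_det_half_cayInv_le (hyp.hχ2 _ hp.1) (hb p hp) hyp.four_kamY_le]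
  bound := fun ζ hζ z hz =>
    (CMat2.norm_logCay_le (hyp.hχ2 ζ hζ) (hyp.conj_family.bound ζ hζ z hz)
      hyp.four_kamY_le).trans (le_of_eq (by ring))
  per := fun ζ hζ z hz k => by
    simp only [kamLog, hyp.conj_family.per ζ hζ z hz k]

theorem norm_det_counter_le {ζ : Fin 2 → ℂ} (hζ : ζ ∈ U) :
    ‖((χ ζ * t ζ / 2) • kamCounter ρ₀ ω c C S (χ ζ) (t ζ) (f ζ)).det‖ ≤ 1 / 16 := by
  have h1 := hyp.norm_smul_counter_le hζ
  have h2 := CMat2.norm_det_le_of_trace_zero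
    (a := (χ ζ * t ζ / 2) • kamCounter ρ₀ ω c C S (χ ζ) (t ζ) (f ζ))
    (by rw [Matrix.trace_smul, hyp.trace_counter hζ, smul_zero])
  have h3 := hyp.hτ
  nlinarith [norm_nonneg ((χ ζ * t ζ / 2) • kamCounter ρ₀ ω c C S (χ ζ) (t ζ) (f ζ))]

theorem differentiableOn_counterLog :
    DifferentiableOn ℂ (fun ζ => kamCounterLog ρ₀ ω c C S (χ ζ) (t ζ) (f ζ)) U :=
  hyp.differentiableOn_counter.logCay (hyp.hχ.mul hyp.ht) fun ζ hζ => by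
    linarith [hyp.norm_det_counter_le hζ]

theorem exp_log {ζ : Fin 2 → ℂ} (hζ : ζ ∈ U) {z : Fin d → ℂ} (hz : z ∈ strip d (ρ₀ / 2)) :
    NormedSpace.exp (χ ζ • kamLog ρ₀ ω c C S (χ ζ) (t ζ) (f ζ) z)
      = 1 + χ ζ • kamConj ρ₀ ω c C S (χ ζ) (t ζ) (f ζ) z :=
  CMat2.exp_log_conj (hyp.hχ2 ζ hζ) (hyp.conj_family.bound ζ hζ z hz) hyp.four_kamY_le
    (hyp.unimod_conj hζ hz)

theorem conjugacy_exp {ζ : Fin 2 → ℂ} (hζ : ζ ∈ U) {z : Fin d → ℂ}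
    (hz : z ∈ strip d (ρ₀ / 2)) :
    (1 + t ζ • CMat2.ofRealM (nilpotentA c : Mat2))
        * (NormedSpace.exp ((χ ζ * t ζ) • f ζ z)
          * NormedSpace.exp (-((χ ζ * t ζ) • kamCounterLog ρ₀ ω c C S (χ ζ) (t ζ) (f ζ)))
          * NormedSpace.exp (χ ζ • kamLog ρ₀ ω c C S (χ ζ) (t ζ) (f ζ) z))
      = NormedSpace.exp (χ ζ • kamLog ρ₀ ω c C S (χ ζ) (t ζ) (f ζ) (z + toC ω))
        * (1 + t ζ • CMat2.ofRealM (nilpotentA c : Mat2)) := by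
  rw [hyp.exp_log hζ hz, hyp.exp_log hζ (add_toC_mem_strip hz ω), kamCounterLog,
    CMat2.exp_neg_logCay (hyp.trace_counter hζ) (by linarith [hyp.norm_det_counter_le hζ])]
  exact hyp.conjugacy hζ hz

variable {ζ : Fin 2 → ℂ} (hζ : ζ ∈ U) (hχ : (χ ζ).im = 0) (ht : (t ζ).im = 0)
  (hf : ∀ x, f ζ (toC x) ∈ CMat2.realM)
include hζ hχ ht hf

theorem ofRealM_log (x : Fin d → ℝ) :
    CMat2.ofRealM (toSL ((kamLog ρ₀ ω c C S (χ ζ) (t ζ) (f ζ) (toC x)).map Complex.re) : Mat2)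
      = kamLog ρ₀ ω c C S (χ ζ) (t ζ) (f ζ) (toC x) := by
  have hm : kamLog ρ₀ ω c C S (χ ζ) (t ζ) (f ζ) (toC x) ∈ CMat2.realM :=
    CMat2.logCay_mem hχ (CMat2.cayInv_mem hχ (hyp.conj_real hζ hχ ht hf x))
  have htr : (kamLog ρ₀ ω c C S (χ ζ) (t ζ) (f ζ) (toC x)).trace = 0 := by
    rw [kamLog, CMat2.logCay, Matrix.trace_smul, CMat2.trace_cayInv, smul_zero]
  exact ofRealM_toSL_re hm htr

/-- On trace-zero matrices `logCay` multiplies by a scalar, which is real for real data. The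
logarithm therefore stays on the line of the counterterm, inside the fixed space of `C`. -/
theorem counterLog_spec :
    CMat2.ofRealM (toSL ((kamCounterLog ρ₀ ω c C S (χ ζ) (t ζ) (f ζ)).map Complex.re) : Mat2)
        = kamCounterLog ρ₀ ω c C S (χ ζ) (t ζ) (f ζ) ∧
      C (toSL ((kamCounterLog ρ₀ ω c C S (χ ζ) (t ζ) (f ζ)).map Complex.re))
        = toSL ((kamCounterLog ρ₀ ω c C S (χ ζ) (t ζ) (f ζ)).map Complex.re) := by
  obtain ⟨y, hy, hκ⟩ := hyp.counter_real hζ hχ ht hf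
  have hs : (χ ζ * t ζ).im = 0 := CMat2.im_mul_eq_zero hχ ht
  have hm : kamCounter ρ₀ ω c C S (χ ζ) (t ζ) (f ζ) ∈ CMat2.realM := by
    rw [← hκ]; exact CMat2.ofRealM_mem _
  have hl := CMat2.lam_det_im_eq_zero hs hm
  set k := CMat2.lam (-((χ ζ * t ζ / 2) • kamCounter ρ₀ ω c C S (χ ζ) (t ζ) (f ζ)).det) with hk
  have hkr : k = (k.re : ℂ) := Complex.ext rfl (by simpa using hl)
  have e : kamCounterLog ρ₀ ω c C S (χ ζ) (t ζ) (f ζ)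
      = CMat2.ofRealM ((k.re • y : SL2Alg) : Mat2) := by
    have e1 : CMat2.ofRealM ((k.re • y : SL2Alg) : Mat2) = (k.re : ℂ) • CMat2.ofRealM (y : Mat2) :=
      CMat2.ofRealM_smul _ _
    rw [e1, ← hkr, hκ]
    rfl
  have e2 : toSL ((kamCounterLog ρ₀ ω c C S (χ ζ) (t ζ) (f ζ)).map Complex.re) = k.re • y := by
    rw [e]
    have : (CMat2.ofRealM ((k.re • y : SL2Alg) : Mat2)).map Complex.re
        = ((k.re • y : SL2Alg) : Mat2) := by
      ext i j
      exact Complex.ofReal_re _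
    rw [this, toSL_coe]
  rw [e2, e]
  exact ⟨rfl, by rw [map_smul, hy]⟩

end KamHyp

end Conclusion

/-! ### Extensions of real data and identity theorems in the parameters. -/

section Extension

variable {d : ℕ} {ρ M : ℝ}

theorem BH.hext (hρ : 0 < ρ) {X : (Fin d → ℝ) → SL2Alg} (hper : TorusPeriodic 1 X)
    (hX : StripNormLE ρ (fun x => (X x : Mat2)) M) : BH ρ M (hext ρ X) := by
  obtain ⟨h1, h2, h3⟩ := hext_spec hρ hX
  refine ⟨h1, h3, fun z hz k => ?_⟩
  have hk : (fun i => (k i : ℂ)) = toC (fun i => (k i : ℝ)) := by ext i; simp [toC]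
  refine eqOn_strip_of_eq_real hρ (f := fun z => _root_.hext ρ X (z + fun i => (k i : ℂ)))
    (h1.comp (by fun_prop) fun w hw => ?_) h1 (fun x => ?_) hz
  · rw [hk]; exact add_toC_mem_strip hw _
  · rw [← toC_add_int, h2, h2, hper x k]

theorem trace_hext (hρ : 0 < ρ) {X : (Fin d → ℝ) → SL2Alg}
    (hX : StripNormLE ρ (fun x => (X x : Mat2)) M) {z : Fin d → ℂ} (hz : z ∈ strip d ρ) :
    (hext ρ X z).trace = 0 := by
  obtain ⟨h1, h2, -⟩ := hext_spec hρ hX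
  have := eqOn_strip_of_eq_real hρ (f := fun z => hext ρ X z 0 0 + hext ρ X z 1 1)
    (g := fun _ => 0) ((h1.entry 0 0).add (h1.entry 1 1)) (differentiableOn_const _)
    (fun x => by
      simp only [h2, CMat2.ofRealM_apply, Matrix.map_apply, SL2Alg.entry11]
      simp) hz
  rw [Matrix.trace_fin_two]
  exact this

theorem eqOn_ball_of_eq_real {n : ℕ} {G : Type*} [NormedAddCommGroup G] [NormedSpace ℂ G]
    [CompleteSpace G] {δ : ℝ} {φ ψ : (Fin n → ℂ) → G} (hφ : DifferentiableOn ℂ φ (ball 0 δ))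
    (hψ : DifferentiableOn ℂ ψ (ball 0 δ))
    (h : ∀ x : Fin n → ℝ, ‖x‖ < δ → φ (toC x) = ψ (toC x)) : EqOn φ ψ (ball 0 δ) := by
  intro ζ hζ
  rw [← sub_eq_zero, ← toC_re_add ζ]
  have hre : toC (fun i => (ζ i).re) ∈ ball (0 : Fin n → ℂ) δ := by
    rw [mem_ball_zero_iff] at hζ ⊢
    refine lt_of_le_of_lt ?_ hζ
    rw [norm_toC]
    refine (pi_norm_le_iff_of_nonneg (norm_nonneg _)).2 fun i => ?_
    exact (Complex.abs_re_le_norm _).trans (norm_le_pi_norm ζ i)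
  refine eq_zero_of_eq_zero_on_real_line isOpen_ball (convex_ball 0 δ) (hφ.sub hψ)
    hre (by rwa [toC_re_add]) fun s hs => ?_
  have e : toC (fun i => (ζ i).re) + (s : ℂ) • toC (fun i => (ζ i).im)
      = toC (fun i => (ζ i).re + s * (ζ i).im) := by
    ext i; simp [toC]
  rw [e] at hs ⊢
  rw [mem_ball_zero_iff, norm_toC] at hs
  exact sub_eq_zero.2 (h _ hs)

end Extension

/-! ### Choice of the constants. -/

section Constants

/-- The ratio between `kamTau` and the size of the perturbation. -/
noncomputable def kamSlope (c c' ν ρ₀ : ℝ) : ℝ :=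
  16 * (120 * coefBound c c' * (4 / ρ₀) ^ ν) + 4 * kamQ c c' ν ρ₀

/-- The size of the perturbations to which the iteration applies. -/
noncomputable def kamSize (c c' ν ρ₀ : ℝ) : ℝ :=
  min (1 / 4) (kamRate ν / (120 * kamQ c c' ν ρ₀)) / kamSlope c c' ν ρ₀

/-- The constant in the bound of the logarithm of the conjugacy. -/
noncomputable def kamConst (c c' ν : ℝ) : ℝ := 24 * 120 * 4 * coefBound c c' * 4 ^ ν

variable {c c' ν ρ₀ : ℝ}

theorem coefBound_pos (hc' : 0 < c') : 0 < coefBound c c' := by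
  unfold coefBound; positivity

theorem kamConst_pos (hc' : 0 < c') : 0 < kamConst c c' ν := by
  have := coefBound_pos (c := c) hc'
  unfold kamConst; positivity

theorem kamQ_pos (hρ₀ : 0 < ρ₀) (hc' : 0 < c') : 0 < kamQ c c' ν ρ₀ := by
  have := projBound_nonneg (c := c) (ν := ν) hρ₀ hc'
  unfold kamQ; linarith

theorem kamSlope_pos (hρ₀ : 0 < ρ₀) (hc' : 0 < c') : 0 < kamSlope c c' ν ρ₀ := by
  have h1 := coefBound_pos (c := c) hc'
  have h2 := kamQ_pos (c := c) (ν := ν) hρ₀ hc'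
  unfold kamSlope; positivity

theorem kamSize_pos (hρ₀ : 0 < ρ₀) (hc' : 0 < c') (hν : 0 < ν) : 0 < kamSize c c' ν ρ₀ := by
  have h1 := kamSlope_pos (c := c) (ν := ν) hρ₀ hc'
  have h2 := kamQ_pos (c := c) (ν := ν) hρ₀ hc'
  have h3 := (kamRate_le hν).1
  unfold kamSize; positivity

/-- `kamTau` is linear in the size of the perturbation with slope `kamSlope`; `kamSize` is the size
at which it meets both smallness conditions of `KamHyp`. -/
theorem kamTau_kamSize (hρ₀ : 0 < ρ₀) (hc' : 0 < c') :
    kamTau c c' ν ρ₀ (kamSize c c' ν ρ₀)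
      = min (1 / 4) (kamRate ν / (120 * kamQ c c' ν ρ₀)) := by
  have h1 := (kamSlope_pos (c := c) (ν := ν) hρ₀ hc').ne'
  have : kamTau c c' ν ρ₀ (kamSize c c' ν ρ₀)
      = kamSize c c' ν ρ₀ * kamSlope c c' ν ρ₀ := by
    rw [kamTau, kamY, kamSlope]; ring
  rw [this, kamSize, div_mul_cancel₀ _ h1]

/-- `coefBound` does not involve `ρ₀`, so the only dependence on the width is the power `ρ₀ ^ (-ν)`.
-/
theorem kamY_four_mul (hρ₀ : 0 < ρ₀) (ε : ℝ) :
    24 * kamY c c' ν ρ₀ (4 * ε) = kamConst c c' ν * ε * ρ₀ ^ (-ν) := by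
  rw [kamY, kamConst, Real.div_rpow four_pos.le hρ₀.le, Real.rpow_neg hρ₀.le]
  ring

variable {d : ℕ} {ω : Fin d → ℝ} {C S : SL2Alg →ₗ[ℝ] SL2Alg}
  {U : Set (Fin 2 → ℂ)} {χ t : (Fin 2 → ℂ) → ℂ} {f : (Fin 2 → ℂ) → (Fin d → ℂ) → CMat2}

theorem kamHyp_of_kamSize (hρ₀ : 0 < ρ₀) (hc' : 0 < c') (hν : 0 < ν)
    (adm : IsAdmissible ω (nilpotentA c) C S c' ν ρ₀) (hU : IsOpen U)
    (hf : FH U ρ₀ (kamSize c c' ν ρ₀ / 2) f)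
    (htr : ∀ ζ ∈ U, ∀ z ∈ strip d ρ₀, (f ζ z).trace = 0)
    (hχ : DifferentiableOn ℂ χ U) (hχ2 : ∀ ζ ∈ U, ‖χ ζ‖ ≤ 2)
    (ht : DifferentiableOn ℂ t U) (ht2 : ∀ ζ ∈ U, ‖t ζ‖ ≤ 2) :
    KamHyp ω c c' ν ρ₀ (kamSize c c' ν ρ₀) C S U χ t f where
  hρ₀ := hρ₀
  hc' := hc'
  hν := hν
  adm := adm
  hU := hU
  hf := hf
  htr := htr
  hχ := hχ
  hχ2 := hχ2
  ht := ht
  ht2 := ht2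
  hH₀ := (kamSize_pos hρ₀ hc' hν).le
  hτ := by rw [kamTau_kamSize hρ₀ hc']; exact min_le_left _ _
  hτθ := by
    rw [kamTau_kamSize hρ₀ hc']
    have h2 := kamQ_pos (c := c) (ν := ν) hρ₀ hc'
    calc 120 * min (1 / 4) (kamRate ν / (120 * kamQ c c' ν ρ₀)) * kamQ c c' ν ρ₀
        ≤ 120 * (kamRate ν / (120 * kamQ c c' ν ρ₀)) * kamQ c c' ν ρ₀ := by
          gcongr; exact min_le_right _ _
      _ = kamRate ν := by field_simp

end Constants

/-! ### The conjugacy for a single real perturbation. -/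

section RealConjugacy

variable {d : ℕ} {ω : Fin d → ℝ} {c c' ν ρ₀ : ℝ} {C S : SL2Alg →ₗ[ℝ] SL2Alg} {p : ℕ}

/-- The counterterm `ξ*` of a real perturbation. -/
noncomputable def counterterm (ρ₀ : ℝ) (ω : Fin d → ℝ) (c : ℝ) (C S : SL2Alg →ₗ[ℝ] SL2Alg)
    (p : ℕ) (f : (Fin d → ℝ) → SL2Alg) (χ : ℝ) : SL2Alg :=
  toSL ((kamCounterLog ρ₀ ω c C S (χ : ℂ) ((χ : ℂ) ^ p) (hext ρ₀ f)).map Complex.re)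

/-- The logarithm of the conjugacy of a real perturbation. -/
noncomputable def conjugacyLog (ρ₀ : ℝ) (ω : Fin d → ℝ) (c : ℝ) (C S : SL2Alg →ₗ[ℝ] SL2Alg)
    (p : ℕ) (f : (Fin d → ℝ) → SL2Alg) (χ : ℝ) (x : Fin d → ℝ) : SL2Alg :=
  toSL ((kamLog ρ₀ ω c C S (χ : ℂ) ((χ : ℂ) ^ p) (hext ρ₀ f) (toC x)).map Complex.re)

theorem conjugacyLog_spec (hρ₀ : 0 < ρ₀) (hc' : 0 < c') (hν : 0 < ν)
    (adm : IsAdmissible ω (nilpotentA c) C S c' ν ρ₀) {f : (Fin d → ℝ) → SL2Alg} {χ : ℝ}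
    (hper : TorusPeriodic 1 f)
    (hf : StripNormLE ρ₀ (fun x => (f x : Mat2)) (kamSize c c' ν ρ₀ / 4)) (hχ : |χ| ≤ 1) :
    C (counterterm ρ₀ ω c C S p f χ) = counterterm ρ₀ ω c C S p f χ ∧
    TorusPeriodic 2 (conjugacyLog ρ₀ ω c C S p f χ) ∧
    StripNormLE (ρ₀ / 2) (fun x => (conjugacyLog ρ₀ ω c C S p f χ x : Mat2))
      (24 * kamY c c' ν ρ₀ (kamSize c c' ν ρ₀)) ∧
    AnalyticallyConjugatedBy ω
      (fun x => NormedSpace.exp (χ ^ p • (nilpotentA c : Mat2))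
        * NormedSpace.exp (χ ^ (p + 1) • (f x : Mat2))
        * NormedSpace.exp (-(χ ^ (p + 1) • (counterterm ρ₀ ω c C S p f χ : Mat2))))
      (fun _ => NormedSpace.exp (χ ^ p • (nilpotentA c : Mat2)))
      (fun x => NormedSpace.exp (χ • (conjugacyLog ρ₀ ω c C S p f χ x : Mat2))) := by
  have hn : ‖(χ : ℂ)‖ ≤ 1 := by rwa [Complex.norm_real]
  have hnp : ‖(χ : ℂ) ^ p‖ ≤ 1 := by rw [norm_pow]; exact pow_le_one₀ (norm_nonneg _) hn
  have hbh := BH.hext hρ₀ hper hf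
  have hsz := kamSize_pos (c := c) hρ₀ hc' hν
  -- A single perturbation is a constant family over the whole parameter space, so the results for
  -- families apply at any parameter, here `0`.
  have hyp : KamHyp ω c c' ν ρ₀ (kamSize c c' ν ρ₀) C S univ (fun _ => (χ : ℂ))
      (fun _ => (χ : ℂ) ^ p) (fun _ => hext ρ₀ f) :=
    kamHyp_of_kamSize hρ₀ hc' hν adm isOpen_univ
      (hbh.family.mono le_rfl (by linarith)) (fun _ _ z hz => trace_hext hρ₀ hf hz)
      (differentiableOn_const _) (fun _ _ => hn.trans one_le_two)
      (differentiableOn_const _) (fun _ _ => hnp.trans one_le_two)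
  have hζ : (0 : Fin 2 → ℂ) ∈ (univ : Set (Fin 2 → ℂ)) := mem_univ _
  have hpc : (χ : ℂ) ^ p = ((χ ^ p : ℝ) : ℂ) := by push_cast; rfl
  have him : ((χ : ℂ)).im = 0 := Complex.ofReal_im _
  have himp : ((χ : ℂ) ^ p).im = 0 := by rw [hpc]; exact Complex.ofReal_im _
  have hreal : ∀ x, hext ρ₀ f (toC x) = CMat2.ofRealM (f x : Mat2) := (hext_spec hρ₀ hf).2.1
  have hmem : ∀ x, hext ρ₀ f (toC x) ∈ CMat2.realM := fun x => by
    rw [hreal]; exact CMat2.ofRealM_mem _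
  have hlog := hyp.ofRealM_log hζ him himp hmem
  obtain ⟨hcl, hCfix⟩ := hyp.counterLog_spec hζ him himp hmem
  have hσ : 0 < ρ₀ / 2 := half_pos hρ₀
  have hfam := hyp.log_family.single hζ
  have hcfam := hyp.conj_family.single hζ
  have hX2 : TorusPeriodic 2 (conjugacyLog ρ₀ ω c C S p f χ) := by
    intro x k
    have e : toC (x + fun i => ((2 : ℕ) : ℝ) * (k i : ℝ))
        = toC x + fun i => ((2 * k i : ℤ) : ℂ) := by
      ext i; simp [toC]
    rw [conjugacyLog, conjugacyLog, e, hfam.per _ (toC_mem_strip hσ x)]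
  have hZ : ∀ x, CMat2.ofRealM (NormedSpace.exp (χ • (conjugacyLog ρ₀ ω c C S p f χ x : Mat2)))
      = NormedSpace.exp ((χ : ℂ) • kamLog ρ₀ ω c C S (χ : ℂ) ((χ : ℂ) ^ p) (hext ρ₀ f) (toC x)) :=
    fun x => by
      rw [CMat2.ofRealM_exp, CMat2.ofRealM_smul]
      exact congrArg (fun M => NormedSpace.exp ((χ : ℂ) • M)) (hlog x)
  have hZ' : ∀ x, CMat2.ofRealM (NormedSpace.exp (χ • (conjugacyLog ρ₀ ω c C S p f χ x : Mat2)))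
      = 1 + (χ : ℂ) • kamConj ρ₀ ω c C S (χ : ℂ) ((χ : ℂ) ^ p) (hext ρ₀ f) (toC x) :=
    fun x => (hZ x).trans (hyp.exp_log hζ (toC_mem_strip hσ x))
  have hdet : ∀ x, (NormedSpace.exp (χ • (conjugacyLog ρ₀ ω c C S p f χ x : Mat2))).det = 1 := by
    intro x
    have h1 := CMat2.det_one_add_smul (hyp.unimod_conj hζ (toC_mem_strip hσ x))
    rw [← hZ' x] at h1
    have h2 := RingHom.map_det Complex.ofRealHom
      (NormedSpace.exp (χ • (conjugacyLog ρ₀ ω c C S p f χ x : Mat2)))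
    exact Complex.ofReal_injective (h2.trans (h1.trans Complex.ofReal_one.symm))
  refine ⟨hCfix, hX2, ⟨_, hfam.diff, fun x => (hlog x).symm, hfam.bound⟩,
    ⟨ρ₀ / 2, hσ, fun x k => by simp only [hX2 x k], 1 + 1 * (4 * kamY c c' ν ρ₀ (kamSize c c' ν ρ₀)),
      _, (differentiableOn_const 1).add (hcfam.diff.const_smul (χ : ℂ)), fun x => (hZ' x).symm,
      fun z hz => ?_⟩, hdet, fun x => ?_⟩
  · refine (norm_add_le _ _).trans (add_le_add norm_one.le ?_)
    rw [Pi.smul_apply, norm_smul]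
    exact mul_le_mul hn (hcfam.bound z hz) (norm_nonneg _) zero_le_one
  · have key : NormedSpace.exp (χ ^ p • (nilpotentA c : Mat2))
        * NormedSpace.exp (χ ^ (p + 1) • (f x : Mat2))
        * NormedSpace.exp (-(χ ^ (p + 1) • (counterterm ρ₀ ω c C S p f χ : Mat2)))
        * NormedSpace.exp (χ • (conjugacyLog ρ₀ ω c C S p f χ x : Mat2))
        = NormedSpace.exp (χ • (conjugacyLog ρ₀ ω c C S p f χ (x + ω) : Mat2))
          * NormedSpace.exp (χ ^ p • (nilpotentA c : Mat2)) := by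
      -- The real conjugacy equation is checked after embedding into complex matrices, where it is
      -- `conjugacy_exp` at a real point.
      apply CMat2.ofRealM_injective
      have h := hyp.conjugacy_exp hζ (toC_mem_strip hσ x)
      have hs : (χ : ℂ) * (χ : ℂ) ^ p = ((χ ^ (p + 1) : ℝ) : ℂ) := by push_cast; ring
      have hcl' : CMat2.ofRealM (counterterm ρ₀ ω c C S p f χ : Mat2)
        = kamCounterLog ρ₀ ω c C S (χ : ℂ) ((χ : ℂ) ^ p) (hext ρ₀ f) := hcl
      simp only [← toC_add, ← hZ, ← hcl', hs, hreal] at h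
      rw [map_mul, map_mul, map_mul, map_mul, exp_smul_nilpotentA, map_add, map_one,
        CMat2.ofRealM_smul, ← hpc, CMat2.ofRealM_exp (χ ^ (p + 1) • (f x : Mat2)),
        CMat2.ofRealM_exp (-(χ ^ (p + 1) • (counterterm ρ₀ ω c C S p f χ : Mat2))), map_neg,
        CMat2.ofRealM_smul, CMat2.ofRealM_smul, mul_assoc, mul_assoc, ← mul_assoc (NormedSpace.exp _)]
      exact h
    have hu : IsUnit (NormedSpace.exp (χ • (conjugacyLog ρ₀ ω c C S p f χ (x + ω) : Mat2))).det := by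
      rw [hdet]; exact isUnit_one
    simp only
    rw [mul_assoc, key, ← mul_assoc, Matrix.nonsing_inv_mul _ hu, one_mul]

end RealConjugacy

/-! ### Analytic dependence on parameters. -/

section AnalyticFamilies

variable {d : ℕ} {ω : Fin d → ℝ} {c c' ν ρ₀ ρ : ℝ} {C S : SL2Alg →ₗ[ℝ] SL2Alg} {p : ℕ}

/-- A family of perturbations that depends analytically on two parameters extends to a bounded
holomorphic family of periodic trace-zero functions. -/
theorem exists_holomorphic_family (hρ : 0 < ρ) {ε : ℝ} (hε : 0 < ε)
    {f : (Fin 2 → ℝ) → (Fin d → ℝ) → SL2Alg}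
    (hev : ∀ᶠ ζ in 𝓝 0, TorusPeriodic 1 (f ζ) ∧ StripNormLE ρ (fun x => (f ζ x : Mat2)) ε)
    (hfam : AnalyticFamilyNearZero ρ (fun ζ x => (f ζ x : Mat2))) :
    ∃ (δ : ℝ) (g : (Fin 2 → ℂ) → (Fin d → ℂ) → CMat2), 0 < δ ∧ FH (ball 0 δ) ρ (2 * ε) g ∧
      (∀ ζ ∈ ball (0 : Fin 2 → ℂ) δ, ∀ z ∈ strip d ρ, (g ζ z).trace = 0) ∧
      ∀ ζ : Fin 2 → ℝ, ‖ζ‖ < δ → hext ρ (f ζ) = g (toC ζ) ∧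
        ∀ x, g (toC ζ) (toC x) ∈ CMat2.realM := by
  classical
  obtain ⟨δ₁, M, F, hδ₁, hF, hFM, hFf⟩ := hfam
  obtain ⟨δ₂, hδ₂, hev'⟩ := Metric.eventually_nhds_iff.1 hev
  have htoC0 : toC (0 : Fin 2 → ℝ) = 0 := by ext i; simp [toC]
  have hM : 0 ≤ M := (norm_nonneg _).trans (hFM (0, toC 0) ⟨mem_ball_self hδ₁, toC_mem_strip hρ 0⟩)
  -- The norm bound `ε` is known at real parameters only. On a ball of this radius the Lipschitz
  -- estimate changes `F` by at most `ε` from its value at parameter `0`, which gives `2 ε` at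
  -- complex parameters.
  set δ := min (min δ₁ δ₂) (ε * δ₁ / (2 * M + 1)) with hδ
  have hδ0 : 0 < δ := lt_min (lt_min hδ₁ hδ₂) (by positivity)
  have hle₁ : δ ≤ δ₁ := (min_le_left _ _).trans (min_le_left _ _)
  have hle₂ : δ ≤ δ₂ := (min_le_left _ _).trans (min_le_right _ _)
  have hreal : ∀ ζ : Fin 2 → ℝ, ‖ζ‖ < δ → TorusPeriodic 1 (f ζ) ∧
      StripNormLE ρ (fun x => (f ζ x : Mat2)) ε := fun ζ hζ =>
    hev' (by rw [dist_zero_right]; exact hζ.trans_le hle₂)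
  have hzsec : ∀ ζ ∈ ball (0 : Fin 2 → ℂ) δ₁, DifferentiableOn ℂ (fun z => F (ζ, z)) (strip d ρ) :=
    fun ζ hζ => hF.comp (f := fun z => (ζ, z)) (by fun_prop) fun _ hz => ⟨hζ, hz⟩
  have hsec : ∀ z ∈ strip d ρ, DifferentiableOn ℂ (fun ζ => F (ζ, z)) (ball 0 δ₁) :=
    fun z hz => hF.comp (f := fun ζ => (ζ, z)) (by fun_prop) fun _ hζ => ⟨hζ, hz⟩
  have hFext : ∀ ζ : Fin 2 → ℝ, ‖ζ‖ < δ₁ → ∀ z ∈ strip d ρ, hext ρ (f ζ) z = F (toC ζ, z) :=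
    fun ζ hζ z hz => hext_eq hρ (F := fun z => F (toC ζ, z))
      (hzsec _ (by rwa [mem_ball_zero_iff, norm_toC])) (hFf ζ hζ) hz
  -- Extension by zero off the strip makes `g` agree with `hext` as a function everywhere; the
  -- iteration takes the whole function as its argument, so equality on the strip alone could not be
  -- rewritten.
  set g : (Fin 2 → ℂ) → (Fin d → ℂ) → CMat2 := fun ζ z => if z ∈ strip d ρ then F (ζ, z) else 0
    with hg
  have hgF : ∀ ζ, ∀ z ∈ strip d ρ, g ζ z = F (ζ, z) := fun ζ z hz => if_pos hz
  have hgext : ∀ ζ : Fin 2 → ℝ, ‖ζ‖ < δ₁ → hext ρ (f ζ) = g (toC ζ) := by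
    intro ζ hζ
    funext z
    by_cases hz : z ∈ strip d ρ
    · rw [hgF _ z hz, hFext ζ hζ z hz]
    · rw [hext_of_notMem hz]
      exact (if_neg hz).symm
  have hgsec : ∀ z ∈ strip d ρ, DifferentiableOn ℂ (fun ζ => g ζ z) (ball 0 δ) := fun z hz =>
    ((hsec z hz).mono (ball_subset_ball hle₁)).congr fun ζ _ => hgF ζ z hz
  refine ⟨δ, g, hδ0, ⟨?_, fun ζ hζ z hz => ?_, fun ζ hζ z hz k => ?_⟩, fun ζ hζ z hz => ?_,
    fun ζ hζ => ⟨hgext ζ (hζ.trans_le hle₁), fun x => ?_⟩⟩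
  · exact (hF.mono (prod_mono_left (ball_subset_ball hle₁))).congr fun q hq => hgF _ _ hq.2
  · have hζ₁ := ball_subset_ball hle₁ hζ
    have h1 := norm_sub_le_of_bounded hδ₁ (hsec z hz) (fun w hw => hFM (w, z) ⟨hw, hz⟩) hζ₁
    have h2 : ‖F (0, z)‖ ≤ ε := by
      have := hFext 0 (by rwa [norm_zero]) z hz
      rw [htoC0] at this
      rw [← this]
      exact (hext_spec hρ (hreal 0 (by rwa [norm_zero])).2).2.2 z hz
    have h3 : 2 * M / δ₁ * ‖ζ - 0‖ ≤ ε := by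
      rw [sub_zero]
      have h4 : ‖ζ‖ ≤ ε * δ₁ / (2 * M + 1) :=
        (mem_ball_zero_iff.1 hζ).le.trans (min_le_right _ _)
      calc 2 * M / δ₁ * ‖ζ‖ ≤ 2 * M / δ₁ * (ε * δ₁ / (2 * M + 1)) := by gcongr
        _ = ε * (2 * M / (2 * M + 1)) := by field_simp
        _ ≤ ε * 1 := by
          gcongr
          rw [div_le_one (by positivity)]
          linarith
        _ = ε := mul_one ε
    rw [hgF ζ z hz]
    have h5 := norm_add_le (F (ζ, z) - F (0, z)) (F (0, z))
    rw [sub_add_cancel] at h5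
    linarith
  · have hk : (fun i => (k i : ℂ)) = toC (fun i => (k i : ℝ)) := by ext i; simp [toC]
    have hz' : (z + fun i => (k i : ℂ)) ∈ strip d ρ := by rw [hk]; exact add_toC_mem_strip hz _
    -- Periodicity holds at real parameters and extends to complex ones by the identity theorem in
    -- `ζ`.
    refine eqOn_ball_of_eq_real (hgsec _ hz') (hgsec z hz) (fun ξ hξ => ?_) hζ
    rw [← hgext ξ (hξ.trans_le hle₁)]
    exact (BH.hext hρ (hreal ξ hξ).1 (hreal ξ hξ).2).per z hz k
  · have h := eqOn_ball_of_eq_real (φ := fun ζ => g ζ z 0 0 + g ζ z 1 1) (ψ := fun _ => 0)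
      (((hgsec z hz).entry 0 0).add ((hgsec z hz).entry 1 1)) (differentiableOn_const _)
      (fun ξ hξ => by
        rw [← hgext ξ (hξ.trans_le hle₁), ← Matrix.trace_fin_two]
        exact trace_hext hρ (hreal ξ hξ).2 hz) hζ
    rw [Matrix.trace_fin_two]
    exact h
  · rw [← hgext ζ (hζ.trans_le hle₁), (hext_spec hρ (hreal ζ hζ).2).2.1]
    exact CMat2.ofRealM_mem _

/-- The trace-zero real part of a holomorphic matrix function of two variables is real analytic in
the real variables. -/
theorem analyticAt_toSL_re {Φ : (Fin 2 → ℂ) → CMat2} {δ : ℝ} (hδ : 0 < δ)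
    (hΦ : DifferentiableOn ℂ Φ (ball 0 δ)) :
    AnalyticAt ℝ (fun ζ : Fin 2 → ℝ => (toSL ((Φ (toC ζ)).map Complex.re) : Mat2)) 0 := by
  let ι : (Fin 2 → ℝ) →ₗ[ℝ] (Fin 2 → ℂ) :=
    { toFun := toC
      map_add' := toC_add
      map_smul' := fun a x => by ext i; simp [toC] }
  let κ : CMat2 →ₗ[ℝ] Mat2 :=
    { toFun := fun M => (toSL (M.map Complex.re) : Mat2)
      map_add' := fun M N => by
        have : (M + N).map Complex.re = M.map Complex.re + N.map Complex.re := by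
          ext i j; simp
        rw [this, map_add]; rfl
      map_smul' := fun a M => by
        have : (a • M).map Complex.re = a • M.map Complex.re := by
          ext i j; simp
        rw [this, map_smul]; rfl }
  have h0 : toC (0 : Fin 2 → ℝ) = 0 := by ext i; simp [toC]
  have h1 : AnalyticAt ℝ Φ (toC 0) := by
    rw [h0]
    exact (analyticAt_zero_of_differentiableOn hδ hΦ).restrictScalars
  have h2 : AnalyticAt ℝ (toC : (Fin 2 → ℝ) → Fin 2 → ℂ) 0 :=
    (LinearMap.toContinuousLinearMap ι).analyticAt 0
  have h3 : AnalyticAt ℝ (fun ζ : Fin 2 → ℝ => Φ (toC ζ)) 0 := h1.comp h2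
  exact ((LinearMap.toContinuousLinearMap κ).analyticAt _).comp h3

/-- The iteration is run on the complexified data `g` and `X`, whose outputs are holomorphic. At
real parameters these data coincide with `hext` of `f ζ` and with `χ ζ`, so the outputs are the
objects already assigned to each individual real pair. The bounds by 2 in `KamHyp` leave room for
`‖X‖` and `‖X ^ p‖` to exceed 1 at complex parameters. -/
theorem analytic_dependence (hρ₀ : 0 < ρ₀) (hc' : 0 < c') (hν : 0 < ν)
    (adm : IsAdmissible ω (nilpotentA c) C S c' ν ρ₀)
    {f : (Fin 2 → ℝ) → (Fin d → ℝ) → SL2Alg} {χ : (Fin 2 → ℝ) → ℝ}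
    (hev : ∀ᶠ ζ in 𝓝 0, TorusPeriodic 1 (f ζ) ∧
      StripNormLE ρ₀ (fun x => (f ζ x : Mat2)) (kamSize c c' ν ρ₀ / 4) ∧ |χ ζ| ≤ 1)
    (hfam : AnalyticFamilyNearZero ρ₀ (fun ζ x => (f ζ x : Mat2))) (hχ : AnalyticAt ℝ χ 0) :
    AnalyticAt ℝ (fun ζ => (counterterm ρ₀ ω c C S p (f ζ) (χ ζ) : Mat2)) 0 ∧
      AnalyticFamilyNearZero (ρ₀ / 2)
        (fun ζ x => (conjugacyLog ρ₀ ω c C S p (f ζ) (χ ζ) x : Mat2)) := by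
  obtain ⟨δ₁, g, hδ₁, hg, hgt, hgf⟩ := exists_holomorphic_family hρ₀
    (by have := kamSize_pos (c := c) hρ₀ hc' hν; positivity)
    (hev.mono fun _ h => ⟨h.1, h.2.1⟩) hfam
  obtain ⟨δ₂, hδ₂, X, hX, hXχ⟩ := exists_holomorphic_extension hχ
  have htoC0 : toC (0 : Fin 2 → ℝ) = 0 := by ext i; simp [toC]
  have hX0 : ‖X 0‖ ≤ 1 := by
    have := hXχ 0 (by rwa [norm_zero])
    rw [htoC0] at this
    rw [this, Complex.norm_real]
    exact hev.self_of_nhds.2.2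
  have hXc : ContinuousAt X 0 := (hX.differentiableAt (ball_mem_nhds _ hδ₂)).continuousAt
  have h1 : ∀ᶠ ζ in 𝓝 (0 : Fin 2 → ℂ), ‖X ζ‖ < 2 :=
    hXc.norm.eventually_lt_const (hX0.trans_lt one_lt_two)
  have h2 : ∀ᶠ ζ in 𝓝 (0 : Fin 2 → ℂ), ‖X ζ ^ p‖ < 2 := by
    refine (hXc.pow p).norm.eventually_lt_const ?_
    simp only [Pi.pow_apply, norm_pow]
    exact (pow_le_one₀ (norm_nonneg _) hX0).trans_lt one_lt_two
  obtain ⟨δ₃, hδ₃, h3⟩ := Metric.eventually_nhds_iff.1 (h1.and h2)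
  set δ := min (min δ₁ δ₂) δ₃
  have hδ : 0 < δ := lt_min (lt_min hδ₁ hδ₂) hδ₃
  have hle₁ : δ ≤ δ₁ := (min_le_left _ _).trans (min_le_left _ _)
  have hle₂ : δ ≤ δ₂ := (min_le_left _ _).trans (min_le_right _ _)
  have hle₃ : δ ≤ δ₃ := min_le_right _ _
  have hXd := hX.mono (ball_subset_ball hle₂)
  have hyp : KamHyp ω c c' ν ρ₀ (kamSize c c' ν ρ₀) C S (ball 0 δ) X (fun ζ => X ζ ^ p) g :=
    kamHyp_of_kamSize hρ₀ hc' hν adm isOpen_ball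
      ⟨hg.diff.mono (prod_mono_left (ball_subset_ball hle₁)),
        fun ζ hζ z hz => (hg.bound ζ (ball_subset_ball hle₁ hζ) z hz).trans (by linarith),
        fun ζ hζ => hg.per ζ (ball_subset_ball hle₁ hζ)⟩
      (fun ζ hζ => hgt ζ (ball_subset_ball hle₁ hζ)) hXd
      (fun ζ hζ => (h3 (mem_ball.1 (ball_subset_ball hle₃ hζ))).1.le) (hXd.pow p)
      (fun ζ hζ => (h3 (mem_ball.1 (ball_subset_ball hle₃ hζ))).2.le)
  refine ⟨(analyticAt_toSL_re hδ hyp.differentiableOn_counterLog).congr ?_,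
    δ, _, fun q => kamLog ρ₀ ω c C S (X q.1) (X q.1 ^ p) (g q.1) q.2, hδ, hyp.log_family.diff,
    fun w hw => hyp.log_family.bound w.1 hw.1 w.2 hw.2, fun ζ hζ x => ?_⟩
  · filter_upwards [ball_mem_nhds (0 : Fin 2 → ℝ) hδ] with ζ hζ
    rw [mem_ball_zero_iff] at hζ
    rw [counterterm, (hgf ζ (hζ.trans_le hle₁)).1, hXχ ζ (hζ.trans_le hle₂)]
  · have hζU : toC ζ ∈ ball (0 : Fin 2 → ℂ) δ := by rwa [mem_ball_zero_iff, norm_toC]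
    have hr := hXχ ζ (hζ.trans_le hle₂)
    have him : (X (toC ζ)).im = 0 := by rw [hr]; exact Complex.ofReal_im _
    have himp : (X (toC ζ) ^ p).im = 0 := by
      rw [hr, ← Complex.ofReal_pow]; exact Complex.ofReal_im _
    have h := hyp.ofRealM_log hζU him himp (hgf ζ (hζ.trans_le hle₁)).2 x
    simp only
    rw [conjugacyLog, (hgf ζ (hζ.trans_le hle₁)).1, ← hr]
    exact h.symm

end AnalyticFamilies

end Helpers

theorem mainTheorem9 (d : ℕ) (hd : 0 < d) (c c' ν : ℝ) (hc' : 0 < c') (hν : 0 < ν) :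
    ∃ cTilde : ℝ, 0 < cTilde ∧ ∀ ρ₀ : ℝ, 0 < ρ₀ → ∃ ε : ℝ, 0 < ε ∧
      ∀ (ω : Fin d → ℝ) (C S : SL2Alg →ₗ[ℝ] SL2Alg) (p : ℕ),
        IsAdmissible ω (nilpotentA c) C S c' ν ρ₀ →
        ∃ (Ξ : ((Fin d → ℝ) → SL2Alg) → ℝ → SL2Alg)
          (𝒳 : ((Fin d → ℝ) → SL2Alg) → ℝ → (Fin d → ℝ) → SL2Alg),
          (∀ (f : (Fin d → ℝ) → SL2Alg) (χ : ℝ),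
            TorusPeriodic 1 f → StripNormLE ρ₀ (fun x => (f x : Mat2)) ε → |χ| ≤ 1 →
            C (Ξ f χ) = Ξ f χ ∧
            TorusPeriodic 2 (𝒳 f χ) ∧
            StripNormLE (ρ₀ / 2) (fun x => (𝒳 f χ x : Mat2)) (cTilde * ε * ρ₀ ^ (-ν)) ∧
            AnalyticallyConjugatedBy ω
              (fun x => NormedSpace.exp (χ ^ p • (nilpotentA c : Mat2))
                * NormedSpace.exp (χ ^ (p + 1) • (f x : Mat2))
                * NormedSpace.exp (-(χ ^ (p + 1) • (Ξ f χ : Mat2))))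
              (fun _ => NormedSpace.exp (χ ^ p • (nilpotentA c : Mat2)))
              (fun x => NormedSpace.exp (χ • (𝒳 f χ x : Mat2)))) ∧
          (∀ (f : (Fin 2 → ℝ) → (Fin d → ℝ) → SL2Alg) (χ : (Fin 2 → ℝ) → ℝ),
            (∀ᶠ ζ in 𝓝 0, TorusPeriodic 1 (f ζ) ∧
              StripNormLE ρ₀ (fun x => (f ζ x : Mat2)) ε ∧ |χ ζ| ≤ 1) →
            AnalyticFamilyNearZero ρ₀ (fun ζ x => (f ζ x : Mat2)) →
            AnalyticAt ℝ χ 0 →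
            AnalyticAt ℝ (fun ζ => (Ξ (f ζ) (χ ζ) : Mat2)) 0 ∧
            AnalyticFamilyNearZero (ρ₀ / 2) (fun ζ x => (𝒳 (f ζ) (χ ζ) x : Mat2))) := by
  -- The divisor 4 in `ε` is the product of two losses: a factor 2 in passing to complex parameters
  -- and a factor 2 in the initial error.
  refine ⟨kamConst c c' ν, kamConst_pos hc', fun ρ₀ hρ₀ => ⟨kamSize c c' ν ρ₀ / 4,
    div_pos (kamSize_pos hρ₀ hc' hν) four_pos, fun ω C S p adm => ⟨counterterm ρ₀ ω c C S p,
      conjugacyLog ρ₀ ω c C S p, fun f χ hper hf hχ => ?_, fun f χ hev hfam hχ =>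
        analytic_dependence hρ₀ hc' hν adm hev hfam hχ⟩⟩⟩
  have h := conjugacyLog_spec (p := p) hρ₀ hc' hν adm hper hf hχ
  rwa [← kamY_four_mul hρ₀, mul_div_cancel₀ _ (four_ne_zero (α := ℝ))]
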